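/- Let $R$ be an arbitrary commutative ring (not assumed to contain $\mathbb{Q}$). Let $\Lambda$ be Connes' cyclic category (cyclic objects being covariant functors on $\Lambda$), with its standard functor $j:\Delta^{o}\to\Lambda$, and let $\mathcal{D}(\Lambda,R)$ be the derived category of functors from $\Lambda$ to $R$-modules, with its derived pointwise tensor product $\overset{L}{\otimes}$, computed by homotopically flat replacements. For a complex $E$ of functors $\Lambda\to R\text{-mod}$, let $CH_\bullet(E)$ be the total complex of the standard complex of $j^*E$, that is, of the complex with terms $E(j[n+1])$, $n\ge 0$ (where $[n+1]$ has $n+1$ elements), and with differential $b=\sum_{i=0}^{n}(-1)^i d_i$. Let $$B_E=(1-t)\,s\,N : CH_\bullet(E)\to CH_\bullet(E)[-1]$$ be the Connes–Tsygan differential, where on the term of simplicial degree $n$ the operator $t$ is $(-1)^n$ times the cyclic rotation, $N=1+t+\dots+t^n$, and $s$ is the extra degeneracy. It is a natural map of complexes, and it raises the homological degree by one. Then $CH_\bullet$ preserves homotopically flat replacements, so that both sides of the following are computed by replacements of $E$ and $E'$, and for all $E,E'\in\mathcal{D}(\Lambda,R)$ the Alexander–Whitney map is invertible in $\mathcal{D}(R)$,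 its inverse being the natural Künneth isomorphism $$\kappa: CH_\bullet(E)\overset{L}{\otimes}CH_\bullet(E')\;\cong\; CH_\bullet(E\overset{L}{\otimes}E').$$ This isomorphism is compatible with the Connes–Tsygan differentials: in $\mathcal{D}(R)$ one has $$B_{E\overset{L}{\otimes}E'}\circ\kappa=\kappa[-1]\circ\bigl(B_E\otimes\mathrm{id}+\mathrm{id}\otimes B_{E'}\bigr),$$ with the Koszul sign $(\mathrm{id}\otimes B_{E'})(x\otimes y)=(-1)^{|x|}x\otimes B_{E'}(y)$. -/

import Mathlib

open CategoryTheory MonoidalCategory Opposite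

universe w u

/-! ### The cyclic category -/

/-- Objects of the cyclic category: `⟨n⟩` is the cellular decomposition of the circle with
`n + 1` vertices (written `[n + 1]` when objects are numbered by the number of vertices). -/
@[ext]
structure CyclicCat where
  len : ℕ

namespace CyclicCat

/-- The lift to universal coverings of a degree one map from the circle with `m + 1` vertices to
the circle with `n + 1` vertices: the vertices of the universal coverings are numbered by `ℤ`, in
such a way that the deck transformations are the translations by `m + 1` and `n + 1`. -/
@[ext]
structure Lift (m n : ℕ) where
  toFun : ℤ → ℤ
  monotone' : Monotone toFun
  map_add' : ∀ i, toFun (i + (m + 1)) = toFun i + (n + 1)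

namespace Lift

def id (n : ℕ) : Lift n n where
  toFun := fun i => i
  monotone' := fun _ _ h => h
  map_add' := fun _ => rfl

def comp {l m n : ℕ} (f : Lift l m) (g : Lift m n) : Lift l n where
  toFun := fun i => g.toFun (f.toFun i)
  monotone' := fun _ _ h => g.monotone' (f.monotone' h)
  map_add' := fun i => by rw [f.map_add', g.map_add']

theorem map_add_mul {m n : ℕ} (f : Lift m n) (i k : ℤ) :
    f.toFun (i + k * (m + 1)) = f.toFun i + k * (n + 1) := by
  induction k using Int.induction_on with
  | zero => simp
  | succ k ih =>
    have := f.map_add' (i + k * (m + 1))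
    rw [ih] at this
    rw [show i + ((k : ℤ) + 1) * (m + 1) = i + k * (m + 1) + (m + 1) by ring, this]
    ring
  | pred k ih =>
    have := f.map_add' (i + (-(k : ℤ) - 1) * (m + 1))
    rw [show i + (-(k : ℤ) - 1) * (m + 1) + (m + 1) = i + -k * (m + 1) by ring, ih] at this
    linarith

/-- Two lifts define the same map of circles if and only if they differ by a deck
transformation. -/
instance setoid (m n : ℕ) : Setoid (Lift m n) where
  r f g := ∃ k : ℤ, ∀ i, g.toFun i = f.toFun i + k * (n + 1)
  iseqv :=
    { refl := fun _ => ⟨0, fun _ => by simp⟩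
      symm := fun ⟨k, hk⟩ => ⟨-k, fun i => by rw [hk i]; ring⟩
      trans := fun ⟨k, hk⟩ ⟨l, hl⟩ => ⟨k + l, fun i => by rw [hl i, hk i]; ring⟩ }

end Lift

/-- Morphisms in the cyclic category. -/
def Hom (X Y : CyclicCat) : Type := Quotient (Lift.setoid X.len Y.len)

def compHom {X Y Z : CyclicCat} : Hom X Y → Hom Y Z → Hom X Z :=
  Quotient.map₂ Lift.comp (by
    rintro f f' ⟨k, hk⟩ g g' ⟨l, hl⟩
    refine ⟨k + l, fun i => ?_⟩
    change g'.toFun (f'.toFun i) = g.toFun (f.toFun i) + _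
    rw [hl, hk, g.map_add_mul]
    ring)

instance : Category CyclicCat where
  Hom := Hom
  id X := Quotient.mk _ (Lift.id X.len)
  comp := compHom
  id_comp := by rintro X Y ⟨f⟩; rfl
  comp_id := by rintro X Y ⟨f⟩; rfl
  assoc := by rintro X Y Z W ⟨f⟩ ⟨g⟩ ⟨h⟩; rfl

/-- The morphism of the cyclic category defined by a lift. -/
def ofLift {m n : ℕ} (f : Lift m n) : (⟨m⟩ : CyclicCat) ⟶ ⟨n⟩ := Quotient.mk _ f

theorem ofLift_comp {l m n : ℕ} (f : Lift l m) (g : Lift m n) :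
    ofLift f ≫ ofLift g = ofLift (f.comp g) := rfl

theorem ofLift_eq {m n : ℕ} {f g : Lift m n} (k : ℤ)
    (h : ∀ i, g.toFun i = f.toFun i + k * (n + 1)) : ofLift f = ofLift g :=
  Quotient.sound ⟨k, h⟩

/-! ### The functor from the opposite of the simplex category -/

/-- The periodic extension to `ℤ` of an order preserving map `{0, …, m} → {0, …, n}`. -/
def periodize {m n : ℕ} (g : Fin (m + 1) →o Fin (n + 1)) (k : ℤ) : ℤ :=
  (g (Fin.ofNat (m + 1) (k % (m + 1)).toNat) : ℕ) + (k / (m + 1)) * (n + 1)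

theorem periodize_eq {m n : ℕ} (g : Fin (m + 1) →o Fin (n + 1)) (s : Fin (m + 1)) (q : ℤ) :
    periodize g ((s : ℕ) + q * (m + 1)) = (g s : ℕ) + q * (n + 1) := by
  have hs : ((s : ℕ) : ℤ) < m + 1 := by have := s.isLt; omega
  have h0 : (0 : ℤ) < m + 1 := by omega
  have h1 : (((s : ℕ) : ℤ) + q * (m + 1)) % (m + 1) = (s : ℕ) := by
    rw [Int.add_mul_emod_self_right]
    exact Int.emod_eq_of_lt (by omega) hs
  have h2 : (((s : ℕ) : ℤ) + q * (m + 1)) / (m + 1) = q := by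
    rw [Int.add_mul_ediv_right _ _ h0.ne', Int.ediv_eq_zero_of_lt (by omega) hs, zero_add]
  unfold periodize
  rw [h1, h2]
  congr 4
  ext
  simp

theorem exists_eq_add_mul (m : ℕ) (k : ℤ) :
    ∃ (s : Fin (m + 1)) (q : ℤ), k = (s : ℕ) + q * (m + 1) := by
  have h0 : (0 : ℤ) < m + 1 := by omega
  have h1 := Int.emod_nonneg k h0.ne'
  have h2 := Int.emod_lt_of_pos k h0
  refine ⟨⟨(k % (m + 1)).toNat, by omega⟩, k / (m + 1), ?_⟩
  have := Int.emod_add_mul_ediv k (m + 1)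
  simp only
  rw [Int.toNat_of_nonneg h1]
  linarith

theorem periodize_comp {l m n : ℕ} (g : Fin (l + 1) →o Fin (m + 1))
    (h : Fin (m + 1) →o Fin (n + 1)) (k : ℤ) :
    periodize h (periodize g k) = periodize (h.comp g) k := by
  obtain ⟨s, q, rfl⟩ := exists_eq_add_mul l k
  rw [periodize_eq, periodize_eq, periodize_eq]
  rfl

/-- The number of elements mapped by `g` into `{0, …, r - 1}`. -/
def countLT {m n : ℕ} (g : Fin (m + 1) →o Fin (n + 1)) (r : ℕ) : ℕ :=
  (Finset.univ.filter (fun s => (g s : ℕ) < r)).card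

theorem countLT_le_iff {m n : ℕ} (g : Fin (m + 1) →o Fin (n + 1)) (r : ℕ) (s : Fin (m + 1)) :
    countLT g r ≤ s ↔ r ≤ g s := by
  constructor
  · intro h
    by_contra! h'
    have : Finset.Iic s ⊆ Finset.univ.filter (fun s => (g s : ℕ) < r) := by
      intro x hx
      simp only [Finset.mem_Iic] at hx
      simp only [Finset.mem_filter, Finset.mem_univ, true_and]
      exact lt_of_le_of_lt (g.monotone hx) h'
    have := Finset.card_le_card this
    rw [Fin.card_Iic] at this
    unfold countLT at h
    omega
  · intro h
    have : Finset.univ.filter (fun s => (g s : ℕ) < r) ⊆ Finset.Iio s := by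
      intro x hx
      simp only [Finset.mem_filter, Finset.mem_univ, true_and] at hx
      simp only [Finset.mem_Iio]
      by_contra! h'
      have : (g s : ℕ) ≤ g x := g.monotone h'
      omega
    have := Finset.card_le_card this
    rw [Fin.card_Iio] at this
    exact this

theorem countLT_le {m n : ℕ} (g : Fin (m + 1) →o Fin (n + 1)) (r : ℕ) :
    countLT g r ≤ m + 1 :=
  (Finset.card_le_univ _).trans (by simp)

/-- The map of vertices of universal coverings which is dual to an order preserving map
`g : {0, …, m} → {0, …, n}`: for `0 ≤ r ≤ n`, it sends the vertex `r` to the number of elements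
`s` such that `g s < r`, and it is extended to `ℤ` by periodicity. -/
def dualFun {m n : ℕ} (g : Fin (m + 1) →o Fin (n + 1)) (i : ℤ) : ℤ :=
  countLT g (i % (n + 1)).toNat + (i / (n + 1)) * (m + 1)

theorem dualFun_eq {m n : ℕ} (g : Fin (m + 1) →o Fin (n + 1)) (r : Fin (n + 1)) (q : ℤ) :
    dualFun g ((r : ℕ) + q * (n + 1)) = countLT g r + q * (m + 1) := by
  have hs : ((r : ℕ) : ℤ) < n + 1 := by have := r.isLt; omega
  have h0 : (0 : ℤ) < n + 1 := by omega
  have h1 : (((r : ℕ) : ℤ) + q * (n + 1)) % (n + 1) = (r : ℕ) := by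
    rw [Int.add_mul_emod_self_right]
    exact Int.emod_eq_of_lt (by omega) hs
  have h2 : (((r : ℕ) : ℤ) + q * (n + 1)) / (n + 1) = q := by
    rw [Int.add_mul_ediv_right _ _ h0.ne', Int.ediv_eq_zero_of_lt (by omega) hs, zero_add]
  unfold dualFun
  rw [h1, h2]
  simp

theorem dualFun_le_iff {m n : ℕ} (g : Fin (m + 1) →o Fin (n + 1)) (i k : ℤ) :
    dualFun g i ≤ k ↔ i ≤ periodize g k := by
  obtain ⟨r, q, rfl⟩ := exists_eq_add_mul n i
  obtain ⟨s, t, rfl⟩ := exists_eq_add_mul m k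
  rw [dualFun_eq, periodize_eq]
  have h1 : (countLT g r : ℤ) ≤ m + 1 := by exact_mod_cast countLT_le g r
  have h2 : (0 : ℤ) ≤ countLT g r := by positivity
  have hs : ((s : ℕ) : ℤ) < m + 1 := by have := s.isLt; omega
  have hr : ((r : ℕ) : ℤ) < n + 1 := by have := r.isLt; omega
  have hg : ((g s : ℕ) : ℤ) < n + 1 := by have := (g s).isLt; omega
  have hs0 : (0 : ℤ) ≤ (s : ℕ) := by positivity
  have hr0 : (0 : ℤ) ≤ (r : ℕ) := by positivity
  have hg0 : (0 : ℤ) ≤ (g s : ℕ) := by positivity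
  rcases lt_trichotomy q t with h | rfl | h
  · have e1 : (q + 1) * ((m : ℤ) + 1) ≤ t * (m + 1) :=
      mul_le_mul_of_nonneg_right h (by positivity)
    have e2 : (q + 1) * ((n : ℤ) + 1) ≤ t * (n + 1) :=
      mul_le_mul_of_nonneg_right h (by positivity)
    constructor <;> intro <;> linarith
  · have := countLT_le_iff g r s
    rw [add_le_add_iff_right, add_le_add_iff_right]
    exact_mod_cast this
  · have e1 : (t + 1) * ((m : ℤ) + 1) ≤ q * (m + 1) :=
      mul_le_mul_of_nonneg_right h (by positivity)
    have e2 : (t + 1) * ((n : ℤ) + 1) ≤ q * (n + 1) :=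
      mul_le_mul_of_nonneg_right h (by positivity)
    constructor <;> intro <;> linarith

theorem dualFun_unique {m n : ℕ} (g : Fin (m + 1) →o Fin (n + 1)) (f : ℤ → ℤ)
    (hf : ∀ i k, f i ≤ k ↔ i ≤ periodize g k) (i : ℤ) : dualFun g i = f i :=
  le_antisymm ((dualFun_le_iff g _ _).2 ((hf _ _).1 le_rfl))
    ((hf _ _).2 ((dualFun_le_iff g _ _).1 le_rfl))

/-- The lift `dualFun g`. -/
def dualLift {m n : ℕ} (g : Fin (m + 1) →o Fin (n + 1)) : Lift n m where
  toFun := dualFun g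
  monotone' := fun i j hij => by
    rw [dualFun_le_iff]
    exact hij.trans ((dualFun_le_iff g _ _).1 le_rfl)
  map_add' := fun i => by
    obtain ⟨r, q, rfl⟩ := exists_eq_add_mul n i
    rw [show ((r : ℕ) : ℤ) + q * (n + 1) + (n + 1) = (r : ℕ) + (q + 1) * (n + 1) by ring,
      dualFun_eq, dualFun_eq]
    ring

/-- The functor `j : Δᵒᵖ ⥤ Λ`, which identifies `Δᵒᵖ` with the category of objects of `Λ` with a
chosen vertex. -/
def ofSimplex : SimplexCategoryᵒᵖ ⥤ CyclicCat where
  obj X := ⟨X.unop.len⟩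
  map φ := ofLift (dualLift φ.unop.toOrderHom)
  map_id X := by
    refine ofLift_eq 0 fun i => ?_
    change i = dualFun _ i + _
    rw [zero_mul, add_zero]
    refine (dualFun_unique _ (fun i => i) (fun i k => ?_) i).symm
    obtain ⟨s, q, rfl⟩ := exists_eq_add_mul X.unop.len k
    rw [periodize_eq]
    rfl
  map_comp {X Y Z} φ ψ := by
    rw [ofLift_comp]
    refine ofLift_eq 0 fun i => ?_
    change dualFun _ (dualFun _ i) = dualFun _ i + _
    rw [zero_mul, add_zero]
    refine (dualFun_unique _ (fun i => dualFun _ (dualFun _ i)) (fun i k => ?_) i).symm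
    rw [dualFun_le_iff, dualFun_le_iff, periodize_comp]
    rfl

/-! ### Rotations and extra degeneracies -/

/-- The rotation `k ↦ k + 1` of the circle with `n + 1` vertices. -/
def rot (n : ℕ) : (⟨n⟩ : CyclicCat) ⟶ ⟨n⟩ :=
  ofLift
    { toFun := fun k => k + 1
      monotone' := fun _ _ h => by simpa using h
      map_add' := fun _ => by ring }

/-- The lift of the extra degeneracy: for `0 ≤ k ≤ n`, it sends `k` to `k + 1`. -/
def extraLift (n : ℕ) : Lift n (n + 1) where
  toFun := fun k => k + k / (n + 1) + 1
  monotone' := fun a b h => by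
    have : a / ((n : ℤ) + 1) ≤ b / (n + 1) := Int.ediv_le_ediv (by omega) h
    simp only
    omega
  map_add' := fun k => by
    rw [Int.add_ediv_of_dvd_right (dvd_refl _), Int.ediv_self (by omega)]
    push_cast
    ring

/-- The extra degeneracy: the map from the circle with vertices `0, …, n` to the circle with
vertices `0, …, n + 1` which misses the vertex `0` and preserves the order of the others. -/
def extraDegen (n : ℕ) : (⟨n⟩ : CyclicCat) ⟶ ⟨n + 1⟩ := ofLift (extraLift n)

/-- The `i`-th face map, in the cyclic category. -/
def face {n : ℕ} (i : Fin (n + 2)) : (⟨n + 1⟩ : CyclicCat) ⟶ ⟨n⟩ :=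
  ofSimplex.map (SimplexCategory.δ i).op

end CyclicCat
namespace CyclicCat

/-! ### The cyclic relations -/

/-- An explicit lift of the `i`-th face map. -/
def faceLift {n : ℕ} (i : Fin (n + 2)) : Lift (n + 1) n where
  toFun := fun k => k - (k + (n + 1 - i)) / (n + 2)
  monotone' := fun a b h => by
    have hb : (b + ((n : ℤ) + 1 - i)) / (n + 2) ≤ (a + (n + 1 - i)) / (n + 2) + (b - a) := by
      obtain ⟨d, rfl⟩ : ∃ d : ℕ, b = a + d := ⟨(b - a).toNat, by omega⟩
      rw [← Int.add_mul_ediv_right _ _ (show (n : ℤ) + 2 ≠ 0 by omega)]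
      apply Int.ediv_le_ediv (by omega)
      nlinarith
    simp only
    omega
  map_add' := fun k => by
    rw [show k + (((n + 1 : ℕ) : ℤ) + 1) + (n + 1 - i) = k + (n + 1 - i) + (n + 2) by
      push_cast; ring, Int.add_ediv_of_dvd_right (dvd_refl _), Int.ediv_self (by omega)]
    push_cast
    ring

theorem face_eq {n : ℕ} (i : Fin (n + 2)) : face i = ofLift (faceLift i) := by
  refine ofLift_eq 0 fun k => ?_
  rw [zero_mul, add_zero]
  refine (dualFun_unique _ _ (fun k l => ?_) k).symm
  obtain ⟨s, q, rfl⟩ := exists_eq_add_mul n l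
  rw [show (s : ℕ) + q * ((n : ℤ) + 1) = ((s : ℕ) : ℤ) + q * (n + 1) by rfl]
  have e := periodize_eq (SimplexCategory.δ i).toOrderHom s q
  have hs := s.isLt
  have hi := i.isLt
  have hq : 0 < (n : ℤ) + 2 := by omega
  have key : (faceLift i).toFun k ≤ (s : ℕ) + q * ((n : ℤ) + 1) ↔
      k ≤ ((i.succAbove s : Fin (n + 2)) : ℕ) + q * ((n : ℤ) + 2) := by
    change k - (k + (n + 1 - i)) / (n + 2) ≤ _ ↔ _
    set Q := (k + ((n : ℤ) + 1 - i)) / (n + 2) with hQ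
    have h1 := Int.emod_add_mul_ediv (k + ((n : ℤ) + 1 - i)) (n + 2)
    have h2 := Int.emod_nonneg (k + ((n : ℤ) + 1 - i)) hq.ne'
    have h3 := Int.emod_lt_of_pos (k + ((n : ℤ) + 1 - i)) hq
    rw [← hQ] at h1
    set r := (k + ((n : ℤ) + 1 - i)) % (n + 2)
    have hval : (((i.succAbove s : Fin (n + 2)) : ℕ) : ℤ) =
        (s : ℕ) + if (s : ℕ) < (i : ℕ) then 0 else 1 := by
      by_cases h : (s : ℕ) < i
      · rw [Fin.succAbove_of_castSucc_lt _ _ (by simpa [Fin.lt_def] using h)]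
        simp [h]
      · rw [Fin.succAbove_of_le_castSucc _ _ (by simpa [Fin.le_def] using h)]
        simp [h]
    rw [hval]
    have hs' : ((s : ℕ) : ℤ) < n + 1 := by omega
    have hk : k = r + ((n : ℤ) + 2) * Q - (n + 1 - i) := by linarith
    rcases lt_trichotomy Q q with h | h | h
    · have e1 : ((n : ℤ) + 1) * (Q + 1) ≤ (n + 1) * q :=
        mul_le_mul_of_nonneg_left h (by omega)
      split_ifs <;> constructor <;> intro <;> nlinarith
    · subst h
      split_ifs with h5 <;> constructor <;> intro <;> nlinarith
    · obtain h' | h' : Q = q + 1 ∨ q + 2 ≤ Q := by omega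
      · rw [h'] at hk ⊢
        split_ifs with h5 <;> constructor <;> intro <;> nlinarith
      · have e1 : ((n : ℤ) + 1) * (q + 2) ≤ (n + 1) * Q :=
          mul_le_mul_of_nonneg_left h' (by omega)
        split_ifs <;> constructor <;> intro <;> nlinarith
  rw [key]
  have e2 : periodize (SimplexCategory.δ i).toOrderHom ((s : ℕ) + q * ((n : ℤ) + 1)) =
    ((i.succAbove s : Fin (n + 2)) : ℕ) + q * ((n : ℤ) + 2) := by
    refine e.trans ?_
    push_cast
    rw [show ((n : ℤ) + 1 + 1) = n + 2 by ring]
    rfl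
  rw [← e2]
  rfl

theorem rot_face_succ {n : ℕ} (i : Fin (n + 1)) :
    rot (n + 1) ≫ face i.succ = face i.castSucc ≫ rot n := by
  rw [face_eq, face_eq]
  refine ofLift_eq 0 fun k => ?_
  change k - (k + (n + 1 - ((i.castSucc : Fin (n + 2)) : ℕ))) / (n + 2) + 1 =
    (k + 1) - ((k + 1) + (n + 1 - ((i.succ : Fin (n + 2)) : ℕ))) / (n + 2) + _
  rw [show (k + 1) + ((n : ℤ) + 1 - ((i.succ : Fin (n + 2)) : ℕ)) =
    k + (n + 1 - ((i.castSucc : Fin (n + 2)) : ℕ)) by simp; ring]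
  ring

theorem rot_face_zero (n : ℕ) : rot (n + 1) ≫ face (0 : Fin (n + 2)) = face (Fin.last (n + 1)) := by
  rw [face_eq, face_eq]
  refine ofLift_eq 0 fun k => ?_
  change k - (k + (n + 1 - ((Fin.last (n + 1) : Fin (n + 2)) : ℕ))) / (n + 2) =
    (k + 1) - ((k + 1) + (n + 1 - ((0 : Fin (n + 2)) : ℕ))) / (n + 2) + _
  rw [show (k + 1) + ((n : ℤ) + 1 - ((0 : Fin (n + 2)) : ℕ)) = k + (n + 2) by simp; ring,
    Int.add_ediv_of_dvd_right (dvd_refl _), Int.ediv_self (by omega)]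
  simp

theorem extraDegen_face_zero (n : ℕ) : extraDegen n ≫ face (0 : Fin (n + 2)) = 𝟙 _ := by
  rw [face_eq]
  refine ofLift_eq 0 fun k => ?_
  change k = (k + k / (n + 1) + 1) -
    ((k + k / (n + 1) + 1) + (n + 1 - ((0 : Fin (n + 2)) : ℕ))) / (n + 2) + _
  obtain ⟨s, q, rfl⟩ := exists_eq_add_mul n k
  have hs := s.isLt
  rw [Int.add_mul_ediv_right _ _ (by omega), Int.ediv_eq_zero_of_lt (by omega) (by omega),
    show ((s : ℕ) : ℤ) + q * (n + 1) + (0 + q) + 1 + (n + 1 - ((0 : Fin (n + 2)) : ℕ)) =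
      (s : ℕ) + (q + 1) * (n + 2) by simp; ring,
    Int.add_mul_ediv_right _ _ (by omega), Int.ediv_eq_zero_of_lt (by omega) (by omega)]
  ring

theorem extraDegen_face_succ {n : ℕ} (i : Fin (n + 1)) :
    extraDegen (n + 1) ≫ face (i.castSucc.succ : Fin (n + 3)) =
      face (i.castSucc : Fin (n + 2)) ≫ extraDegen n := by
  rw [face_eq, face_eq]
  refine ofLift_eq 0 fun k => ?_
  have hi := i.isLt
  change (k - (k + (n + 1 - ((i.castSucc : Fin (n + 2)) : ℕ))) / (n + 2)) +
      (k - (k + (n + 1 - ((i.castSucc : Fin (n + 2)) : ℕ))) / (n + 2)) / (n + 1) + 1 =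
    (k + k / ((n + 1 : ℕ) + 1) + 1) - ((k + k / ((n + 1 : ℕ) + 1) + 1) +
      ((n + 1 : ℕ) + 1 - ((i.castSucc.succ : Fin (n + 3)) : ℕ))) / ((n + 1 : ℕ) + 2) + _
  obtain ⟨s, q, rfl⟩ := exists_eq_add_mul (n + 1) k
  have hs := s.isLt
  have c1 : ((s : ℕ) : ℤ) + q * ((n + 1 : ℕ) + 1) = (s : ℕ) + q * (n + 2) := by push_cast; ring
  have c2 : (((i.castSucc.succ : Fin (n + 3)) : ℕ) : ℤ) = (i : ℕ) + 1 := by simp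
  have c3 : (((i.castSucc : Fin (n + 2)) : ℕ) : ℤ) = (i : ℕ) := by simp
  have c4 : (((n + 1 : ℕ) : ℤ) + 1) = n + 2 := by push_cast; ring
  have c5 : (((n + 1 : ℕ) : ℤ) + 2) = n + 3 := by push_cast; ring
  rw [c1, c2, c3, c4, c5]
  have a1 : (((s : ℕ) : ℤ) + q * (n + 2)) / (n + 2) = q := by
    rw [Int.add_mul_ediv_right _ _ (by omega), Int.ediv_eq_zero_of_lt (by omega) (by omega),
      zero_add]
  rw [a1]
  by_cases h : (s : ℕ) ≤ (i : ℕ)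
  · have a2 : (((s : ℕ) : ℤ) + q * (n + 2) + (n + 1 - (i : ℕ))) / (n + 2) = q := by
      rw [show ((s : ℕ) : ℤ) + q * (n + 2) + (n + 1 - (i : ℕ)) =
        ((s : ℕ) + (n + 1 - (i : ℕ))) + q * (n + 2) by ring,
        Int.add_mul_ediv_right _ _ (by omega), Int.ediv_eq_zero_of_lt (by omega) (by omega),
        zero_add]
    have a3 : (((s : ℕ) : ℤ) + q * (n + 2) + q + 1 + (n + 2 - ((i : ℕ) + 1))) / (n + 3) = q := by
      rw [show ((s : ℕ) : ℤ) + q * (n + 2) + q + 1 + (n + 2 - ((i : ℕ) + 1)) =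
        ((s : ℕ) + (n + 2 - (i : ℕ))) + q * (n + 3) by ring,
        Int.add_mul_ediv_right _ _ (by omega), Int.ediv_eq_zero_of_lt (by omega) (by omega),
        zero_add]
    have a4 : (((s : ℕ) : ℤ) + q * (n + 2) - q) / (n + 1) = q := by
      rw [show ((s : ℕ) : ℤ) + q * (n + 2) - q = (s : ℕ) + q * (n + 1) by ring,
        Int.add_mul_ediv_right _ _ (by omega), Int.ediv_eq_zero_of_lt (by omega) (by omega),
        zero_add]
    rw [a2, a3, a4]
    ring
  · have a2 : (((s : ℕ) : ℤ) + q * (n + 2) + (n + 1 - (i : ℕ))) / (n + 2) = q + 1 := by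
      rw [show ((s : ℕ) : ℤ) + q * (n + 2) + (n + 1 - (i : ℕ)) =
        ((s : ℕ) - 1 - (i : ℕ)) + (q + 1) * (n + 2) by ring,
        Int.add_mul_ediv_right _ _ (by omega), Int.ediv_eq_zero_of_lt (by omega) (by omega),
        zero_add]
    have a3 : (((s : ℕ) : ℤ) + q * (n + 2) + q + 1 + (n + 2 - ((i : ℕ) + 1))) / (n + 3) =
        q + 1 := by
      rw [show ((s : ℕ) : ℤ) + q * (n + 2) + q + 1 + (n + 2 - ((i : ℕ) + 1)) =
        ((s : ℕ) - 1 - (i : ℕ)) + (q + 1) * (n + 3) by ring,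
        Int.add_mul_ediv_right _ _ (by omega), Int.ediv_eq_zero_of_lt (by omega) (by omega),
        zero_add]
    have a4 : (((s : ℕ) : ℤ) + q * (n + 2) - (q + 1)) / (n + 1) = q := by
      rw [show ((s : ℕ) : ℤ) + q * (n + 2) - (q + 1) = ((s : ℕ) - 1) + q * (n + 1) by ring,
        Int.add_mul_ediv_right _ _ (by omega), Int.ediv_eq_zero_of_lt (by omega) (by omega),
        zero_add]
    rw [a2, a3, a4]
    ring

/-- The iterates of the rotation. -/
def rotPow (n : ℕ) (j : ℕ) : (⟨n⟩ : CyclicCat) ⟶ ⟨n⟩ :=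
  ofLift
    { toFun := fun k => k + j
      monotone' := fun _ _ h => by simpa using h
      map_add' := fun _ => by ring }

theorem rotPow_zero (n : ℕ) : rotPow n 0 = 𝟙 _ :=
  ofLift_eq 0 fun k => by simp [Lift.id]

theorem rotPow_succ (n j : ℕ) : rotPow n (j + 1) = rot n ≫ rotPow n j :=
  ofLift_eq 0 fun k => by simp [Lift.comp]; ring

theorem rotPow_self (n : ℕ) : rotPow n (n + 1) = 𝟙 _ :=
  ofLift_eq (-1) fun k => by simp [Lift.id]; ring

end CyclicCat
/-! ### The Connes operator of a cyclic object -/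

namespace CyclicObject

open CyclicCat

variable {C : Type*} [Category* C] [Preadditive C] (F : CyclicCat ⥤ C)

/-- The Hochschild differential: the alternating sum of the face maps. -/
def b (n : ℕ) : F.obj ⟨n + 1⟩ ⟶ F.obj ⟨n⟩ :=
  ∑ i : Fin (n + 2), (-1 : ℤ) ^ (i : ℕ) • F.map (face i)

/-- The cyclic operator, with its sign. -/
def t (n : ℕ) : F.obj ⟨n⟩ ⟶ F.obj ⟨n⟩ := (-1 : ℤ) ^ n • F.map (rot n)

/-- The iterates of the cyclic operator. -/
def tPow (n : ℕ) : ℕ → (F.obj ⟨n⟩ ⟶ F.obj ⟨n⟩)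
  | 0 => 𝟙 _
  | j + 1 => t F n ≫ tPow n j

/-- The norm `1 + t + ⋯ + tⁿ`. -/
def normOp (n : ℕ) : F.obj ⟨n⟩ ⟶ F.obj ⟨n⟩ := ∑ j ∈ Finset.range (n + 1), tPow F n j

/-- The Connes operator `B = (1 - t) s N`. -/
def connesB (n : ℕ) : F.obj ⟨n⟩ ⟶ F.obj ⟨n + 1⟩ :=
  normOp F n ≫ F.map (extraDegen n) ≫ (𝟙 _ - t F (n + 1))

/-- The alternating sum of all face maps but the last one. -/
def b' (n : ℕ) : F.obj ⟨n + 1⟩ ⟶ F.obj ⟨n⟩ :=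
  ∑ i : Fin (n + 1), (-1 : ℤ) ^ (i : ℕ) • F.map (face i.castSucc)

theorem b_eq (n : ℕ) :
    b F n = b' F n + (-1 : ℤ) ^ (n + 1) • F.map (face (Fin.last (n + 1))) := by
  rw [b, b', Fin.sum_univ_castSucc]
  simp

theorem t_b (n : ℕ) : t F (n + 1) ≫ b F n =
    b' F n ≫ t F n + (-1 : ℤ) ^ (n + 1) • F.map (face (Fin.last (n + 1))) := by
  rw [b, b', Fin.sum_univ_succ, Preadditive.comp_add, Preadditive.comp_sum,
    Preadditive.sum_comp]
  refine (add_comm _ _).trans ?_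
  congr 1
  · refine Finset.sum_congr rfl fun i _ => ?_
    simp only [t, Preadditive.comp_zsmul, Preadditive.zsmul_comp, ← F.map_comp, rot_face_succ,
      smul_smul]
    congr 1
    simp only [Fin.val_succ]
    ring
  · simp only [t, Preadditive.comp_zsmul, Preadditive.zsmul_comp, ← F.map_comp, rot_face_zero,
      smul_smul]
    simp

theorem one_sub_t_b (n : ℕ) :
    (𝟙 _ - t F (n + 1)) ≫ b F n = b' F n ≫ (𝟙 _ - t F n) := by
  rw [Preadditive.sub_comp, Category.id_comp, t_b, b_eq, Preadditive.comp_sub, Category.comp_id]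
  abel

theorem extraDegen_b' (n : ℕ) :
    F.map (extraDegen (n + 1)) ≫ b' F (n + 1) = 𝟙 _ - b' F n ≫ F.map (extraDegen n) := by
  rw [b', b', Fin.sum_univ_succ, Preadditive.comp_add, Preadditive.comp_sum,
    Preadditive.sum_comp, sub_eq_add_neg, ← Finset.sum_neg_distrib]
  congr 1
  · simp only [Fin.val_zero, pow_zero, one_smul, Fin.castSucc_zero, ← F.map_comp]
    rw [extraDegen_face_zero, F.map_id]
  · refine Finset.sum_congr rfl fun i _ => ?_
    rw [← Fin.succ_castSucc, Preadditive.comp_zsmul, Preadditive.zsmul_comp, ← F.map_comp,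
      ← F.map_comp, extraDegen_face_succ, Fin.val_succ, pow_succ, mul_neg, mul_one, neg_smul]

theorem tPow_add (n i j : ℕ) : tPow F n (i + j) = tPow F n i ≫ tPow F n j := by
  induction i with
  | zero => simp [tPow]
  | succ i ih => rw [show i + 1 + j = (i + j) + 1 by ring, tPow, ih, tPow, Category.assoc]

theorem tPow_eq (n j : ℕ) : tPow F n j = (-1 : ℤ) ^ (n * j) • F.map (rotPow n j) := by
  induction j with
  | zero => simp [tPow, rotPow_zero]
  | succ j ih =>
    rw [tPow, ih, rotPow_succ, t, Preadditive.comp_zsmul, Preadditive.zsmul_comp, smul_smul,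
      F.map_comp]
    congr 1
    ring

theorem tPow_self (n : ℕ) : tPow F n (n + 1) = 𝟙 _ := by
  rw [tPow_eq, rotPow_self, F.map_id, (Nat.even_mul_succ_self n).neg_one_pow, one_smul]

theorem t_norm (n : ℕ) : t F n ≫ normOp F n = normOp F n := by
  have h : ∀ j, t F n ≫ tPow F n j = tPow F n (j + 1) := fun _ => rfl
  rw [normOp, Preadditive.comp_sum]
  simp only [h]
  rw [Finset.sum_range_succ, tPow_self, Finset.sum_range_succ' (fun j => tPow F n j)]
  rfl

theorem norm_t (n : ℕ) : normOp F n ≫ t F n = normOp F n := by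
  have h : ∀ j, tPow F n j ≫ t F n = tPow F n (j + 1) := fun j => by
    rw [tPow_add]
    simp [tPow]
  rw [normOp, Preadditive.sum_comp]
  simp only [h]
  rw [Finset.sum_range_succ, tPow_self, Finset.sum_range_succ' (fun j => tPow F n j)]
  rfl

theorem norm_tPow (n j : ℕ) : normOp F n ≫ tPow F n j = normOp F n := by
  induction j with
  | zero => simp [tPow]
  | succ j ih => rw [tPow, ← Category.assoc, norm_t, ih]

theorem tPow_norm (n j : ℕ) : tPow F n j ≫ normOp F n = normOp F n := by
  induction j with
  | zero => simp [tPow]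
  | succ j ih => rw [tPow, Category.assoc, ih, t_norm]

theorem tPow_face (n : ℕ) (i : ℕ) (hi : i < n + 2) :
    tPow F (n + 1) i ≫ ((-1 : ℤ) ^ i • F.map (face (⟨i, hi⟩ : Fin (n + 2)))) =
      F.map (face (0 : Fin (n + 2))) ≫ tPow F n i := by
  induction i with
  | zero => simp [tPow]
  | succ i ih =>
    have h1 : t F (n + 1) ≫ ((-1 : ℤ) ^ (i + 1) • F.map (face (⟨i + 1, hi⟩ : Fin (n + 2)))) =
        ((-1 : ℤ) ^ i • F.map (face (⟨i, by omega⟩ : Fin (n + 2)))) ≫ t F n := by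
      have := rot_face_succ (⟨i, by omega⟩ : Fin (n + 1))
      simp only [Fin.succ_mk, Fin.castSucc_mk] at this
      simp only [t, Preadditive.comp_zsmul, Preadditive.zsmul_comp, ← F.map_comp, this, smul_smul]
      congr 1
      ring
    rw [tPow_add]
    simp only [tPow, Category.comp_id, Category.assoc]
    rw [h1, ← Category.assoc, ih, Category.assoc]
    have h2 : tPow F n i ≫ tPow F n 1 = tPow F n 1 ≫ tPow F n i := by
      rw [← tPow_add, ← tPow_add, add_comm]
    simp only [tPow, Category.comp_id] at h2
    rw [h2]

theorem norm_b' (n : ℕ) : normOp F (n + 1) ≫ b' F n = b F n ≫ normOp F n := by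
  have hl : normOp F (n + 1) ≫ b' F n =
      normOp F (n + 1) ≫ F.map (face (0 : Fin (n + 2))) ≫ normOp F n := by
    rw [b', normOp.eq_def F n, Preadditive.comp_sum, Preadditive.comp_sum, Preadditive.comp_sum,
      ← Fin.sum_univ_eq_sum_range
        (fun j => normOp F (n + 1) ≫ F.map (face (0 : Fin (n + 2))) ≫ tPow F n j)]
    refine Finset.sum_congr rfl fun i _ => ?_
    rw [← tPow_face F n i (by omega), ← Category.assoc, norm_tPow]
    rfl
  have hr : b F n ≫ normOp F n =
      normOp F (n + 1) ≫ F.map (face (0 : Fin (n + 2))) ≫ normOp F n := by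
    have h1 : ∀ i : ℕ, ∀ hi : i < n + 2,
        ((-1 : ℤ) ^ i • F.map (face (⟨i, hi⟩ : Fin (n + 2)))) ≫ normOp F n =
          tPow F (n + 1) (n + 2 - i) ≫ F.map (face (0 : Fin (n + 2))) ≫ normOp F n := by
      intro i hi
      have h2 := tPow_face F n i hi
      have h3 : tPow F (n + 1) (n + 2 - i) ≫ tPow F (n + 1) i = 𝟙 _ := by
        rw [← tPow_add, show n + 2 - i + i = n + 1 + 1 by omega, tPow_self]
      calc _ = (tPow F (n + 1) (n + 2 - i) ≫ tPow F (n + 1) i) ≫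
            ((-1 : ℤ) ^ i • F.map (face (⟨i, hi⟩ : Fin (n + 2)))) ≫ normOp F n := by
            rw [h3, Category.id_comp]
        _ = tPow F (n + 1) (n + 2 - i) ≫ (tPow F (n + 1) i ≫
            ((-1 : ℤ) ^ i • F.map (face (⟨i, hi⟩ : Fin (n + 2))))) ≫ normOp F n := by
            simp only [Category.assoc]
        _ = _ := by rw [h2, Category.assoc, tPow_norm]
    rw [b, Preadditive.sum_comp, normOp.eq_def F (n + 1), Preadditive.sum_comp]
    rw [Finset.sum_congr rfl (fun (i : Fin (n + 2)) _ => h1 i i.isLt),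
      Fin.sum_univ_eq_sum_range
        (fun i => tPow F (n + 1) (n + 2 - i) ≫ F.map (face (0 : Fin (n + 2))) ≫ normOp F n)]
    refine (Finset.sum_range_succ' _ (n + 1)).trans
      (Eq.trans ?_ (Finset.sum_range_succ' _ (n + 1)).symm)
    congr 1
    · rw [← Finset.sum_range_reflect
        (fun i => tPow F (n + 1) (i + 1) ≫ F.map (face (0 : Fin (n + 2))) ≫ normOp F n)]
      refine Finset.sum_congr rfl fun i hi => ?_
      rw [Finset.mem_range] at hi
      rw [show n + 2 - (i + 1) = n + 1 - 1 - i + 1 by omega]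
    · rw [Nat.sub_zero, tPow_self]
      rfl
  rw [hl, hr]

theorem connesB_b_zero : connesB F 0 ≫ b F 0 = 0 := by
  have h : t F 0 = 𝟙 _ := by
    have := tPow_self F 0
    simpa [tPow] using this
  rw [connesB, Category.assoc, Category.assoc, one_sub_t_b, h, sub_self]
  simp

theorem connesB_b (n : ℕ) : connesB F (n + 1) ≫ b F (n + 1) = -(b F n ≫ connesB F n) := by
  have h : normOp F (n + 1) ≫ (𝟙 _ - t F (n + 1)) = 0 := by
    rw [Preadditive.comp_sub, norm_t, Category.comp_id, sub_self]
  calc connesB F (n + 1) ≫ b F (n + 1)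
      = normOp F (n + 1) ≫ (F.map (extraDegen (n + 1)) ≫ b' F (n + 1)) ≫ (𝟙 _ - t F (n + 1)) := by
        rw [connesB, Category.assoc, Category.assoc, one_sub_t_b, Category.assoc]
    _ = normOp F (n + 1) ≫ (𝟙 _ - t F (n + 1)) -
          (normOp F (n + 1) ≫ b' F n) ≫ F.map (extraDegen n) ≫ (𝟙 _ - t F (n + 1)) := by
        rw [extraDegen_b', Preadditive.sub_comp, Preadditive.comp_sub, Category.id_comp]
        simp only [Category.assoc]
    _ = -(b F n ≫ connesB F n) := by
        rw [h, norm_b', zero_sub, connesB, Category.assoc]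

variable {F} in
theorem t_naturality {G : CyclicCat ⥤ C} (φ : F ⟶ G) (n : ℕ) :
    t F n ≫ φ.app ⟨n⟩ = φ.app ⟨n⟩ ≫ t G n := by
  simp [t]

variable {F} in
theorem tPow_naturality {G : CyclicCat ⥤ C} (φ : F ⟶ G) (n j : ℕ) :
    tPow F n j ≫ φ.app ⟨n⟩ = φ.app ⟨n⟩ ≫ tPow G n j := by
  induction j with
  | zero => simp [tPow]
  | succ j ih => rw [tPow, Category.assoc, ih, ← Category.assoc, t_naturality, Category.assoc, tPow]

variable {F} in
theorem connesB_naturality {G : CyclicCat ⥤ C} (φ : F ⟶ G) (n : ℕ) :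
    connesB F n ≫ φ.app ⟨n + 1⟩ = φ.app ⟨n⟩ ≫ connesB G n := by
  have h : normOp F n ≫ φ.app ⟨n⟩ = φ.app ⟨n⟩ ≫ normOp G n := by
    rw [normOp, normOp, Preadditive.sum_comp, Preadditive.comp_sum]
    exact Finset.sum_congr rfl fun j _ => tPow_naturality φ n j
  rw [connesB, connesB, ← Category.assoc (φ.app _), ← h]
  simp only [Category.assoc, Preadditive.sub_comp, Preadditive.comp_sub,
    Category.comp_id, t_naturality, NatTrans.naturality, NatTrans.naturality_assoc]

end CyclicObject
/-! ### Hochschild complexes and the Connes–Tsygan differential -/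

/-- The total degree of the summand of simplicial degree `p` and internal (cohomological) degree
`a` is `a - p`; the internal differential receives the sign `(-1) ^ p`. -/
instance simplicialTotalComplexShape :
    TotalComplexShape (ComplexShape.down ℕ) (ComplexShape.up ℤ) (ComplexShape.up ℤ) where
  π x := x.2 - (x.1 : ℤ)
  ε₁ _ := 1
  ε₂ x := (x.1 : ℤ).negOnePow
  rel₁ {p p'} h a := by
    simp only [ComplexShape.down_Rel] at h
    simp only [ComplexShape.up_Rel]
    omega
  rel₂ p a a' h := by
    simp only [ComplexShape.up_Rel] at h ⊢
    omega
  ε₂_ε₁ {p p' a a'} h _ := by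
    simp only [ComplexShape.down_Rel] at h
    subst h
    simp [Int.negOnePow_succ]

/-- The category of complexes of functors from the cyclic category to `R`-modules, or equivalently,
of functors from the cyclic category to complexes of `R`-modules. -/
abbrev CyclicComplex (R : Type u) [CommRing R] : Type (u + 1) :=
  CyclicCat ⥤ CochainComplex (ModuleCat.{u} R) ℤ

section

variable {R : Type u} [CommRing R]

namespace SimplicialTotal

variable (K : HomologicalComplex₂ (ModuleCat.{u} R) (ComplexShape.down ℕ) (ComplexShape.up ℤ))

/-- The inclusion of a summand in the total complex. -/
noncomputable abbrev ι (p : ℕ) (a m : ℤ) (h : a - p = m) :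
    (K.X p).X a ⟶ (K.total (ComplexShape.up ℤ)).X m :=
  K.ιTotal (ComplexShape.up ℤ) p a m h

theorem ι_d_zero (a m m' : ℤ) (h : a - (0 : ℕ) = m) (hm : m + 1 = m') :
    ι K 0 a m h ≫ (K.total (ComplexShape.up ℤ)).d m m' =
      (K.X 0).d a (a + 1) ≫ ι K 0 (a + 1) m' (by omega) := by
  rw [HomologicalComplex₂.total_d, Preadditive.comp_add, HomologicalComplex₂.ι_D₁,
    HomologicalComplex₂.ι_D₂, HomologicalComplex₂.d₁_eq_zero, zero_add,
    HomologicalComplex₂.d₂_eq (i₂' := a + 1) (h' := by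
      change a + 1 - ((0 : ℕ) : ℤ) = m'; omega)]
  · change (((0 : ℕ) : ℤ).negOnePow) • _ = _
    simp
  · simp
  · simp

theorem ι_d_succ (p : ℕ) (a m m' : ℤ) (h : a - (p + 1 : ℕ) = m) (hm : m + 1 = m') :
    ι K (p + 1) a m h ≫ (K.total (ComplexShape.up ℤ)).d m m' =
      (K.d (p + 1) p).f a ≫ ι K p a m' (by push_cast at h; omega) +
      ((p + 1 : ℕ) : ℤ).negOnePow •
        ((K.X (p + 1)).d a (a + 1) ≫ ι K (p + 1) (a + 1) m' (by omega)) := by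
  rw [HomologicalComplex₂.total_d, Preadditive.comp_add, HomologicalComplex₂.ι_D₁,
    HomologicalComplex₂.ι_D₂,
    HomologicalComplex₂.d₁_eq (i₁' := p) (h' := by
      change a - (p : ℤ) = m'; push_cast at h; omega),
    HomologicalComplex₂.d₂_eq (i₂' := a + 1) (h' := by
      change a + 1 - ((p + 1 : ℕ) : ℤ) = m'; omega)]
  · change (1 : ℤˣ) • _ + _ = _
    rw [one_smul]
    rfl
  · simp
  · simp

variable (β : ∀ p, K.X p ⟶ K.X (p + 1))

/-- The map of degree `-1` on the total complex which is induced by maps raising the simplicial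
degree by one. -/
noncomputable def raise (m n : ℤ) (h : n + 1 = m) :
    (K.total (ComplexShape.up ℤ)).X m ⟶ (K.total (ComplexShape.up ℤ)).X n :=
  K.totalDesc fun p a hpa => (β p).f a ≫ ι K (p + 1) a n (by
    change a - (p : ℤ) = m at hpa
    push_cast
    omega)

theorem ι_raise (m n : ℤ) (h : n + 1 = m) (p : ℕ) (a : ℤ) (hpa : a - p = m) :
    ι K p a m hpa ≫ raise K β m n h =
      (β p).f a ≫ ι K (p + 1) a n (by push_cast; omega) :=
  HomologicalComplex₂.ι_totalDesc _ _ _ _ _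

theorem raise_d (h0 : β 0 ≫ K.d 1 0 = 0)
    (hs : ∀ p, β (p + 1) ≫ K.d (p + 2) (p + 1) = -(K.d (p + 1) p ≫ β p))
    (m m' n n' : ℤ) (hm : m + 1 = m') (hn : n + 1 = m) (hn' : n' + 1 = m') :
    raise K β m n hn ≫ (K.total (ComplexShape.up ℤ)).d n n' =
      -((K.total (ComplexShape.up ℤ)).d m m' ≫ raise K β m' n' hn') := by
  refine HomologicalComplex₂.total.hom_ext (c₁₂ := ComplexShape.up ℤ) fun p a h => ?_
  have h' : a - (p : ℤ) = m := h
  change ι K p a m h' ≫ _ = ι K p a m h' ≫ _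
  rw [← Category.assoc, ι_raise, Category.assoc,
    ι_d_succ K p a n n' (by push_cast; omega) (by omega), Preadditive.comp_neg, ← Category.assoc]
  cases p with
  | zero =>
    have h1 := congrArg (fun x => HomologicalComplex.Hom.f x a) h0
    simp only [HomologicalComplex.comp_f, HomologicalComplex.zero_f] at h1
    rw [ι_d_zero K a m m' h' hm, Category.assoc, ι_raise, Preadditive.comp_add,
      ← Category.assoc, h1]
    simp
  | succ p =>
    have h1 := congrArg (fun x => HomologicalComplex.Hom.f x a) (hs p)
    simp only [HomologicalComplex.comp_f, HomologicalComplex.neg_f_apply] at h1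
    rw [ι_d_succ K p a m m' h' hm, Preadditive.add_comp, Linear.units_smul_comp, Category.assoc,
      Category.assoc, ι_raise, ι_raise, Preadditive.comp_add, ← Category.assoc, h1]
    simp only [Nat.cast_add, Nat.cast_one, Int.negOnePow_succ, Units.neg_smul,
      Linear.comp_units_smul, neg_neg, neg_add_rev, Preadditive.neg_comp, Category.assoc,
      HomologicalComplex.Hom.comm_assoc]
    abel

/-- The morphism from the total complex to its shift which is induced by maps raising the
simplicial degree by one and anticommuting with the simplicial differential. -/
noncomputable def shiftMap (h0 : β 0 ≫ K.d 1 0 = 0)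
    (hs : ∀ p, β (p + 1) ≫ K.d (p + 2) (p + 1) = -(K.d (p + 1) p ≫ β p)) :
    K.total (ComplexShape.up ℤ) ⟶ (K.total (ComplexShape.up ℤ))⟦(-1 : ℤ)⟧ where
  f m := raise K β m (m + -1) (by ring)
  comm' m m' hm := by
    have h := raise_d K β h0 hs m m' (m + -1) (m' + -1) hm (by ring) (by ring)
    rw [CochainComplex.shiftFunctor_obj_d', Int.negOnePow_neg, Int.negOnePow_one, Units.neg_smul,
      one_smul]
    exact (Preadditive.comp_neg _ _).trans (neg_eq_iff_eq_neg.2 h)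

variable {K} in
theorem ι_map {L : HomologicalComplex₂ (ModuleCat.{u} R) (ComplexShape.down ℕ) (ComplexShape.up ℤ)}
    (φ : K ⟶ L) (p : ℕ) (a m : ℤ) (h : a - p = m) :
    ι K p a m h ≫ (HomologicalComplex₂.total.map φ (ComplexShape.up ℤ)).f m =
      (φ.f p).f a ≫ ι L p a m h :=
  HomologicalComplex₂.ιTotal_map _ _ _ _ _ _ _ _

variable {K} in
theorem raise_map
    {L : HomologicalComplex₂ (ModuleCat.{u} R) (ComplexShape.down ℕ) (ComplexShape.up ℤ)}
    (φ : K ⟶ L) (γ : ∀ p, L.X p ⟶ L.X (p + 1)) (h : ∀ p, β p ≫ φ.f (p + 1) = φ.f p ≫ γ p)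
    (m n : ℤ) (hmn : n + 1 = m) :
    raise K β m n hmn ≫ (HomologicalComplex₂.total.map φ (ComplexShape.up ℤ)).f n =
      (HomologicalComplex₂.total.map φ (ComplexShape.up ℤ)).f m ≫ raise L γ m n hmn := by
  refine HomologicalComplex₂.total.hom_ext (c₁₂ := ComplexShape.up ℤ) fun p a h' => ?_
  change ι K p a m h' ≫ _ = ι K p a m h' ≫ _
  have h1 := congrArg (fun x => HomologicalComplex.Hom.f x a) (h p)
  simp only [HomologicalComplex.comp_f] at h1
  rw [← Category.assoc, ι_raise, Category.assoc, ι_map, ← Category.assoc, ← Category.assoc, ι_map,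
    Category.assoc ((φ.f p).f a), ι_raise, ← Category.assoc, h1]

end SimplicialTotal

/-- The bicomplex defined by the standard complex of the simplicial complex `j^* E`. -/
noncomputable def hochschildBicomplex : CyclicComplex R ⥤
    HomologicalComplex₂ (ModuleCat.{u} R) (ComplexShape.down ℕ) (ComplexShape.up ℤ) :=
  (Functor.whiskeringLeft _ _ _).obj CyclicCat.ofSimplex ⋙
    AlgebraicTopology.alternatingFaceMapComplex (CochainComplex (ModuleCat.{u} R) ℤ)

/-- The Hochschild homology complex, as a functor: the total complex of the standard complex of
the simplicial object `j^* E`. -/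
noncomputable def CH : CyclicComplex R ⥤ CochainComplex (ModuleCat.{u} R) ℤ :=
  hochschildBicomplex ⋙ HomologicalComplex₂.totalFunctor _ _ _ (ComplexShape.up ℤ)

theorem hochschildBicomplex_d (E : CyclicComplex R) (n : ℕ) :
    (hochschildBicomplex.obj E).d (n + 1) n = CyclicObject.b E n := by
  refine (AlgebraicTopology.alternatingFaceMapComplex_obj_d _ n).trans ?_
  rfl

/-- The Connes–Tsygan differential, as a natural transformation from `CH` to its shift. In terms
of homological degrees, it raises the degree by one. -/
noncomputable def connesTsygan :
    (CH : CyclicComplex R ⥤ _) ⟶ CH ⋙ shiftFunctor (CochainComplex (ModuleCat.{u} R) ℤ) (-1 : ℤ) where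
  app E := SimplicialTotal.shiftMap (hochschildBicomplex.obj E)
    (fun p => CyclicObject.connesB E p)
    (by
      rw [hochschildBicomplex_d]
      exact CyclicObject.connesB_b_zero E)
    (fun p => by
      rw [hochschildBicomplex_d, hochschildBicomplex_d]
      exact CyclicObject.connesB_b E p)
  naturality E E' φ := by
    refine HomologicalComplex.hom_ext _ _ fun m => ?_
    exact (SimplicialTotal.raise_map _ (hochschildBicomplex.map φ) _
      (fun p => CyclicObject.connesB_naturality φ p) m (m + -1) (by ring)).symm

end
/-! ### The Künneth map -/

section

variable {R : Type u} [CommRing R]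

section tensor

variable (X Y : CochainComplex (ModuleCat.{u} R) ℤ)

/-- The inclusion of a summand in the tensor product of complexes. -/
noncomputable def ιTensor (i j m : ℤ) (h : i + j = m) : X.X i ⊗ Y.X j ⟶ (X ⊗ Y).X m :=
  HomologicalComplex.ιTensorObj X Y i j m h

theorem tensor_hom_ext {A : ModuleCat.{u} R} {m : ℤ} {f g : (X ⊗ Y).X m ⟶ A}
    (h : ∀ i j (hij : i + j = m), ιTensor X Y i j m hij ≫ f = ιTensor X Y i j m hij ≫ g) : f = g :=
  HomologicalComplex.mapBifunctor.hom_ext h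

theorem ιTensor_d (i j m m' : ℤ) (h : i + j = m) (hm : m + 1 = m') :
    ιTensor X Y i j m h ≫ (X ⊗ Y).d m m' =
      (X.d i (i + 1) ▷ Y.X j) ≫ ιTensor X Y (i + 1) j m' (by omega) +
      i.negOnePow • ((X.X i ◁ Y.d j (j + 1)) ≫ ιTensor X Y i (j + 1) m' (by omega)) := by
  change HomologicalComplex.ιTensorObj X Y i j m h ≫ (HomologicalComplex.tensorObj X Y).d m m' = _
  rw [HomologicalComplex.mapBifunctor.d_eq, Preadditive.comp_add,
    HomologicalComplex.mapBifunctor.ι_D₁, HomologicalComplex.mapBifunctor.ι_D₂,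
    HomologicalComplex.mapBifunctor.d₁_eq _ _ _ _ (i₁' := i + 1) (by simp) _ _
      (by change i + 1 + j = m'; omega),
    HomologicalComplex.mapBifunctor.d₂_eq _ _ _ _ _ (i₂' := j + 1) (by simp) _
      (by change i + (j + 1) = m'; omega)]
  change (1 : ℤˣ) • _ + i.negOnePow • _ = _
  rw [one_smul]
  rfl

theorem ιTensor_map {X Y} {X' Y' : CochainComplex (ModuleCat.{u} R) ℤ} (f : X ⟶ X') (g : Y ⟶ Y')
    (i j m : ℤ) (h : i + j = m) :
    ιTensor X Y i j m h ≫ (f ⊗ₘ g).f m = (f.f i ⊗ₘ g.f j) ≫ ιTensor X' Y' i j m h := by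
  refine (HomologicalComplex.ι_mapBifunctorMap _ _ _ _ _ _ _ _).trans ?_
  rw [MonoidalCategory.tensorHom_def, Category.assoc]
  rfl

end tensor

instance cochainMonoidalPreadditive :
    MonoidalPreadditive (CochainComplex (ModuleCat.{u} R) ℤ) where
  whiskerLeft_zero {X Y Z} := by
    ext1 m
    refine tensor_hom_ext _ _ fun i j h => ?_
    rw [← id_tensorHom, ιTensor_map, HomologicalComplex.zero_f, HomologicalComplex.zero_f,
      Limits.comp_zero, MonoidalPreadditive.tensor_zero, Limits.zero_comp]
  zero_whiskerRight {X Y Z} := by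
    ext1 m
    refine tensor_hom_ext _ _ fun i j h => ?_
    rw [← tensorHom_id, ιTensor_map, HomologicalComplex.zero_f, HomologicalComplex.zero_f,
      Limits.comp_zero, MonoidalPreadditive.zero_tensor, Limits.zero_comp]
  whiskerLeft_add {X Y Z} f g := by
    ext1 m
    refine tensor_hom_ext _ _ fun i j h => ?_
    rw [HomologicalComplex.add_f_apply, Preadditive.comp_add, ← id_tensorHom, ← id_tensorHom,
      ← id_tensorHom, ιTensor_map, ιTensor_map, ιTensor_map, HomologicalComplex.add_f_apply,
      MonoidalPreadditive.tensor_add, Preadditive.add_comp]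
  add_whiskerRight {X Y Z} f g := by
    ext1 m
    refine tensor_hom_ext _ _ fun i j h => ?_
    rw [HomologicalComplex.add_f_apply, Preadditive.comp_add, ← tensorHom_id, ← tensorHom_id,
      ← tensorHom_id, ιTensor_map, ιTensor_map, ιTensor_map, HomologicalComplex.add_f_apply,
      MonoidalPreadditive.add_tensor, Preadditive.add_comp]

namespace SimplicialTotal

variable (K L : HomologicalComplex₂ (ModuleCat.{u} R) (ComplexShape.down ℕ) (ComplexShape.up ℤ))

/-- The inclusion of the tensor product of the columns `K.X p` and `L.X q` in the tensor product of
total complexes. The sign comes from exchanging the internal degree `a` in `K.X p` and the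
simplicial degree `q`. -/
noncomputable def columns (p q : ℕ) (c m : ℤ) (h : c - p - q = m) :
    (K.X p ⊗ L.X q).X c ⟶
      (K.total (ComplexShape.up ℤ) ⊗ L.total (ComplexShape.up ℤ)).X m :=
  HomologicalComplex.mapBifunctorDesc fun a b hab =>
    (a * q).negOnePow • ((ι K p a (a - p) rfl ⊗ₘ ι L q b (b - q) rfl) ≫
      ιTensor _ _ (a - p) (b - q) m (by
        change a + b = c at hab
        omega))

theorem ι_columns (p q : ℕ) (c m : ℤ) (h : c - p - q = m) (a b : ℤ) (hab : a + b = c)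
    (a' b' : ℤ) (ha : a - p = a') (hb : b - q = b') :
    ιTensor _ _ a b c hab ≫ columns K L p q c m h =
      (a * q).negOnePow • ((ι K p a a' ha ⊗ₘ ι L q b b' hb) ≫
        ιTensor _ _ a' b' m (by omega)) := by
  subst ha hb
  exact HomologicalComplex.ι_mapBifunctorDesc _ _ _ _

/-- The component of the total differential which comes from the simplicial differential. -/
noncomputable def faceι : ∀ (p : ℕ) (a m : ℤ) (_ : a - p + 1 = m),
    (K.X p).X a ⟶ (K.total (ComplexShape.up ℤ)).X m
  | 0, _, _, _ => 0
  | p + 1, a, m, h => (K.d (p + 1) p).f a ≫ ι K p a m (by push_cast at h; omega)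

theorem ι_d (p : ℕ) (a m m' : ℤ) (h : a - p = m) (hm : m + 1 = m') :
    ι K p a m h ≫ (K.total (ComplexShape.up ℤ)).d m m' =
      faceι K p a m' (by omega) +
        (p : ℤ).negOnePow • ((K.X p).d a (a + 1) ≫ ι K p (a + 1) m' (by omega)) := by
  cases p with
  | zero => rw [ι_d_zero K a m m' h hm, faceι]; simp
  | succ p => rw [ι_d_succ K p a m m' h hm, faceι]

/-- Applies the simplicial differential of the first factor, then `columns`. -/
noncomputable def faceColumns₁ : ∀ (p q : ℕ) (c m : ℤ) (_ : c - p - q + 1 = m),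
    (K.X p ⊗ L.X q).X c ⟶
      (K.total (ComplexShape.up ℤ) ⊗ L.total (ComplexShape.up ℤ)).X m
  | 0, _, _, _, _ => 0
  | p + 1, q, c, m, h =>
    (K.d (p + 1) p ▷ L.X q).f c ≫ columns K L p q c m (by push_cast at h; omega)

/-- Applies the simplicial differential of the second factor, then `columns`. -/
noncomputable def faceColumns₂ : ∀ (p q : ℕ) (c m : ℤ) (_ : c - p - q + 1 = m),
    (K.X p ⊗ L.X q).X c ⟶
      (K.total (ComplexShape.up ℤ) ⊗ L.total (ComplexShape.up ℤ)).X m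
  | _, 0, _, _, _ => 0
  | p, q + 1, c, m, h =>
    (K.X p ◁ L.d (q + 1) q).f c ≫ columns K L p q c m (by push_cast at h; omega)

theorem ι_faceColumns₁ (p q : ℕ) (c m : ℤ) (h : c - p - q + 1 = m) (a b : ℤ) (hab : a + b = c)
    (a' b' : ℤ) (ha : a - p + 1 = a') (hb : b - q = b') :
    ιTensor _ _ a b c hab ≫ faceColumns₁ K L p q c m h =
      (a * q).negOnePow • ((faceι K p a a' ha ⊗ₘ ι L q b b' hb) ≫
        ιTensor _ _ a' b' m (by omega)) := by
  cases p with
  | zero =>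
    rw [faceι, faceColumns₁, MonoidalPreadditive.zero_tensor]
    simp
  | succ p =>
    rw [faceι, faceColumns₁, ← Category.assoc, ← tensorHom_id, ιTensor_map, Category.assoc,
      ι_columns K L p q c m (by push_cast at h; omega) a b hab a' b' (by push_cast at ha; omega) hb,
      Linear.comp_units_smul, ← Category.assoc, MonoidalCategory.tensorHom_comp_tensorHom]
    simp

theorem ι_faceColumns₂ (p q : ℕ) (c m : ℤ) (h : c - p - q + 1 = m) (a b : ℤ) (hab : a + b = c)
    (a' b' : ℤ) (ha : a - p = a') (hb : b - q + 1 = b') :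
    ιTensor _ _ a b c hab ≫ faceColumns₂ K L p q c m h =
      (a * q + a).negOnePow • ((ι K p a a' ha ⊗ₘ faceι L q b b' hb) ≫
        ιTensor _ _ a' b' m (by omega)) := by
  cases q with
  | zero =>
    rw [faceι, faceColumns₂, MonoidalPreadditive.tensor_zero]
    simp
  | succ q =>
    rw [faceι, faceColumns₂, ← Category.assoc, ← id_tensorHom, ιTensor_map, Category.assoc,
      ι_columns K L p q c m (by push_cast at h; omega) a b hab a' b' ha (by push_cast at hb; omega),
      Linear.comp_units_smul, ← Category.assoc, MonoidalCategory.tensorHom_comp_tensorHom]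
    have : (a * (q + 1 : ℕ) + a).negOnePow = (a * q).negOnePow := by
      rw [Int.negOnePow_eq_iff]
      exact ⟨a, by push_cast; ring⟩
    rw [this]
    simp

theorem units_smul_tensor (v : ℤˣ) {A B C D : ModuleCat.{u} R} (f : A ⟶ B) (g : C ⟶ D) :
    ((v • f) ⊗ₘ g) = v • (f ⊗ₘ g) := by
  rcases Int.units_eq_one_or v with rfl | rfl
  · simp
  · rw [Units.neg_smul, Units.neg_smul, one_smul, one_smul, eq_neg_iff_add_eq_zero,
      ← MonoidalPreadditive.add_tensor, neg_add_cancel, MonoidalPreadditive.zero_tensor]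

theorem tensor_units_smul (v : ℤˣ) {A B C D : ModuleCat.{u} R} (f : A ⟶ B) (g : C ⟶ D) :
    (f ⊗ₘ (v • g)) = v • (f ⊗ₘ g) := by
  rcases Int.units_eq_one_or v with rfl | rfl
  · simp
  · rw [Units.neg_smul, Units.neg_smul, one_smul, one_smul, eq_neg_iff_add_eq_zero,
      ← MonoidalPreadditive.tensor_add, neg_add_cancel, MonoidalPreadditive.tensor_zero]

theorem columns_d (p q : ℕ) (c m m' : ℤ) (h : c - p - q = m) (hm : m + 1 = m') :
    columns K L p q c m h ≫
        (K.total (ComplexShape.up ℤ) ⊗ L.total (ComplexShape.up ℤ)).d m m' =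
      faceColumns₁ K L p q c m' (by omega) +
        (p : ℤ).negOnePow • faceColumns₂ K L p q c m' (by omega) +
        ((p : ℤ) + q).negOnePow •
          ((K.X p ⊗ L.X q).d c (c + 1) ≫ columns K L p q (c + 1) m' (by omega)) := by
  refine tensor_hom_ext _ _ fun a b hab => ?_
  have l1 : ((ι K p a (a - p) rfl ⊗ₘ ι L q b (b - q) rfl) ≫
      ((K.total (ComplexShape.up ℤ)).d (a - p) (a - p + 1) ▷ _)) =
      (faceι K p a (a - p + 1) rfl ⊗ₘ ι L q b (b - q) rfl) +
        (p : ℤ).negOnePow • ((K.X p).d a (a + 1) ▷ _ ≫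
          (ι K p (a + 1) (a - p + 1) (by omega) ⊗ₘ ι L q b (b - q) rfl)) := by
    rw [← tensorHom_id, MonoidalCategory.tensorHom_comp_tensorHom, Category.comp_id,
      ι_d K p a (a - p) (a - p + 1) rfl rfl, MonoidalPreadditive.add_tensor, units_smul_tensor,
      ← tensorHom_id, MonoidalCategory.tensorHom_comp_tensorHom, Category.id_comp]
  have l2 : ((ι K p a (a - p) rfl ⊗ₘ ι L q b (b - q) rfl) ≫
      (_ ◁ (L.total (ComplexShape.up ℤ)).d (b - q) (b - q + 1))) =
      (ι K p a (a - p) rfl ⊗ₘ faceι L q b (b - q + 1) rfl) +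
        (q : ℤ).negOnePow • (_ ◁ (L.X q).d b (b + 1) ≫
          (ι K p a (a - p) rfl ⊗ₘ ι L q (b + 1) (b - q + 1) (by omega))) := by
    rw [← id_tensorHom, MonoidalCategory.tensorHom_comp_tensorHom, Category.comp_id,
      ι_d L q b (b - q) (b - q + 1) rfl rfl, MonoidalPreadditive.tensor_add, tensor_units_smul,
      ← id_tensorHom, MonoidalCategory.tensorHom_comp_tensorHom, Category.id_comp]
  have lhs : ιTensor _ _ a b c hab ≫ columns K L p q c m h ≫
        (K.total (ComplexShape.up ℤ) ⊗ L.total (ComplexShape.up ℤ)).d m m' =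
      (a * q).negOnePow • (((faceι K p a (a - p + 1) rfl ⊗ₘ ι L q b (b - q) rfl) +
        (p : ℤ).negOnePow • ((K.X p).d a (a + 1) ▷ _ ≫
          (ι K p (a + 1) (a - p + 1) (by omega) ⊗ₘ ι L q b (b - q) rfl))) ≫
          ιTensor _ _ (a - p + 1) (b - q) m' (by omega) +
        (a - p).negOnePow • ((ι K p a (a - p) rfl ⊗ₘ faceι L q b (b - q + 1) rfl) +
        (q : ℤ).negOnePow • (_ ◁ (L.X q).d b (b + 1) ≫
          (ι K p a (a - p) rfl ⊗ₘ ι L q (b + 1) (b - q + 1) (by omega)))) ≫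
          ιTensor _ _ (a - p) (b - q + 1) m' (by omega)) := by
    rw [← l1, ← l2, ← Category.assoc, ι_columns K L p q c m h a b hab _ _ rfl rfl,
      Linear.units_smul_comp, Category.assoc, ιTensor_d _ _ _ _ m m' (by omega) hm,
      Preadditive.comp_add, Linear.comp_units_smul, Category.assoc, Category.assoc]
  have rhs : ιTensor _ _ a b c hab ≫ (K.X p ⊗ L.X q).d c (c + 1) ≫
        columns K L p q (c + 1) m' (by omega) =
      ((a + 1) * q).negOnePow • ((K.X p).d a (a + 1) ▷ _ ≫
          (ι K p (a + 1) (a - p + 1) (by omega) ⊗ₘ ι L q b (b - q) rfl) ≫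
          ιTensor _ _ (a - p + 1) (b - q) m' (by omega)) +
      a.negOnePow • (a * q).negOnePow • (_ ◁ (L.X q).d b (b + 1) ≫
          (ι K p a (a - p) rfl ⊗ₘ ι L q (b + 1) (b - q + 1) (by omega)) ≫
          ιTensor _ _ (a - p) (b - q + 1) m' (by omega)) := by
    rw [← Category.assoc, ιTensor_d _ _ a b c (c + 1) hab rfl, Preadditive.add_comp, Category.assoc,
      ι_columns K L p q (c + 1) m' (by omega) (a + 1) b (by omega) (a - p + 1) (b - q)
        (by omega) rfl,
      Linear.units_smul_comp, Category.assoc,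
      ι_columns K L p q (c + 1) m' (by omega) a (b + 1) (by omega) (a - p) (b - q + 1)
        rfl (by omega), Linear.comp_units_smul, Linear.comp_units_smul]
  rw [lhs, Preadditive.comp_add, Preadditive.comp_add,
    ι_faceColumns₁ K L p q c m' (by omega) a b hab _ _ rfl rfl, Linear.comp_units_smul,
    ι_faceColumns₂ K L p q c m' (by omega) a b hab _ _ rfl rfl, Linear.comp_units_smul, rhs]
  have s1 : (((p : ℤ) + q).negOnePow * ((a + 1) * q).negOnePow) =
      (a * q).negOnePow * (p : ℤ).negOnePow := by
    rw [← Int.negOnePow_add, ← Int.negOnePow_add, Int.negOnePow_eq_iff]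
    exact ⟨q, by ring⟩
  have s2 : (p : ℤ).negOnePow * (a * q + a).negOnePow =
      (a * q).negOnePow * (a - p).negOnePow := by
    rw [← Int.negOnePow_add, ← Int.negOnePow_add, Int.negOnePow_eq_iff]
    exact ⟨p, by ring⟩
  have s3 : ((p : ℤ) + q).negOnePow * (a.negOnePow * (a * q).negOnePow) =
      (a * q).negOnePow * ((a - p).negOnePow * (q : ℤ).negOnePow) := by
    rw [← Int.negOnePow_add, ← Int.negOnePow_add, ← Int.negOnePow_add, ← Int.negOnePow_add,
      Int.negOnePow_eq_iff]
    exact ⟨p, by ring⟩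
  simp only [Preadditive.add_comp, Linear.units_smul_comp, smul_add, smul_smul, Category.assoc,
    s1, s2, s3]
  abel

end SimplicialTotal
end
section

variable {R : Type u} [CommRing R]

theorem δ_apply_val {n : ℕ} (i : Fin (n + 2)) (k : Fin (n + 1)) :
    (((SimplexCategory.δ i).toOrderHom k : Fin (n + 2)) : ℕ) =
      if (k : ℕ) < (i : ℕ) then (k : ℕ) else k + 1 := by
  change ((i.succAbove k : Fin (n + 2)) : ℕ) = _
  split_ifs with h
  · rw [Fin.succAbove_of_castSucc_lt _ _ (by simpa [Fin.lt_def] using h)]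
    simp
  · rw [Fin.succAbove_of_le_castSucc _ _ (by simpa [Fin.le_def] using h)]
    simp

theorem subinterval_apply_val {n : ℕ} (j l : ℕ) (h : j + l ≤ n) (k : Fin (l + 1)) :
    (((SimplexCategory.subinterval j l h).toOrderHom k : Fin (n + 1)) : ℕ) = k + j := rfl

theorem simplexHom_ext {m n : ℕ} {f g : SimplexCategory.mk m ⟶ SimplexCategory.mk n}
    (h : ∀ k : Fin (m + 1), ((f.toOrderHom k : Fin (n + 1)) : ℕ) = (g.toOrderHom k : Fin (n + 1))) :
    f = g := by
  ext k : 3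
  exact Fin.ext (h k)

/-- Faces indexed by natural numbers. -/
def faceN (n i : ℕ) : (⟨n + 1⟩ : CyclicCat) ⟶ ⟨n⟩ := CyclicCat.face (Fin.ofNat (n + 2) i)

theorem ofNat_val {n i : ℕ} (h : i < n + 2) : ((Fin.ofNat (n + 2) i : Fin (n + 2)) : ℕ) = i := by
  simp [Nat.mod_eq_of_lt h]

theorem b_eq_sum_range {C : Type*} [Category* C] [Preadditive C] (F : CyclicCat ⥤ C) (n : ℕ) :
    CyclicObject.b F n = ∑ i ∈ Finset.range (n + 2), (-1 : ℤ) ^ i • F.map (faceN n i) := by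
  rw [CyclicObject.b, ← Fin.sum_univ_eq_sum_range (fun i => (-1 : ℤ) ^ i • F.map (faceN n i))]
  refine Finset.sum_congr rfl fun i _ => ?_
  rw [faceN]
  simp

namespace CyclicComplex

/-- The action of a morphism of the simplex category on the simplicial object `j^* E`. -/
noncomputable def act (E : CyclicComplex R) {m n : ℕ}
    (φ : SimplexCategory.mk m ⟶ SimplexCategory.mk n) : E.obj ⟨n⟩ ⟶ E.obj ⟨m⟩ :=
  E.map (CyclicCat.ofSimplex.map φ.op)

theorem act_comp (E : CyclicComplex R) {l m n : ℕ} (φ : SimplexCategory.mk l ⟶ SimplexCategory.mk m)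
    (ψ : SimplexCategory.mk m ⟶ SimplexCategory.mk n) : act E ψ ≫ act E φ = act E (φ ≫ ψ) :=
  (E.map_comp _ _).symm.trans (congrArg (fun x => E.map x)
    (CyclicCat.ofSimplex.map_comp ψ.op φ.op).symm)

theorem map_faceN (E : CyclicComplex R) (n i : ℕ) :
    E.map (faceN n i) = act E (SimplexCategory.δ (Fin.ofNat (n + 2) i)) := rfl

/-- The restriction to the first `p + 1` elements of `{0, …, n}`, where `n = p + q`. -/
noncomputable def front (E : CyclicComplex R) (p q n : ℕ) (h : p + q = n) :
    E.obj ⟨n⟩ ⟶ E.obj ⟨p⟩ :=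
  act E (SimplexCategory.subinterval (n := n) 0 p (by omega))

/-- The restriction to the last `q + 1` elements of `{0, …, n}`, where `n = p + q`. -/
noncomputable def back (E : CyclicComplex R) (p q n : ℕ) (h : p + q = n) :
    E.obj ⟨n⟩ ⟶ E.obj ⟨q⟩ :=
  act E (SimplexCategory.subinterval (n := n) p q (by omega))

variable (E E' : CyclicComplex R) (p q n : ℕ) (h : p + q = n)

theorem face_front (i : ℕ) (hi : i ≤ p + 1) :
    E.map (faceN n i) ≫ front E p q n h =
      front E (p + 1) q (n + 1) (by omega) ≫ E.map (faceN p i) := by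
  rw [front, front, map_faceN, map_faceN, act_comp, act_comp]
  congr 1
  refine simplexHom_ext fun k => ?_
  rw [SimplexCategory.comp_toOrderHom, SimplexCategory.comp_toOrderHom, OrderHom.comp_coe,
    OrderHom.comp_coe, Function.comp_apply, Function.comp_apply, δ_apply_val,
    subinterval_apply_val, subinterval_apply_val, δ_apply_val,
    ofNat_val (by omega), ofNat_val (by omega)]
  rfl

theorem face_front' (i : ℕ) (hi : p + 1 ≤ i) (hi' : i ≤ n + 1) :
    E.map (faceN n i) ≫ front E p q n h = front E p (q + 1) (n + 1) (by omega) := by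
  rw [front, front, map_faceN, act_comp]
  congr 1
  refine simplexHom_ext fun k => ?_
  have := k.isLt
  rw [SimplexCategory.comp_toOrderHom, OrderHom.comp_coe, Function.comp_apply, δ_apply_val,
    subinterval_apply_val, subinterval_apply_val, ofNat_val (by omega), if_pos (by omega)]

theorem face_back (i : ℕ) (hi : i ≤ p) :
    E.map (faceN n i) ≫ back E p q n h = back E (p + 1) q (n + 1) (by omega) := by
  rw [back, back, map_faceN, act_comp]
  congr 1
  refine simplexHom_ext fun k => ?_
  rw [SimplexCategory.comp_toOrderHom, OrderHom.comp_coe, Function.comp_apply, δ_apply_val,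
    subinterval_apply_val, subinterval_apply_val, ofNat_val (by omega), if_neg (by omega)]
  ring

theorem face_back' (j : ℕ) (hj : j ≤ q + 1) :
    E.map (faceN n (p + j)) ≫ back E p q n h =
      back E p (q + 1) (n + 1) (by omega) ≫ E.map (faceN q j) := by
  rw [back, back, map_faceN, map_faceN, act_comp, act_comp]
  congr 1
  refine simplexHom_ext fun k => ?_
  rw [SimplexCategory.comp_toOrderHom, SimplexCategory.comp_toOrderHom, OrderHom.comp_coe,
    OrderHom.comp_coe, Function.comp_apply, Function.comp_apply, δ_apply_val,
    subinterval_apply_val, subinterval_apply_val, δ_apply_val,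
    ofNat_val (by omega), ofNat_val (by omega)]
  split_ifs <;> omega

theorem back_face_zero : back E p (q + 1) (n + 1) (by omega) ≫ E.map (faceN q 0) =
    back E (p + 1) q (n + 1) (by omega) := by
  rw [← face_back' E p q n h 0 (by omega), face_back E p q n h _ (by omega)]

theorem front_face_last : front E (p + 1) q (n + 1) (by omega) ≫ E.map (faceN p (p + 1)) =
    front E p (q + 1) (n + 1) (by omega) := by
  rw [← face_front E p q n h _ (by omega), face_front' E p q n h _ (by omega) (by omega)]

/-- The component of bidegree `(p, q)` of the Alexander–Whitney map. -/
noncomputable def frontBack : (E ⊗ E').obj ⟨n⟩ ⟶ E.obj ⟨p⟩ ⊗ E'.obj ⟨q⟩ :=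
  front E p q n h ⊗ₘ back E' p q n h

theorem zsmul_tensor {A B C D : CochainComplex (ModuleCat.{u} R) ℤ} (z : ℤ) (f : A ⟶ B)
    (g : C ⟶ D) : (z • f) ⊗ₘ g = z • (f ⊗ₘ g) := by
  exact map_zsmul (AddMonoidHom.mk' (fun f : A ⟶ B => f ⊗ₘ g)
    (fun f f' => MonoidalPreadditive.add_tensor f f' g)) z f

theorem tensor_zsmul {A B C D : CochainComplex (ModuleCat.{u} R) ℤ} (z : ℤ) (f : A ⟶ B)
    (g : C ⟶ D) : f ⊗ₘ (z • g) = z • (f ⊗ₘ g) := by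
  exact map_zsmul (AddMonoidHom.mk' (fun g : C ⟶ D => f ⊗ₘ g)
    (fun g g' => MonoidalPreadditive.tensor_add f g g')) z g

theorem alternating_sum_split {A : Type*} [AddCommGroup A] (p q n : ℕ) (h : p + q = n)
    (F G K : ℕ → A) (h1 : ∀ i ≤ p, F i = G i) (h2 : ∀ j ≤ q, F (p + 1 + j) = K (j + 1))
    (h3 : G (p + 1) = K 0) :
    ∑ i ∈ Finset.range (n + 2), (-1 : ℤ) ^ i • F i =
      ∑ i ∈ Finset.range (p + 2), (-1 : ℤ) ^ i • G i +
        (-1 : ℤ) ^ p • ∑ j ∈ Finset.range (q + 2), (-1 : ℤ) ^ j • K j := by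
  have e1 : ∀ i ∈ Finset.range (p + 1), (-1 : ℤ) ^ i • F i = (-1 : ℤ) ^ i • G i := by
    intro i hi
    rw [Finset.mem_range] at hi
    rw [h1 i (by omega)]
  have e2 : ∀ j ∈ Finset.range (q + 1), (-1 : ℤ) ^ (p + 1 + j) • F (p + 1 + j) =
      (-1 : ℤ) ^ p • (-1 : ℤ) ^ (j + 1) • K (j + 1) := by
    intro j hj
    rw [Finset.mem_range] at hj
    rw [h2 j (by omega), smul_smul, ← pow_add]
    congr 2
    ring
  rw [show n + 2 = (p + 1) + (q + 1) by omega, Finset.sum_range_add,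
    Finset.sum_range_succ _ (p + 1), Finset.sum_range_succ' _ (q + 1), smul_add, Finset.smul_sum,
    Finset.sum_congr rfl e1, Finset.sum_congr rfl e2, h3, pow_succ, pow_zero, one_smul, mul_neg_one,
    neg_smul]
  abel

theorem b_frontBack :
    CyclicObject.b (E ⊗ E') n ≫ frontBack E E' p q n h =
      frontBack E E' (p + 1) q (n + 1) (by omega) ≫ (CyclicObject.b E p ▷ E'.obj ⟨q⟩) +
      (-1 : ℤ) ^ p • (frontBack E E' p (q + 1) (n + 1) (by omega) ≫
        (E.obj ⟨p⟩ ◁ CyclicObject.b E' q)) := by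
  have hmap : ∀ i, (E ⊗ E').map (faceN n i) = E.map (faceN n i) ⊗ₘ E'.map (faceN n i) :=
    fun _ => rfl
  have hl : CyclicObject.b (E ⊗ E') n ≫ frontBack E E' p q n h =
      ∑ i ∈ Finset.range (n + 2), (-1 : ℤ) ^ i • ((E.map (faceN n i) ≫ front E p q n h) ⊗ₘ
        (E'.map (faceN n i) ≫ back E' p q n h)) := by
    rw [b_eq_sum_range, Preadditive.sum_comp]
    refine Finset.sum_congr rfl fun i _ => ?_
    rw [Preadditive.zsmul_comp, hmap, frontBack]
    congr 1
    exact MonoidalCategory.tensorHom_comp_tensorHom _ _ _ _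
  have h1 : frontBack E E' (p + 1) q (n + 1) (by omega) ≫ (CyclicObject.b E p ▷ E'.obj ⟨q⟩) =
      ∑ i ∈ Finset.range (p + 2), (-1 : ℤ) ^ i •
        ((front E (p + 1) q (n + 1) (by omega) ≫ E.map (faceN p i)) ⊗ₘ
          back E' (p + 1) q (n + 1) (by omega)) := by
    rw [frontBack, ← tensorHom_id]
    refine (MonoidalCategory.tensorHom_comp_tensorHom _ _ _ _).trans ?_
    rw [b_eq_sum_range, Preadditive.comp_sum, sum_tensor, Category.comp_id]
    refine Finset.sum_congr rfl fun i _ => ?_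
    rw [Preadditive.comp_zsmul, zsmul_tensor]
  have h2 : frontBack E E' p (q + 1) (n + 1) (by omega) ≫ (E.obj ⟨p⟩ ◁ CyclicObject.b E' q) =
      ∑ j ∈ Finset.range (q + 2), (-1 : ℤ) ^ j •
        (front E p (q + 1) (n + 1) (by omega) ⊗ₘ
          (back E' p (q + 1) (n + 1) (by omega) ≫ E'.map (faceN q j))) := by
    rw [frontBack, ← id_tensorHom]
    refine (MonoidalCategory.tensorHom_comp_tensorHom _ _ _ _).trans ?_
    rw [b_eq_sum_range, Preadditive.comp_sum, tensor_sum, Category.comp_id]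
    refine Finset.sum_congr rfl fun i _ => ?_
    rw [Preadditive.comp_zsmul, tensor_zsmul]
  rw [hl, h1, h2]
  refine alternating_sum_split p q n h _ _ _ ?_ ?_ ?_
  · intro i hi
    rw [face_front E p q n h i (by omega), face_back E' p q n h i (by omega)]
  · intro j hj
    rw [face_front' E p q n h _ (by omega) (by omega), show p + 1 + j = p + (j + 1) by ring,
      face_back' E' p q n h _ (by omega)]
  · rw [front_face_last E p q n h, back_face_zero E' p q n h]

end CyclicComplex

end
section

variable {R : Type u} [CommRing R]

namespace SimplicialTotal

variable {K L M : HomologicalComplex₂ (ModuleCat.{u} R) (ComplexShape.down ℕ) (ComplexShape.up ℤ)}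
  (φ : ∀ p q n : ℕ, p + q = n → (M.X n ⟶ K.X p ⊗ L.X q))

/-- The component of bidegree `(p, q)`, on the summand of simplicial degree `n` and internal
degree `c`, of the map which is induced by the family `φ`; it is zero unless `p + q = n`. -/
noncomputable def component (n : ℕ) (c m : ℤ) (h : c - n = m) (x : ℕ × ℕ) :
    (M.X n).X c ⟶ (K.total (ComplexShape.up ℤ) ⊗ L.total (ComplexShape.up ℤ)).X m :=
  if hx : x.1 + x.2 = n then
    (φ x.1 x.2 n hx).f c ≫ columns K L x.1 x.2 c m (by omega)
  else 0

theorem component_of (n : ℕ) (c m : ℤ) (h : c - n = m) (p q : ℕ) (hx : p + q = n) :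
    component φ n c m h (p, q) = (φ p q n hx).f c ≫ columns K L p q c m (by omega) :=
  dif_pos hx

/-- The map of degree zero whose restriction to the summand of simplicial degree `n` is the sum of
the components of bidegrees `(p, q)` with `p + q = n`. -/
noncomputable def sumComponents (m : ℤ) : (M.total (ComplexShape.up ℤ)).X m ⟶
    (K.total (ComplexShape.up ℤ) ⊗ L.total (ComplexShape.up ℤ)).X m :=
  M.totalDesc fun n c hnc =>
    ∑ x ∈ Finset.HasAntidiagonal.antidiagonal n, component φ n c m hnc x

theorem ι_sumComponents (n : ℕ) (c m : ℤ) (h : c - n = m) :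
    ι M n c m h ≫ sumComponents φ m =
      ∑ x ∈ Finset.HasAntidiagonal.antidiagonal n, component φ n c m h x :=
  HomologicalComplex₂.ι_totalDesc _ _ _ _ _

/-- The contribution of the simplicial differential of the first factor. -/
noncomputable def face₁ (n : ℕ) (c m : ℤ) (h : c - n + 1 = m) (x : ℕ × ℕ) :
    (M.X n).X c ⟶ (K.total (ComplexShape.up ℤ) ⊗ L.total (ComplexShape.up ℤ)).X m :=
  if hx : x.1 + x.2 = n then
    (φ x.1 x.2 n hx).f c ≫ faceColumns₁ K L x.1 x.2 c m (by omega)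
  else 0

theorem face₁_of (n : ℕ) (c m : ℤ) (h : c - n + 1 = m) (p q : ℕ) (hx : p + q = n) :
    face₁ φ n c m h (p, q) = (φ p q n hx).f c ≫ faceColumns₁ K L p q c m (by omega) :=
  dif_pos hx

/-- The contribution of the simplicial differential of the second factor. -/
noncomputable def face₂ (n : ℕ) (c m : ℤ) (h : c - n + 1 = m) (x : ℕ × ℕ) :
    (M.X n).X c ⟶ (K.total (ComplexShape.up ℤ) ⊗ L.total (ComplexShape.up ℤ)).X m :=
  if hx : x.1 + x.2 = n then
    (x.1 : ℤ).negOnePow • ((φ x.1 x.2 n hx).f c ≫ faceColumns₂ K L x.1 x.2 c m (by omega))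
  else 0

theorem face₂_of (n : ℕ) (c m : ℤ) (h : c - n + 1 = m) (p q : ℕ) (hx : p + q = n) :
    face₂ φ n c m h (p, q) =
      (p : ℤ).negOnePow • ((φ p q n hx).f c ≫ faceColumns₂ K L p q c m (by omega)) :=
  dif_pos hx

theorem component_d (n : ℕ) (c m m' : ℤ) (h : c - n = m) (hm : m + 1 = m') (x : ℕ × ℕ)
    (hx : x ∈ Finset.HasAntidiagonal.antidiagonal n) :
    component φ n c m h x ≫
        (K.total (ComplexShape.up ℤ) ⊗ L.total (ComplexShape.up ℤ)).d m m' =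
      face₁ φ n c m' (by omega) x + face₂ φ n c m' (by omega) x +
        (n : ℤ).negOnePow • ((M.X n).d c (c + 1) ≫ component φ n (c + 1) m' (by omega) x) := by
  obtain ⟨p, q⟩ := x
  have hpq : p + q = n := Finset.HasAntidiagonal.mem_antidiagonal.1 hx
  rw [component_of φ n c m h p q hpq, component_of φ n (c + 1) m' (by omega) p q hpq,
    face₁_of φ n c m' _ p q hpq, face₂_of φ n c m' _ p q hpq, Category.assoc,
    columns_d K L p q c m m' (by omega) hm, Preadditive.comp_add, Preadditive.comp_add,
    Linear.comp_units_smul, Linear.comp_units_smul, show ((p : ℤ) + q) = n by omega,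
    ← Category.assoc (HomologicalComplex.Hom.f _ _), HomologicalComplex.Hom.comm, Category.assoc]

theorem face_zero (c m : ℤ) (h : c - (0 : ℕ) + 1 = m) (x : ℕ × ℕ)
    (hx : x ∈ Finset.HasAntidiagonal.antidiagonal 0) :
    face₁ φ 0 c m h x + face₂ φ 0 c m h x = 0 := by
  obtain ⟨p, q⟩ := x
  have hpq : p + q = 0 := Finset.HasAntidiagonal.mem_antidiagonal.1 hx
  obtain ⟨rfl, rfl⟩ : p = 0 ∧ q = 0 := by omega
  rw [face₁_of φ 0 c m _ 0 0 rfl, face₂_of φ 0 c m _ 0 0 rfl, faceColumns₁, faceColumns₂,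
    Limits.comp_zero, smul_zero, zero_add]

theorem d_component
    (hφ : ∀ p q n (h : p + q = n), M.d (n + 1) n ≫ φ p q n h =
      φ (p + 1) q (n + 1) (by omega) ≫ (K.d (p + 1) p ▷ L.X q) +
        (-1 : ℤ) ^ p • (φ p (q + 1) (n + 1) (by omega) ≫ (K.X p ◁ L.d (q + 1) q)))
    (n : ℕ) (c m : ℤ) (h : c - n = m) (p q : ℕ) (hpq : p + q = n) :
    (M.d (n + 1) n).f c ≫ component φ n c m h (p, q) =
      face₁ φ (n + 1) c m (by push_cast; omega) (p + 1, q) +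
        face₂ φ (n + 1) c m (by push_cast; omega) (p, q + 1) := by
  have hs : (-1 : ℤ) ^ p = ((p : ℤ).negOnePow : ℤ) := by
    rw [Int.negOnePow_def]
    simp
  rw [component_of φ n c m h p q hpq, face₁_of φ (n + 1) c m _ (p + 1) q (by omega),
    face₂_of φ (n + 1) c m _ p (q + 1) (by omega), ← Category.assoc, ← HomologicalComplex.comp_f,
    hφ p q n hpq, HomologicalComplex.add_f_apply, HomologicalComplex.zsmul_f_apply,
    Preadditive.add_comp, hs, ← Units.smul_def, Linear.units_smul_comp, HomologicalComplex.comp_f,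
    HomologicalComplex.comp_f, Category.assoc, Category.assoc, faceColumns₁, faceColumns₂]

theorem sum_faces
    (hφ : ∀ p q n (h : p + q = n), M.d (n + 1) n ≫ φ p q n h =
      φ (p + 1) q (n + 1) (by omega) ≫ (K.d (p + 1) p ▷ L.X q) +
        (-1 : ℤ) ^ p • (φ p (q + 1) (n + 1) (by omega) ≫ (K.X p ◁ L.d (q + 1) q)))
    (n : ℕ) (c m : ℤ) (h : c - n + 1 = m) :
    ∑ x ∈ Finset.HasAntidiagonal.antidiagonal n, (face₁ φ n c m h x + face₂ φ n c m h x) =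
      faceι M n c m h ≫ sumComponents φ m := by
  cases n with
  | zero =>
    rw [faceι, Limits.zero_comp]
    exact Finset.sum_eq_zero fun x hx => face_zero φ c m h x hx
  | succ n =>
    have z1 : face₁ φ (n + 1) c m h (0, n + 1) = 0 := by
      rw [face₁_of φ (n + 1) c m _ 0 (n + 1) (by omega), faceColumns₁, Limits.comp_zero]
    have z2 : face₂ φ (n + 1) c m h (n + 1, 0) = 0 := by
      rw [face₂_of φ (n + 1) c m _ (n + 1) 0 (by omega), faceColumns₂, Limits.comp_zero, smul_zero]
    rw [faceι, Category.assoc, ι_sumComponents, Preadditive.comp_sum,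
      Finset.sum_add_distrib, Finset.Nat.sum_antidiagonal_succ, z1, zero_add,
      Finset.Nat.sum_antidiagonal_succ', z2, zero_add, ← Finset.sum_add_distrib]
    refine Finset.sum_congr rfl fun x hx => ?_
    exact (d_component φ hφ n c m (by push_cast at h; omega) x.1 x.2
      (Finset.HasAntidiagonal.mem_antidiagonal.1 hx)).symm

theorem sumComponents_d
    (hφ : ∀ p q n (h : p + q = n), M.d (n + 1) n ≫ φ p q n h =
      φ (p + 1) q (n + 1) (by omega) ≫ (K.d (p + 1) p ▷ L.X q) +
        (-1 : ℤ) ^ p • (φ p (q + 1) (n + 1) (by omega) ≫ (K.X p ◁ L.d (q + 1) q)))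
    (m m' : ℤ) (hm : m + 1 = m') :
    sumComponents φ m ≫ (K.total (ComplexShape.up ℤ) ⊗ L.total (ComplexShape.up ℤ)).d m m' =
      (M.total (ComplexShape.up ℤ)).d m m' ≫ sumComponents φ m' := by
  refine HomologicalComplex₂.total.hom_ext (c₁₂ := ComplexShape.up ℤ) fun n c h => ?_
  have h' : c - (n : ℤ) = m := h
  change ι M n c m h' ≫ _ = ι M n c m h' ≫ _
  rw [← Category.assoc, ι_sumComponents, Preadditive.sum_comp,
    Finset.sum_congr rfl (fun x hx => component_d φ n c m m' h' hm x hx),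
    Finset.sum_add_distrib, sum_faces φ hφ, ← Category.assoc, ι_d M n c m m' h' hm,
    Preadditive.add_comp, Linear.units_smul_comp, Category.assoc, ι_sumComponents,
    Preadditive.comp_sum, Finset.smul_sum]

end SimplicialTotal

/-- The Alexander–Whitney map `CH(E ⊗ E') ⟶ CH(E) ⊗ CH(E')`. It is inverse to the shuffle map
up to homotopy. -/
noncomputable def alexanderWhitney (E E' : CyclicComplex R) :
    CH.obj (E ⊗ E') ⟶ CH.obj E ⊗ CH.obj E' where
  f m := SimplicialTotal.sumComponents (M := hochschildBicomplex.obj (E ⊗ E'))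
    (K := hochschildBicomplex.obj E) (L := hochschildBicomplex.obj E')
    (fun p q n h => CyclicComplex.frontBack E E' p q n h) m
  comm' m m' hm := by
    refine SimplicialTotal.sumComponents_d (M := hochschildBicomplex.obj (E ⊗ E'))
      (K := hochschildBicomplex.obj E) (L := hochschildBicomplex.obj E')
      (fun p q n h => CyclicComplex.frontBack E E' p q n h) (fun p q n h => ?_) m m' hm
    rw [hochschildBicomplex_d, hochschildBicomplex_d, hochschildBicomplex_d]
    exact CyclicComplex.b_frontBack E E' p q n h

end
/-! ### Derived tensor products and the derived Connes–Tsygan differential -/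

section

variable {R : Type u} [CommRing R]

/-- A complex of `R`-modules is homotopically flat if its tensor product with every acyclic complex
is acyclic. -/
def HomotopicallyFlat (K : CochainComplex (ModuleCat.{u} R) ℤ) : Prop :=
  ∀ X : CochainComplex (ModuleCat.{u} R) ℤ, X.Acyclic → (K ⊗ X).Acyclic

namespace CyclicComplex

/-- Acyclicity of complexes of functors; it can be checked pointwise. -/
def Acyclic (X : CyclicComplex R) : Prop :=
  ∀ n, (X.obj n).Acyclic

/-- A complex of functors is homotopically flat if its pointwise tensor product with every acyclic
complex of functors is acyclic. -/
def HomotopicallyFlat (P : CyclicComplex R) : Prop :=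
  ∀ X : CyclicComplex R, X.Acyclic → (P ⊗ X).Acyclic

/-- A homotopically flat replacement of a complex of functors. The derived tensor product of
two complexes of functors is computed as the tensor product of such replacements. -/
structure FlatResolution (E : CyclicComplex R) where
  obj : CyclicComplex R
  hom : obj ⟶ E
  quasiIso : ∀ n, QuasiIso (hom.app n)
  flat : obj.HomotopicallyFlat

end CyclicComplex

/-- The map `f ⊗ id : X ⊗ Y ⟶ (X ⊗ Y)[-1]` for `f : X ⟶ X[-1]`. -/
noncomputable def tensorShiftLeft {X : CochainComplex (ModuleCat.{u} R) ℤ}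
    (f : X ⟶ X⟦(-1 : ℤ)⟧) (Y : CochainComplex (ModuleCat.{u} R) ℤ) :
    X ⊗ Y ⟶ (X ⊗ Y)⟦(-1 : ℤ)⟧ :=
  (f ▷ Y) ≫ (CochainComplex.mapBifunctorShift₁Iso X Y (curriedTensor (ModuleCat.{u} R)) (-1)).hom

/-- The map `id ⊗ g : X ⊗ Y ⟶ (X ⊗ Y)[-1]` for `g : Y ⟶ Y[-1]`, with the Koszul sign: it sends
`x ⊗ y` to `(-1) ^ |x| x ⊗ g y`. -/
noncomputable def tensorShiftRight (X : CochainComplex (ModuleCat.{u} R) ℤ)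
    {Y : CochainComplex (ModuleCat.{u} R) ℤ} (g : Y ⟶ Y⟦(-1 : ℤ)⟧) :
    X ⊗ Y ⟶ (X ⊗ Y)⟦(-1 : ℤ)⟧ :=
  (X ◁ g) ≫ (CochainComplex.mapBifunctorShift₂Iso X Y (curriedTensor (ModuleCat.{u} R)) (-1)).hom

/-- The morphism of degree `-1` in the derived category which is defined by a map of complexes of
degree `-1`. -/
noncomputable def toDerived [HasDerivedCategory.{w} (ModuleCat.{u} R)]
    {X : CochainComplex (ModuleCat.{u} R) ℤ} (f : X ⟶ X⟦(-1 : ℤ)⟧) :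
    DerivedCategory.Q.obj X ⟶ (DerivedCategory.Q.obj X)⟦(-1 : ℤ)⟧ :=
  DerivedCategory.Q.map f ≫ (DerivedCategory.Q.commShiftIso (-1 : ℤ)).hom.app X

end

/-! ### The paracyclic category -/

namespace CyclicCat.Lift

variable {m n : ℕ}

/-! The method is that of acyclic models, carried out over the paracyclic category, in which the
deck transformation T of the universal covering of a circle is kept as a nontrivial automorphism.
There a morphism from `X` to the object with n + 1 vertices is a sequence of integers a_0 ≤ … ≤ a_n
≤ a_0 + (`X.len` + 1), and a face omits an entry. As n varies these sequences form a contractible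
semisimplicial set. Its quotient by T, which is what the cyclic category sees, has the homotopy type
of a circle, so the argument would break down there.

The contraction is explicit (`Paracyclic.contraction`). Truncate all entries to the interval [c - k,
k] and let c grow from 0 to 2k. Each increase of c is a prism homotopy, and the last truncation is
the constant k. A given formal sum of morphisms is fixed by the first truncation when k is large.
Applied to both variables, this shows that the diagonal complex and the total complex of formal sums
of pairs of paracyclic morphisms have no homology in positive degrees, tested by every object
(`diag_exact`, `total_exact`). Maps from any complex into such a complex can be built, and maps
compared, degree by degree once the lowest degree is settled (`LiftsCycles.exists_hom`,
`LiftsCycles.exists_homotopy`). The Alexander–Whitney map of the models is an isomorphism in degree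
zero, hence a homotopy equivalence (`exists_shuffle`); no shuffle above degree one has to be written
down.

For a paracyclic object the operator B = (1 - t) s N no longer anticommutes with b: instead bB + Bb
= 1 - T (`ParacyclicObject.connesB_b`). For a pair of paracyclic variables the right operator on the
total complex is B₁ ± T₁B₂, since its defect is (1 - T₁) + T₁(1 - T₂) = 1 - T₁T₂, the same as the
defect of the operator of the diagonal. The difference of the two composites of these operators with
the Alexander–Whitney map therefore anticommutes with the boundaries. Its lowest component is a
cycle of degree one, hence a boundary, and the difference is null homotopic
(`exists_connes_homotopy`). No formula for this homotopy is needed.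

A pair of complexes of functors E, E' on the cyclic category defines an additive functor on the
models (`realizeMat`), which sends T₁ and T₂ to identities. It transports all these homotopies. The
diagonal model becomes the bicomplex of E ⊗ E', the total model becomes a bicomplex whose total
complex is CH(E) ⊗ CH(E') (`totalIso`), and B₁ ± T₁B₂ becomes the sum in the statement with its
Koszul sign (`raiseBy_connesDiffMap`). All coefficients are integers, so nothing is asked of R.

For the statement about replacements, a map of bicomplexes which is a quasi-isomorphism on the
columns is one on total complexes, by induction on the simplicial degree (`quasiIso_total_map`). If
P is homotopically flat and Y is acyclic, then CH(P) ⊗ Y is a retract of CH(P) ⊗ CH(Y), with Y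
regarded as a constant functor. The Alexander–Whitney map identifies the latter, up to
quasi-isomorphism, with CH(P ⊗ Y), which is acyclic (`HomotopicallyFlat.CH_obj`). -/

theorem le_toFun_iff (f : Lift m n) (i k : ℤ) :
    (∃ l, IsLeast {k | i ≤ f.toFun k} l ∧ l ≤ k) ↔ i ≤ f.toFun k := by
  constructor
  · rintro ⟨l, hl, hlk⟩
    exact le_trans hl.1 (f.monotone' hlk)
  · intro h
    have hb : BddBelow {k | i ≤ f.toFun k} := by
      -- Each period to the left lowers the value by n + 1 ≥ 1, so |f 0 - i| + 1 periods to the left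
      -- of 0 the value is already below `i`.
      refine ⟨-(|f.toFun 0 - i| + 1) * (m + 1), fun k hk => ?_⟩
      by_contra! hlt
      have h1 := f.monotone' hlt.le
      have h2 := f.map_add_mul 0 (-(|f.toFun 0 - i| + 1))
      rw [zero_add] at h2
      rw [h2] at h1
      have h3 := le_abs_self (f.toFun 0 - i)
      have hk : i ≤ f.toFun k := hk
      nlinarith [abs_nonneg (f.toFun 0 - i)]
    obtain ⟨l, hl⟩ := Int.exists_least_of_bdd (P := fun k => i ≤ f.toFun k)
      ⟨hb.choose, fun z hz => hb.choose_spec hz⟩ ⟨k, h⟩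
    exact ⟨l, ⟨hl.1, fun z hz => hl.2 z hz⟩, hl.2 k h⟩

theorem exists_isLeast (f : Lift m n) (i : ℤ) : ∃ l, IsLeast {k | i ≤ f.toFun k} l := by
  have h : i ≤ f.toFun ((|i - f.toFun 0|) * (m + 1)) := by
    have h2 := f.map_add_mul 0 (|i - f.toFun 0|)
    rw [zero_add] at h2
    rw [h2]
    have h3 := le_abs_self (i - f.toFun 0)
    nlinarith [abs_nonneg (i - f.toFun 0)]
  obtain ⟨l, hl, -⟩ := (f.le_toFun_iff i _).2 h
  exact ⟨l, hl⟩

/-- The left adjoint of a lift, as a map of ordered sets. -/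
noncomputable def adjFun (f : Lift m n) (i : ℤ) : ℤ := (f.exists_isLeast i).choose

theorem adjFun_le_iff (f : Lift m n) (i k : ℤ) : f.adjFun i ≤ k ↔ i ≤ f.toFun k := by
  have h := (f.exists_isLeast i).choose_spec
  exact ⟨fun h' => h.1.trans (f.monotone' h'), fun h' => h.2 h'⟩

theorem adjFun_unique (f : Lift m n) (g : ℤ → ℤ) (hg : ∀ i k, g i ≤ k ↔ i ≤ f.toFun k) :
    f.adjFun = g := by
  funext i
  exact le_antisymm ((f.adjFun_le_iff _ _).2 ((hg _ _).1 le_rfl))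
    ((hg _ _).2 ((f.adjFun_le_iff _ _).1 le_rfl))

theorem toFun_sub (f : Lift m n) (k : ℤ) : f.toFun (k - (m + 1)) = f.toFun k - (n + 1) := by
  have := f.map_add' (k - (m + 1))
  rw [sub_add_cancel] at this
  linarith

/-- The left adjoint of a lift. -/
noncomputable def adj (f : Lift m n) : Lift n m where
  toFun := f.adjFun
  monotone' i j h := (f.adjFun_le_iff _ _).2 (h.trans ((f.adjFun_le_iff _ _).1 le_rfl))
  map_add' i := by
    have h : f.adjFun = fun i => f.adjFun (i + (n + 1)) - (m + 1) := by
      refine f.adjFun_unique _ fun i k => ?_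
      rw [sub_le_iff_le_add, adjFun_le_iff, f.map_add']
      omega
    have := congrFun h i
    linarith

theorem adj_eq (f : Lift m n) (g : Lift n m) (h : ∀ i k, g.toFun i ≤ k ↔ i ≤ f.toFun k) :
    f.adj = g := Lift.ext (f.adjFun_unique _ h)

theorem adj_le_iff (f : Lift m n) (i k : ℤ) : f.adj.toFun i ≤ k ↔ i ≤ f.toFun k :=
  f.adjFun_le_iff i k

/-- The lift with prescribed values on `0, …, m`. -/
def ofSeq (s : ℕ → ℤ) (hs : ∀ k < m, s k ≤ s (k + 1)) (hm : s m ≤ s 0 + (n + 1)) : Lift m n where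
  toFun k := s (k % (m + 1)).toNat + (k / (m + 1)) * (n + 1)
  monotone' := by
    have hs' : ∀ k l, k ≤ l → l ≤ m → s k ≤ s l := by
      intro k l hkl
      induction l, hkl using Nat.le_induction with
      | base => intro _; rfl
      | succ l hkl ih => intro hl; exact (ih (by omega)).trans (hs l (by omega))
    refine monotone_int_of_le_succ fun k => ?_
    obtain ⟨r, q, rfl⟩ := CyclicCat.exists_eq_add_mul m k
    have hr := r.isLt
    have e1 : ((r : ℕ) + q * ((m : ℤ) + 1)) % (m + 1) = (r : ℕ) := by
      rw [Int.add_mul_emod_self_right]; exact Int.emod_eq_of_lt (by omega) (by omega)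
    have e2 : ((r : ℕ) + q * ((m : ℤ) + 1)) / (m + 1) = q := by
      rw [Int.add_mul_ediv_right _ _ (by omega), Int.ediv_eq_zero_of_lt (by omega) (by omega),
        zero_add]
    rw [e1, e2]
    by_cases h : (r : ℕ) = m
    -- At the end of a period the next value is that of the first vertex of the next period, and the
    -- inequality is `hm`.
    · have e3 : ((r : ℕ) + q * ((m : ℤ) + 1)) + 1 = 0 + (q + 1) * (m + 1) := by rw [h]; ring
      rw [e3, Int.add_mul_emod_self_right, Int.add_mul_ediv_right _ _ (by omega), h]
      simp only [Int.toNat_natCast, Int.zero_emod, Int.toNat_zero, Int.zero_ediv]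
      linarith
    · have e3 : ((r : ℕ) + q * ((m : ℤ) + 1)) + 1 = ((r + 1 : ℕ) : ℤ) + q * (m + 1) := by
        push_cast; ring
      rw [e3, Int.add_mul_emod_self_right, Int.add_mul_ediv_right _ _ (by omega),
        Int.emod_eq_of_lt (by omega) (by omega), Int.ediv_eq_zero_of_lt (by omega) (by omega)]
      simp only [Int.toNat_natCast, zero_add]
      have := hs r (by omega)
      linarith
  map_add' k := by
    rw [Int.add_emod_right, Int.add_ediv_of_dvd_right (dvd_refl _), Int.ediv_self (by omega)]
    ring

theorem ofSeq_apply (s : ℕ → ℤ) (hs : ∀ k < m, s k ≤ s (k + 1)) (hm : s m ≤ s 0 + (n + 1))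
    (k : ℕ) (hk : k ≤ m) : (ofSeq (n := n) s hs hm).toFun k = s k := by
  change s ((k : ℤ) % (m + 1)).toNat + ((k : ℤ) / (m + 1)) * (n + 1) = _
  rw [Int.emod_eq_of_lt (by omega) (by omega), Int.ediv_eq_zero_of_lt (by omega) (by omega)]
  simp

/-- By periodicity one period decides. Most identities between paracyclic morphisms are checked in
this way. -/
theorem ext_nat {f g : Lift m n} (h : ∀ k : ℕ, k ≤ m → f.toFun k = g.toFun k) : f = g := by
  refine Lift.ext (funext fun k => ?_)
  obtain ⟨r, q, rfl⟩ := CyclicCat.exists_eq_add_mul m k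
  rw [f.map_add_mul, g.map_add_mul, h r (by omega)]

/-- Besides monotonicity this is the only constraint on the values in one period, as `ofSeq` shows.
-/
theorem toFun_last_le (f : Lift m n) : f.toFun m ≤ f.toFun 0 + (n + 1) := by
  rw [← f.map_add', zero_add]
  exact f.monotone' (by omega)

end CyclicCat.Lift

open CyclicCat (Lift)

/-- Objects of the paracyclic category, numbered as those of the cyclic category. -/
structure Paracyclic where
  len : ℕ

namespace Paracyclic

/-- Arrows are opposite to lifts. With this variance a morphism to `⟨n⟩` is a sequence of n + 1
integers in the vertices of the source, and composition with a face omits an entry. -/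
instance : Category Paracyclic where
  Hom X Y := Lift Y.len X.len
  id X := Lift.id X.len
  comp f g := Lift.comp g f

@[ext]
theorem hom_ext {X Y : Paracyclic} {f g : X ⟶ Y}
    (h : ∀ k : ℕ, k ≤ Y.len → Lift.toFun f k = Lift.toFun g k) : f = g := Lift.ext_nat h

theorem comp_toFun {X Y Z : Paracyclic} (f : X ⟶ Y) (g : Y ⟶ Z) (k : ℤ) :
    Lift.toFun (f ≫ g) k = Lift.toFun f (Lift.toFun g k) := rfl

theorem id_toFun (X : Paracyclic) (k : ℤ) : Lift.toFun (𝟙 X) k = k := rfl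

/-- The functor to the cyclic category. -/
noncomputable def toCyclic : Paracyclic ⥤ CyclicCat where
  obj X := ⟨X.len⟩
  -- Passage to the left adjoint restores the direction of the lifts, and adjoints compose in the
  -- opposite order.
  map f := CyclicCat.ofLift (Lift.adj f)
  map_id X := congrArg CyclicCat.ofLift (Lift.adj_eq _ (Lift.id X.len) fun _ _ => Iff.rfl)
  map_comp f g := congrArg CyclicCat.ofLift
    (Lift.adj_eq _ (Lift.comp (Lift.adj f) (Lift.adj g)) fun i k => by
      change (Lift.adj g).toFun ((Lift.adj f).toFun i) ≤ k ↔ i ≤ Lift.toFun f (Lift.toFun g k)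
      rw [Lift.adj_le_iff, Lift.adj_le_iff])

/-- The periodic extension of an order preserving map. -/
def periodic {m n : ℕ} (g : Fin (m + 1) →o Fin (n + 1)) : Lift m n where
  toFun := CyclicCat.periodize g
  monotone' k l h := by
    rw [← CyclicCat.dualFun_le_iff]
    exact ((CyclicCat.dualFun_le_iff g _ _).2 le_rfl).trans h
  map_add' k := by
    obtain ⟨r, q, rfl⟩ := CyclicCat.exists_eq_add_mul m k
    rw [show ((r : ℕ) : ℤ) + q * (m + 1) + (m + 1) = (r : ℕ) + (q + 1) * (m + 1) by ring,
      CyclicCat.periodize_eq, CyclicCat.periodize_eq]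
    ring

theorem periodic_apply {m n : ℕ} (g : Fin (m + 1) →o Fin (n + 1)) (k : ℕ) (hk : k < m + 1) :
    (periodic g).toFun k = ((g ⟨k, hk⟩ : Fin (n + 1)) : ℕ) := by
  have : CyclicCat.periodize g k = ((g ⟨k, hk⟩ : Fin (n + 1)) : ℕ) := by
    simpa using CyclicCat.periodize_eq g ⟨k, hk⟩ 0
  exact this

/-- The functor from the opposite of the simplex category. -/
def ofSimplex : SimplexCategoryᵒᵖ ⥤ Paracyclic where
  obj X := ⟨X.unop.len⟩
  map φ := periodic φ.unop.toOrderHom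
  map_id _ := hom_ext fun k hk => periodic_apply _ k (Nat.lt_succ_of_le hk)
  map_comp _ _ := Lift.ext (funext fun k => (CyclicCat.periodize_comp _ _ k).symm)

/-- The image of a morphism of the simplex category. -/
abbrev simplexMap {m n : ℕ} (φ : SimplexCategory.mk m ⟶ SimplexCategory.mk n) :
    (⟨n⟩ : Paracyclic) ⟶ ⟨m⟩ := ofSimplex.map φ.op

/-- The lift `dualFun` is the left adjoint of the periodic extension, by `dualFun_le_iff`. Hence the
functor from Δᵒᵖ to the cyclic category factors through the paracyclic one. -/
theorem toCyclic_simplexMap {m n : ℕ} (φ : SimplexCategory.mk m ⟶ SimplexCategory.mk n) :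
    toCyclic.map (simplexMap φ) = CyclicCat.ofSimplex.map φ.op :=
  congrArg CyclicCat.ofLift (Lift.adj_eq _ _ fun i k => CyclicCat.dualFun_le_iff _ i k)

def face {n : ℕ} (i : Fin (n + 2)) : (⟨n + 1⟩ : Paracyclic) ⟶ ⟨n⟩ :=
  simplexMap (SimplexCategory.δ i)

def degen {n : ℕ} (i : Fin (n + 1)) : (⟨n⟩ : Paracyclic) ⟶ ⟨n + 1⟩ :=
  simplexMap (SimplexCategory.σ i)

theorem face_apply {n : ℕ} (i : Fin (n + 2)) (k : ℕ) (hk : k ≤ n) :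
    Lift.toFun (face i) k = if k < (i : ℕ) then (k : ℤ) else k + 1 := by
  refine (periodic_apply _ k (Nat.lt_succ_of_le hk)).trans ?_
  refine (congrArg (Nat.cast (R := ℤ)) (δ_apply_val i ⟨k, Nat.lt_succ_of_le hk⟩)).trans ?_
  simp only
  split_ifs <;> push_cast <;> rfl

theorem degen_apply {n : ℕ} (i : Fin (n + 1)) (k : ℕ) (hk : k ≤ n + 1) :
    Lift.toFun (degen i) k = if k ≤ (i : ℕ) then (k : ℤ) else k - 1 := by
  refine (periodic_apply _ k (Nat.lt_succ_of_le hk)).trans ?_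
  change (((i.predAbove (⟨k, Nat.lt_succ_of_le hk⟩ : Fin (n + 2)) : Fin (n + 1)) : ℕ) : ℤ) = _
  split_ifs with h
  · rw [Fin.predAbove_of_le_castSucc _ _ (by simpa [Fin.le_def] using h)]
    simp
  · rw [Fin.predAbove_of_castSucc_lt _ _ (by simpa [Fin.lt_def] using h)]
    simp only [Fin.val_pred]
    omega

theorem toCyclic_face {n : ℕ} (i : Fin (n + 2)) :
    toCyclic.map (face i) = CyclicCat.face i := toCyclic_simplexMap _

/-- The rotation by `j`. -/
def rotPow (n : ℕ) (j : ℤ) : (⟨n⟩ : Paracyclic) ⟶ ⟨n⟩ where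
  -- The inverse translation, because the functor to the cyclic category takes left adjoints.
  toFun k := k - j
  monotone' _ _ h := by simpa using h
  map_add' _ := by ring

theorem rotPow_toFun (n : ℕ) (j k : ℤ) : Lift.toFun (rotPow n j) k = k - j := rfl

/-- The rotation. -/
abbrev rot (n : ℕ) : (⟨n⟩ : Paracyclic) ⟶ ⟨n⟩ := rotPow n 1

theorem rotPow_comp (n : ℕ) (i j : ℤ) : rotPow n i ≫ rotPow n j = rotPow n (i + j) :=
  Lift.ext (funext fun k => by rw [comp_toFun]; simp only [rotPow_toFun]; ring)

theorem rotPow_zero (n : ℕ) : rotPow n 0 = 𝟙 _ :=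
  Lift.ext (funext fun k => by rw [rotPow_toFun, id_toFun, sub_zero])

theorem toCyclic_rot (n : ℕ) : toCyclic.map (rot n) = CyclicCat.rot n := by
  refine congrArg CyclicCat.ofLift (Lift.adj_eq _ _ fun i k => ?_)
  change i + 1 ≤ k ↔ i ≤ k - 1
  omega

/-- The deck transformation. -/
abbrev deck (X : Paracyclic) : X ⟶ X := rotPow X.len (X.len + 1)

/-- Lifts that differ by a deck transformation define the same map of circles. This is what finally
removes all the defects 1 - T. -/
theorem toCyclic_deck (X : Paracyclic) : toCyclic.map (deck X) = 𝟙 _ := by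
  have : Lift.adj (deck X) = (⟨fun k => k + (X.len + 1), fun _ _ h => by simpa using h,
      fun _ => by ring⟩ : Lift X.len X.len) := by
    refine Lift.adj_eq _ _ fun i k => ?_
    change i + _ ≤ k ↔ i ≤ k - _
    omega
  refine (congrArg CyclicCat.ofLift this).trans (CyclicCat.ofLift_eq (-1) fun k => ?_)
  change k = (k + ((X.len : ℤ) + 1)) + -1 * ((X.len : ℤ) + 1)
  ring

/-- Periodicity of lifts, read as centrality of the deck transformation. -/
theorem deck_naturality {X Y : Paracyclic} (f : X ⟶ Y) : deck X ≫ f = f ≫ deck Y := by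
  refine Lift.ext (funext fun k => ?_)
  rw [comp_toFun, comp_toFun, rotPow_toFun, rotPow_toFun, Lift.toFun_sub]

/-- The extra degeneracy. -/
def extraDegen (n : ℕ) : (⟨n⟩ : Paracyclic) ⟶ ⟨n + 1⟩ :=
  -- The sequence -1, 0, …, n; its last entry equals the first one plus n + 1, so the bound on the
  -- last entry is attained.
  Lift.ofSeq (fun k => (k : ℤ) - 1) (fun _ _ => by simp) (by push_cast; simp)

theorem extraDegen_apply (n k : ℕ) (hk : k ≤ n + 1) :
    Lift.toFun (extraDegen n) k = (k : ℤ) - 1 := Lift.ofSeq_apply _ _ _ k hk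

theorem toCyclic_extraDegen (n : ℕ) : toCyclic.map (extraDegen n) = CyclicCat.extraDegen n := by
  refine congrArg CyclicCat.ofLift (Lift.adj_eq _ _ fun i k => ?_)
  obtain ⟨r, q, rfl⟩ := CyclicCat.exists_eq_add_mul n i
  obtain ⟨s, t, rfl⟩ := CyclicCat.exists_eq_add_mul (n + 1) k
  rw [Lift.map_add_mul, Lift.map_add_mul, extraDegen_apply n s (by omega)]
  change ((r : ℕ) : ℤ) + ((r : ℕ) : ℤ) / (n + 1) + 1 + _ ≤ _ ↔ _
  rw [Int.ediv_eq_zero_of_lt (by omega) (by omega)]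
  have hr := r.isLt
  have hs := s.isLt
  simp only
  push_cast
  rcases lt_trichotomy q t with h | rfl | h
  · have e1 : (q + 1) * ((n : ℤ) + 1) ≤ t * (n + 1) := mul_le_mul_of_nonneg_right h (by positivity)
    constructor <;> intro <;> nlinarith
  · constructor <;> intro <;> linarith
  · have e1 : (t + 1) * ((n : ℤ) + 1) ≤ q * (n + 1) := mul_le_mul_of_nonneg_right h (by positivity)
    constructor <;> intro <;> nlinarith

theorem rot_face_succ {n : ℕ} (i : Fin (n + 1)) :
    rot (n + 1) ≫ face i.succ = face i.castSucc ≫ rot n := by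
  ext k hk
  simp only at hk
  rw [comp_toFun, comp_toFun, face_apply _ k hk, rotPow_toFun, rotPow_toFun]
  obtain _ | k := k
  -- The argument -1 lies outside of the period 0, …, n on which the face is known; periodicity
  -- brings it to n.
  · have := Lift.map_add' (face i.castSucc) (((0 : ℕ) : ℤ) - 1)
    rw [show ((0 : ℕ) : ℤ) - 1 + ((n : ℤ) + 1) = (n : ℕ) by push_cast; ring] at this
    rw [face_apply _ n le_rfl] at this
    simp only [Fin.val_castSucc, Fin.val_succ] at this ⊢
    have := i.isLt
    split_ifs at * <;> push_cast at * <;> omega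
  · rw [show ((k + 1 : ℕ) : ℤ) - 1 = (k : ℕ) by push_cast; ring, face_apply _ k (by omega)]
    simp only [Fin.val_castSucc, Fin.val_succ]
    split_ifs <;> push_cast <;> omega

theorem rot_face_zero (n : ℕ) : rot (n + 1) ≫ face (0 : Fin (n + 2)) = face (Fin.last (n + 1)) := by
  ext k hk
  simp only at hk
  rw [comp_toFun, face_apply _ k hk, face_apply _ k hk, rotPow_toFun]
  simp only [Fin.val_zero, Fin.val_last]
  split_ifs <;> omega

theorem extraDegen_face_zero (n : ℕ) : extraDegen n ≫ face (0 : Fin (n + 2)) = 𝟙 _ := by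
  ext k hk
  simp only at hk
  rw [comp_toFun, face_apply _ k hk, id_toFun]
  simp only [Fin.val_zero, not_lt_zero, if_false]
  exact (extraDegen_apply n (k + 1) (by omega)).trans (by push_cast; ring)

theorem extraDegen_face_succ {n : ℕ} (i : Fin (n + 1)) :
    extraDegen (n + 1) ≫ face (i.castSucc.succ : Fin (n + 3)) =
      face (i.castSucc : Fin (n + 2)) ≫ extraDegen n := by
  ext k hk
  simp only at hk
  rw [comp_toFun, comp_toFun, face_apply _ k hk, extraDegen_apply _ k hk]
  have hi := i.isLt
  have e : (if k < ((i.castSucc.succ : Fin (n + 3)) : ℕ) then (k : ℤ) else k + 1) =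
      ((if k ≤ i then k else k + 1 : ℕ) : ℤ) := by
    simp only [Fin.val_castSucc, Fin.val_succ]
    split_ifs <;> push_cast <;> omega
  rw [e, extraDegen_apply _ _ (by split_ifs <;> omega)]
  obtain _ | k := k
  · have := Lift.map_add' (face i.castSucc) (((0 : ℕ) : ℤ) - 1)
    rw [show ((0 : ℕ) : ℤ) - 1 + ((n : ℤ) + 1) = (n : ℕ) by push_cast; ring] at this
    rw [face_apply _ n le_rfl] at this
    simp only [Fin.val_castSucc] at this ⊢
    split_ifs at * <;> push_cast at * <;> omega
  · rw [show ((k + 1 : ℕ) : ℤ) - 1 = (k : ℕ) by push_cast; ring, face_apply _ k (by omega)]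
    simp only [Fin.val_castSucc]
    split_ifs <;> push_cast <;> omega

end Paracyclic

/-! ### The Connes operator of a paracyclic object -/

namespace ParacyclicObject

open Paracyclic

variable {C : Type*} [Category* C] [Preadditive C] (F : Paracyclic ⥤ C)

/-- The Hochschild differential. -/
def b (n : ℕ) : F.obj ⟨n + 1⟩ ⟶ F.obj ⟨n⟩ :=
  ∑ i : Fin (n + 2), (-1 : ℤ) ^ (i : ℕ) • F.map (face i)

/-- The alternating sum of all face maps but the last one. -/
def b' (n : ℕ) : F.obj ⟨n + 1⟩ ⟶ F.obj ⟨n⟩ :=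
  ∑ i : Fin (n + 1), (-1 : ℤ) ^ (i : ℕ) • F.map (face i.castSucc)

/-- The powers of the signed rotation. -/
def t (n : ℕ) (j : ℤ) : F.obj ⟨n⟩ ⟶ F.obj ⟨n⟩ := (j * n).negOnePow • F.map (rotPow n j)

/-- The norm `1 + t + ⋯ + tⁿ`. -/
def normOp (n : ℕ) : F.obj ⟨n⟩ ⟶ F.obj ⟨n⟩ := ∑ j ∈ Finset.range (n + 1), t F n j

/-- The operator `(1 - t) s N`. -/
def connesB (n : ℕ) : F.obj ⟨n⟩ ⟶ F.obj ⟨n + 1⟩ :=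
  normOp F n ≫ F.map (extraDegen n) ≫ (𝟙 _ - t F (n + 1) 1)

theorem coe_negOnePow_natCast (n : ℕ) : (((n : ℤ).negOnePow : ℤˣ) : ℤ) = (-1) ^ n := by
  rw [Int.negOnePow_def]
  simp

theorem t_zero (n : ℕ) : t F n 0 = 𝟙 _ := by simp [t, rotPow_zero]

theorem units_smul_comp {X Y Z : C} (e : ℤˣ) (f : X ⟶ Y) (g : Y ⟶ Z) :
    (e • f) ≫ g = e • (f ≫ g) := by
  rw [Units.smul_def, Units.smul_def, Preadditive.zsmul_comp]

theorem comp_units_smul {X Y Z : C} (e : ℤˣ) (f : X ⟶ Y) (g : Y ⟶ Z) :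
    f ≫ (e • g) = e • (f ≫ g) := by
  rw [Units.smul_def, Units.smul_def, Preadditive.comp_zsmul]

theorem t_comp (n : ℕ) (i j : ℤ) : t F n i ≫ t F n j = t F n (i + j) := by
  rw [t, t, t, units_smul_comp, comp_units_smul, smul_smul, ← F.map_comp, rotPow_comp,
    ← Int.negOnePow_add, add_mul]

theorem t_comp_assoc (n : ℕ) (i j : ℤ) {Z : C} (f : F.obj ⟨n⟩ ⟶ Z) :
    t F n i ≫ t F n j ≫ f = t F n (i + j) ≫ f := by
  rw [← Category.assoc, t_comp]

/-- The sign is that of n (n + 1), hence trivial. The relation tⁿ⁺¹ = 1 of cyclic objects is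
weakened to this one. -/
theorem t_self (n : ℕ) : t F n (n + 1) = F.map (deck ⟨n⟩) := by
  rw [t, Int.negOnePow_even _ (by simpa [mul_comm] using Int.even_mul_succ_self (n : ℤ)), one_smul]

theorem t_deck (n : ℕ) (j : ℤ) : t F n (j + (n + 1)) = F.map (deck ⟨n⟩) ≫ t F n j := by
  rw [← t_self, t_comp, add_comm]

theorem deck_comm {X Y : Paracyclic} (f : X ⟶ Y) :
    F.map (deck X) ≫ F.map f = F.map f ≫ F.map (deck Y) := by
  rw [← F.map_comp, deck_naturality, F.map_comp]

theorem t_one_face_succ {n : ℕ} (i : Fin (n + 1)) :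
    t F (n + 1) 1 ≫ F.map (face i.succ) = -(F.map (face i.castSucc) ≫ t F n 1) := by
  rw [t, t, units_smul_comp, comp_units_smul, ← F.map_comp, rot_face_succ, F.map_comp, one_mul,
    one_mul, Nat.cast_add, Nat.cast_one, Int.negOnePow_succ, Units.neg_smul]

theorem t_one_face_zero (n : ℕ) : t F (n + 1) 1 ≫ F.map (face (0 : Fin (n + 2))) =
    (-1 : ℤ) ^ (n + 1) • F.map (face (Fin.last (n + 1))) := by
  rw [t, units_smul_comp, ← F.map_comp, rot_face_zero, one_mul, Units.smul_def,
    coe_negOnePow_natCast]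

theorem b_eq (n : ℕ) :
    b F n = b' F n + (-1 : ℤ) ^ (n + 1) • F.map (face (Fin.last (n + 1))) := by
  rw [b, b', Fin.sum_univ_castSucc]
  simp

theorem t_b (n : ℕ) : t F (n + 1) 1 ≫ b F n =
    b' F n ≫ t F n 1 + (-1 : ℤ) ^ (n + 1) • F.map (face (Fin.last (n + 1))) := by
  rw [b, b', Fin.sum_univ_succ, Preadditive.comp_add, Preadditive.comp_sum,
    Preadditive.sum_comp]
  refine (add_comm _ _).trans ?_
  congr 1
  · refine Finset.sum_congr rfl fun i _ => ?_
    rw [Preadditive.comp_zsmul, t_one_face_succ, Preadditive.zsmul_comp, Fin.val_succ, pow_succ,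
      mul_neg_one, neg_smul, smul_neg, neg_neg]
  · rw [Preadditive.comp_zsmul, t_one_face_zero]
    simp

theorem one_sub_t_b (n : ℕ) :
    (𝟙 _ - t F (n + 1) 1) ≫ b F n = b' F n ≫ (𝟙 _ - t F n 1) := by
  rw [Preadditive.sub_comp, Category.id_comp, t_b, b_eq, Preadditive.comp_sub, Category.comp_id]
  abel

/-- The extra degeneracy splits the zeroth face and moves each other face down by one, which changes
its sign. So it contracts the complex with the differential `b'`. -/
theorem extraDegen_b' (n : ℕ) :
    F.map (extraDegen (n + 1)) ≫ b' F (n + 1) = 𝟙 _ - b' F n ≫ F.map (extraDegen n) := by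
  rw [b', b', Fin.sum_univ_succ, Preadditive.comp_add, Preadditive.comp_sum,
    Preadditive.sum_comp, sub_eq_add_neg, ← Finset.sum_neg_distrib]
  congr 1
  · simp only [Fin.val_zero, pow_zero, one_smul, Fin.castSucc_zero, ← F.map_comp]
    rw [extraDegen_face_zero, F.map_id]
  · refine Finset.sum_congr rfl fun i _ => ?_
    rw [← Fin.succ_castSucc, Preadditive.comp_zsmul, Preadditive.zsmul_comp, ← F.map_comp,
      ← F.map_comp, extraDegen_face_succ, Fin.val_succ, pow_succ, mul_neg, mul_one, neg_smul]

theorem t_face (n : ℕ) (i : ℕ) (hi : i < n + 2) :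
    t F (n + 1) i ≫ ((-1 : ℤ) ^ i • F.map (face (⟨i, hi⟩ : Fin (n + 2)))) =
      F.map (face (0 : Fin (n + 2))) ≫ t F n i := by
  induction i with
  | zero => simp [t_zero]
  | succ i ih =>
    have h1 := t_one_face_succ F (⟨i, by omega⟩ : Fin (n + 1))
    simp only [Fin.succ_mk, Fin.castSucc_mk] at h1
    rw [Nat.cast_succ, ← t_comp, ← t_comp, ← Category.assoc, ← ih (by omega), Category.assoc,
      Preadditive.comp_zsmul, h1, pow_succ, mul_neg_one, neg_smul, smul_neg, neg_neg,
      Category.assoc, Preadditive.zsmul_comp]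

/-- All signed faces are obtained from the zeroth one by powers of t on both sides. With this, the
relation between norms and boundaries is a matter of reindexing. -/
theorem sign_face (n : ℕ) (i : ℕ) (hi : i < n + 2) :
    ((-1 : ℤ) ^ i • F.map (face (⟨i, hi⟩ : Fin (n + 2)))) =
      t F (n + 1) (-i) ≫ F.map (face (0 : Fin (n + 2))) ≫ t F n i := by
  rw [← t_face F n i hi, t_comp_assoc, neg_add_cancel, t_zero, Category.id_comp]

/-- A sum over a rectangle, cut along the diagonal and glued again. -/
theorem sum_rectangle {A : Type*} [AddCommMonoid A] (n : ℕ) (f : ℤ → ℤ → A)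
    (hf : ∀ s c, f (s + 1) (c - (n + 1)) = f s c) :
    ∑ i ∈ Finset.range (n + 2), ∑ l ∈ Finset.range (n + 1), f l (i + l) =
      ∑ s ∈ Finset.range (n + 2), ∑ c ∈ Finset.range (n + 1), f s c := by
  rw [← Finset.sum_product', ← Finset.sum_product']
  refine Finset.sum_bij'
    -- The map (i, l) ↦ (l, i + l) leaves the rectangle when i + l > n; the invariance `hf` brings
    -- the point back.
    (fun x _ => if x.1 + x.2 ≤ n then (x.2, x.1 + x.2) else (x.2 + 1, x.1 + x.2 - (n + 1)))
    (fun x _ => if x.1 ≤ x.2 then (x.2 - x.1, x.1) else (x.2 + n + 1 - (x.1 - 1), x.1 - 1))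
    ?_ ?_ ?_ ?_ ?_
  · rintro ⟨i, l⟩ h
    simp only [Finset.mem_product, Finset.mem_range] at h ⊢
    split_ifs <;> constructor <;> simp only <;> omega
  · rintro ⟨i, l⟩ h
    simp only [Finset.mem_product, Finset.mem_range] at h ⊢
    split_ifs <;> constructor <;> simp only <;> omega
  · rintro ⟨i, l⟩ h
    simp only [Finset.mem_product, Finset.mem_range] at h ⊢
    by_cases h1 : i + l ≤ n
    · rw [if_pos h1]
      simp
    · rw [if_neg h1]
      simp only
      rw [if_neg (by omega)]
      ext <;> simp only <;> omega
  · rintro ⟨i, l⟩ h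
    simp only [Finset.mem_product, Finset.mem_range] at h ⊢
    by_cases h1 : i ≤ l
    · rw [if_pos h1]
      simp only
      rw [if_pos (by omega)]
      ext <;> simp only <;> omega
    · rw [if_neg h1]
      simp only
      rw [if_neg (by omega)]
      ext <;> simp only <;> omega
  · rintro ⟨i, l⟩ h
    simp only [Finset.mem_product, Finset.mem_range] at h ⊢
    by_cases h1 : i + l ≤ n
    · rw [if_pos h1]
      simp
    · rw [if_neg h1, ← hf]
      simp only
      congr 1
      push_cast [Nat.cast_sub (show n + 1 ≤ i + l by omega)]
      ring

/-- Both sides are sums of terms t^(s - c) d₀ t^c, indexed by two fundamental domains of the shift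
(s, c) ↦ (s + 1, c - (n + 1)). The shift creates a deck transformation on one side of d₀ and removes
one on the other, and deck transformations are central. The relation tⁿ⁺¹ = 1 is therefore not
needed. -/
theorem norm_b' (n : ℕ) : normOp F (n + 1) ≫ b' F n = b F n ≫ normOp F n := by
  let f : ℤ → ℤ → (F.obj ⟨n + 1⟩ ⟶ F.obj ⟨n⟩) := fun s c =>
    t F (n + 1) (s - c) ≫ F.map (face (0 : Fin (n + 2))) ≫ t F n c
  have hf : ∀ s c, f (s + 1) (c - (n + 1)) = f s c := by
    intro s c
    have e1 : t F (n + 1) (s + 1 - (c - (n + 1))) =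
        t F (n + 1) (s - c) ≫ F.map (deck ⟨n + 1⟩) := by
      rw [← t_self, t_comp]
      congr 1
      push_cast
      ring
    have e2 : t F n c = F.map (deck ⟨n⟩) ≫ t F n (c - (n + 1)) := by
      rw [← t_deck, sub_add_cancel]
    change t F (n + 1) (s + 1 - (c - (n + 1))) ≫ _ ≫ t F n (c - (n + 1)) =
      t F (n + 1) (s - c) ≫ _ ≫ t F n c
    rw [e1, e2, ← Category.assoc (F.map (face 0)), ← deck_comm]
    simp only [Category.assoc]
  have h1 : normOp F (n + 1) ≫ b' F n =
      ∑ s ∈ Finset.range (n + 2), ∑ c ∈ Finset.range (n + 1), f s c := by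
    rw [normOp, Preadditive.sum_comp]
    refine Finset.sum_congr rfl fun s _ => ?_
    rw [b', Preadditive.comp_sum, ← Fin.sum_univ_eq_sum_range (fun c => f s c)]
    refine Finset.sum_congr rfl fun c _ => ?_
    have := sign_face F n c (by omega)
    refine (congrArg (fun x => t F (n + 1) s ≫ x) this).trans ?_
    rw [t_comp_assoc, ← sub_eq_add_neg]
  have h2 : b F n ≫ normOp F n =
      ∑ i ∈ Finset.range (n + 2), ∑ l ∈ Finset.range (n + 1), f l (i + l) := by
    rw [b, Preadditive.sum_comp,
      ← Fin.sum_univ_eq_sum_range (fun i => ∑ l ∈ Finset.range (n + 1), f l (i + l))]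
    refine Finset.sum_congr rfl fun i _ => ?_
    rw [normOp, Preadditive.comp_sum]
    refine Finset.sum_congr rfl fun l _ => ?_
    refine (congrArg (fun x => x ≫ t F n l) (sign_face F n i i.isLt)).trans ?_
    change _ = t F (n + 1) _ ≫ _
    rw [Category.assoc, Category.assoc, t_comp]
    congr 2
    ring
  rw [h1, h2, sum_rectangle n f hf]

/-- The sum telescopes to 1 - tⁿ⁺¹. In the cyclic case it is zero; here it is the whole defect of B.
-/
theorem norm_one_sub_t (n : ℕ) : normOp F n ≫ (𝟙 _ - t F n 1) = 𝟙 _ - F.map (deck ⟨n⟩) := by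
  have h := Finset.sum_range_sub' (fun j : ℕ => t F n j) (n + 1)
  rw [Nat.cast_zero, t_zero, Nat.cast_succ, t_self] at h
  rw [← h, normOp, Preadditive.sum_comp]
  refine Finset.sum_congr rfl fun j _ => ?_
  rw [Preadditive.comp_sub, Category.comp_id, t_comp, Nat.cast_succ]

theorem connesB_b_zero : connesB F 0 ≫ b F 0 = 𝟙 _ - F.map (deck ⟨0⟩) := by
  have h : F.map (extraDegen 0) ≫ b' F 0 = 𝟙 _ := by
    rw [b', Fin.sum_univ_one, ← F.map_id, ← extraDegen_face_zero 0, F.map_comp]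
    simp
  rw [connesB, Category.assoc, Category.assoc, one_sub_t_b, ← Category.assoc (F.map _), h,
    Category.id_comp, norm_one_sub_t]

/-- The classical computation: exchange b and b' across 1 - t and across N, and use that s contracts
b'. The term N (1 - t), which vanishes for cyclic objects, survives. -/
theorem connesB_b (n : ℕ) : connesB F (n + 1) ≫ b F (n + 1) + b F n ≫ connesB F n =
    𝟙 _ - F.map (deck ⟨n + 1⟩) := by
  have : connesB F (n + 1) ≫ b F (n + 1) = normOp F (n + 1) ≫ (𝟙 _ - t F (n + 1) 1) -
          (normOp F (n + 1) ≫ b' F n) ≫ F.map (extraDegen n) ≫ (𝟙 _ - t F (n + 1) 1) := by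
    rw [connesB, Category.assoc, Category.assoc, one_sub_t_b, ← Category.assoc (F.map _),
      extraDegen_b', Preadditive.sub_comp, Preadditive.comp_sub, Category.id_comp]
    simp only [Category.assoc]
  rw [this, norm_b', norm_one_sub_t, connesB, Category.assoc, sub_add_cancel]

variable (G : CyclicCat ⥤ C)

theorem b_toCyclic (n : ℕ) : b (toCyclic ⋙ G) n = CyclicObject.b G n := by
  rw [b, CyclicObject.b]
  refine Finset.sum_congr rfl fun i _ => ?_
  rw [Functor.comp_map, toCyclic_face]
  rfl

theorem t_toCyclic (n j : ℕ) : t (toCyclic ⋙ G) n j = CyclicObject.tPow G n j := by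
  have h1 : t (toCyclic ⋙ G) n 1 = CyclicObject.t G n := by
    rw [t, CyclicObject.t, Functor.comp_map, toCyclic_rot, one_mul, Units.smul_def,
      coe_negOnePow_natCast]
    rfl
  induction j with
  | zero => exact t_zero _ n
  | succ j ih =>
    rw [CyclicObject.tPow, ← ih, ← h1]
    refine Eq.trans ?_ (t_comp (toCyclic ⋙ G) n 1 j).symm
    rw [Nat.cast_succ, add_comm]

/-- Thus the operator of a cyclic object is computed on its restriction to the paracyclic category,
and identities between formal sums of paracyclic morphisms can be realised by it. -/
theorem connesB_toCyclic (n : ℕ) : connesB (toCyclic ⋙ G) n = CyclicObject.connesB G n := by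
  have h : t (toCyclic ⋙ G) (n + 1) 1 = CyclicObject.t G (n + 1) := by
    exact (t_toCyclic G (n + 1) 1).trans (Category.comp_id _)
  rw [connesB, CyclicObject.connesB, h, normOp, CyclicObject.normOp]
  simp only [t_toCyclic, Functor.comp_map, toCyclic_extraDegen]
  rfl

end ParacyclicObject

/-! ### Formal sums of morphisms -/

/-- The category with the objects of `C` whose morphisms are the formal sums of morphisms
of `C`. -/
structure FormalSums (C : Type*) where
  obj : C

namespace FormalSums

variable {C : Type*} [Category* C]

/-- Composition of formal sums. -/
noncomputable def compHom {X Y Z : C} :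
    FreeAbelianGroup (X ⟶ Y) →+ FreeAbelianGroup (Y ⟶ Z) →+ FreeAbelianGroup (X ⟶ Z) :=
  FreeAbelianGroup.lift fun f => FreeAbelianGroup.lift fun g => FreeAbelianGroup.of (f ≫ g)

theorem compHom_of {X Y Z : C} (f : X ⟶ Y) (g : Y ⟶ Z) :
    compHom (FreeAbelianGroup.of f) (FreeAbelianGroup.of g) = FreeAbelianGroup.of (f ≫ g) := by
  simp [compHom]

noncomputable instance : Category (FormalSums C) where
  Hom X Y := FreeAbelianGroup (X.obj ⟶ Y.obj)
  id X := FreeAbelianGroup.of (𝟙 X.obj)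
  comp u v := compHom u v
  id_comp {X Y} u := by
    have : compHom (FreeAbelianGroup.of (𝟙 X.obj)) = AddMonoidHom.id
        (FreeAbelianGroup (X.obj ⟶ Y.obj)) := by
      refine FreeAbelianGroup.lift_ext _ _ fun f => ?_
      simp [compHom_of]
    exact DFunLike.congr_fun this u
  comp_id {X Y} u := by
    have : (compHom (X := X.obj)).flip (FreeAbelianGroup.of (𝟙 Y.obj)) = AddMonoidHom.id
        (FreeAbelianGroup (X.obj ⟶ Y.obj)) := by
      refine FreeAbelianGroup.lift_ext _ _ fun f => ?_
      simp [compHom_of]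
    exact DFunLike.congr_fun this u
  assoc {W X Y Z} u v w := by
    induction u using FreeAbelianGroup.induction_on with
    | zero => simp
    | add u u' hu hu' => simp only [map_add, AddMonoidHom.add_apply, hu, hu']
    | neg f h => simp only [map_neg, AddMonoidHom.neg_apply, h]
    | of f =>
      induction v using FreeAbelianGroup.induction_on with
      | zero => simp
      | add u u' hu hu' => simp only [map_add, AddMonoidHom.add_apply, hu, hu']
      | neg f h => simp only [map_neg, AddMonoidHom.neg_apply, h]
      | of g =>
        induction w using FreeAbelianGroup.induction_on with
        | zero => simp
        | add u u' hu hu' => simp only [map_add, hu, hu']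
        | neg f h => simp only [map_neg, h]
        | of h => simp only [compHom_of, Category.assoc]

noncomputable instance : Preadditive (FormalSums C) where
  homGroup X Y := inferInstanceAs (AddCommGroup (FreeAbelianGroup (X.obj ⟶ Y.obj)))
  add_comp X Y Z u u' v :=
    DFunLike.congr_fun ((compHom (X := X.obj) (Y := Y.obj) (Z := Z.obj)).map_add' u u') v
  comp_add X Y Z u v v' := (compHom (X := X.obj) (Y := Y.obj) (Z := Z.obj) u).map_add' v v'

variable {X Y Z X' Y' Z' : FormalSums C}

/-- A morphism as a formal sum. -/
noncomputable def single (f : X.obj ⟶ Y.obj) : X ⟶ Y := FreeAbelianGroup.of f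

theorem single_comp (f : X.obj ⟶ Y.obj) (g : Y.obj ⟶ Z.obj) :
    (single f : X ⟶ Y) ≫ (single g : Y ⟶ Z) = single (f ≫ g) := compHom_of f g

/-- The additive extension of a map defined on morphisms. -/
noncomputable def extend {A : Type*} [AddCommGroup A] (φ : (X.obj ⟶ Y.obj) → A) :
    (X ⟶ Y) →+ A := FreeAbelianGroup.lift φ

theorem extend_single {A : Type*} [AddCommGroup A] (φ : (X.obj ⟶ Y.obj) → A)
    (f : X.obj ⟶ Y.obj) : extend φ (single f) = φ f := FreeAbelianGroup.lift_apply_of φ f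

theorem induction {p : (X ⟶ Y) → Prop} (zero : p 0)
    (add : ∀ u v, p u → p v → p (u + v)) (neg : ∀ u, p u → p (-u))
    (single : ∀ f : X.obj ⟶ Y.obj, p (single f)) (u) : p u :=
  FreeAbelianGroup.induction_on (motive := p) u zero single (fun _ h => neg _ h) add

theorem addHom_ext {A : Type*} [AddCommGroup A] {u v : (X ⟶ Y) →+ A}
    (h : ∀ f : X.obj ⟶ Y.obj, u (single f) = v (single f)) : u = v :=
  FreeAbelianGroup.lift_ext _ _ h

theorem addHom_congr {A : Type*} [AddCommGroup A] (u v : (X ⟶ Y) →+ A)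
    (h : ∀ f : X.obj ⟶ Y.obj, u (single f) = v (single f)) (x : X ⟶ Y) : u x = v x :=
  DFunLike.congr_fun (addHom_ext h) x

/-- The homomorphism of groups of formal sums which is induced by a map of sets. -/
noncomputable def mapHom (φ : (X.obj ⟶ Y.obj) → (X'.obj ⟶ Y'.obj)) :
    (X ⟶ Y) →+ (X' ⟶ Y') := extend fun f => single (φ f)

theorem mapHom_single (φ : (X.obj ⟶ Y.obj) → (X'.obj ⟶ Y'.obj)) (f : X.obj ⟶ Y.obj) :
    (mapHom φ : (X ⟶ Y) →+ (X' ⟶ Y')) (single f) = single (φ f) := extend_single _ f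

/-- Serves to commute a contraction in one variable with the boundary in the other. -/
theorem mapHom_comp (φ : (X.obj ⟶ Y.obj) → (X'.obj ⟶ Y'.obj))
    (ψ : (X.obj ⟶ Z.obj) → (X'.obj ⟶ Z'.obj))
    (β : Y.obj ⟶ Z.obj) (β' : Y'.obj ⟶ Z'.obj) (h : ∀ f, ψ (f ≫ β) = φ f ≫ β') (u : X ⟶ Y) :
    (mapHom ψ : (X ⟶ Z) →+ (X' ⟶ Z')) (u ≫ single β) =
      (mapHom φ : (X ⟶ Y) →+ (X' ⟶ Y')) u ≫ single β' := by
  refine addHom_congr ((mapHom ψ).comp (Preadditive.rightComp X (single β)))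
    ((Preadditive.rightComp X' (single β')).comp (mapHom φ)) (fun f => ?_) u
  change mapHom ψ (single f ≫ single β) = mapHom φ (single f) ≫ single β'
  rw [single_comp, mapHom_single, mapHom_single, single_comp, h]

variable {D : Type*} [Category* D] [Preadditive D]

/-- The additive extension of a functor to formal sums. -/
noncomputable def lift (F : C ⥤ D) : FormalSums C ⥤ D where
  obj X := F.obj X.obj
  map {X Y} u := extend (X := X) (Y := Y) (fun f => F.map f) u
  map_id X := (extend_single _ _).trans (F.map_id _)
  map_comp {X Y Z} u v := by
    induction u using induction with
    | zero => rw [Limits.zero_comp, map_zero, map_zero, Limits.zero_comp]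
    | add u u' hu hu' => rw [Preadditive.add_comp, map_add, hu, hu', map_add, Preadditive.add_comp]
    | neg u hu => rw [Preadditive.neg_comp, map_neg, hu, map_neg, Preadditive.neg_comp]
    | single f =>
      induction v using induction with
      | zero => rw [Limits.comp_zero, map_zero, map_zero, Limits.comp_zero]
      | add u u' hu hu' =>
        rw [Preadditive.comp_add, map_add, hu, hu', map_add, Preadditive.comp_add]
      | neg u hu => rw [Preadditive.comp_neg, map_neg, hu, map_neg, Preadditive.comp_neg]
      | single g => rw [single_comp, extend_single, extend_single, extend_single, F.map_comp]

instance (F : C ⥤ D) : (lift F).Additive where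
  map_add {X Y u v} := map_add (extend (X := X) (Y := Y) (fun f => F.map f)) u v

theorem lift_map_single (F : C ⥤ D) (f : X.obj ⟶ Y.obj) :
    (lift F).map (single f : X ⟶ Y) = F.map f := extend_single _ f

end FormalSums

/-! ### Contractions on sets of morphisms -/

section

open FormalSums

variable {C : Type*} [Category* C]

/-- The Hochschild boundary of a semisimplicial object, as a formal sum. -/
noncomputable def formalBoundary {F : ℕ → C} (δ : ∀ n, ℕ → (F (n + 1) ⟶ F n)) (n : ℕ) :
    (⟨F (n + 1)⟩ : FormalSums C) ⟶ ⟨F n⟩ :=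
  ∑ i ∈ Finset.range (n + 2), (-1 : ℤ) ^ i • single (δ n i)

/-- A chain of `len` semisimplicial homotopies, which ends at a constant map, on the semisimplicial
set of morphisms from a fixed object to a semisimplicial object. -/
structure HomContraction (X : C) {F : ℕ → C} (δ : ∀ n, ℕ → (F (n + 1) ⟶ F n)) (len : ℕ) where
  φ (c n : ℕ) : (X ⟶ F n) → (X ⟶ F n)
  h (c n i : ℕ) : (X ⟶ F n) → (X ⟶ F (n + 1))
  const (n : ℕ) : (X ⟶ F n) → (X ⟶ F n)
  cone (n : ℕ) : (X ⟶ F n) → (X ⟶ F (n + 1))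
  -- The identities of a simplicial homotopy that involve faces only; it leads from `φ c` at the
  -- last face to `φ (c + 1)` at the zeroth face.
  h_δ_zero (c n : ℕ) (a : X ⟶ F n) : h c n 0 a ≫ δ n 0 = φ (c + 1) n a
  h_δ_last (c n : ℕ) (a : X ⟶ F n) : h c n n a ≫ δ n (n + 1) = φ c n a
  h_δ_of_le (c n i j : ℕ) (hij : i ≤ j) (hj : j ≤ n) (a : X ⟶ F (n + 1)) :
    h c (n + 1) (j + 1) a ≫ δ (n + 1) i = h c n j (a ≫ δ n i)
  h_δ_self (c n j : ℕ) (hj : j < n) (a : X ⟶ F n) :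
    h c n (j + 1) a ≫ δ n (j + 1) = h c n j a ≫ δ n (j + 1)
  h_δ_of_lt (c n i j : ℕ) (hij : j < i) (hi : i ≤ n + 1) (a : X ⟶ F (n + 1)) :
    h c (n + 1) j a ≫ δ (n + 1) (i + 1) = h c n j (a ≫ δ n i)
  -- The constant simplices behave as the chains of a point: all faces agree, and `cone` passes from
  -- one dimension to the next.
  cone_δ (n i : ℕ) (hi : i ≤ n + 1) (a : X ⟶ F n) : cone n a ≫ δ n i = const n a
  cone_comp_δ (n i : ℕ) (hi : i ≤ n + 1) (a : X ⟶ F (n + 1)) :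
    cone n (a ≫ δ n i) = const (n + 1) a
  const_comp_δ (a : X ⟶ F 1) : const 0 (a ≫ δ 0 0) = const 0 (a ≫ δ 0 1)
  φ_len (n : ℕ) (a : X ⟶ F n) : φ len n a = const n a

/-- The prism identity. -/
theorem sum_prism {A : Type*} [AddCommGroup A] (n : ℕ) (x y : ℕ → ℕ → A)
    (h1 : ∀ i j, i ≤ j → j < n → x i (j + 1) = y i j)
    (h2 : ∀ j, j < n → x (j + 1) (j + 1) = x (j + 1) j)
    (h3 : ∀ i j, j < i → i ≤ n → x (i + 1) j = y i j) :
    ∑ j ∈ Finset.range (n + 1), ∑ i ∈ Finset.range (n + 2), (-1 : ℤ) ^ (i + j) • x i j +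
      ∑ j ∈ Finset.range n, ∑ i ∈ Finset.range (n + 1), (-1 : ℤ) ^ (i + j) • y i j =
        x 0 0 - x (n + 1) n := by
  -- The terms next to the diagonal. By `h2` they cancel in pairs, so their contribution is the
  -- telescoping sum of `z j - z (j + 1)`.
  let z : ℕ → A := fun j => if j = n + 1 then x (n + 1) n else x j j
  have hz : ∀ j, j ≤ n → x (j + 1) j = z (j + 1) := by
    intro j hj
    by_cases h : j = n
    · subst h; simp [z]
    · simp only [z]
      rw [if_neg (by omega), h2 j (by omega)]
  have hA : ∀ j ∈ Finset.range (n + 1), ∑ i ∈ Finset.range (n + 2), (-1 : ℤ) ^ (i + j) • x i j =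
      (z j - z (j + 1)) + (∑ i ∈ Finset.range j, (-1 : ℤ) ^ (i + j) • x i j +
        ∑ i ∈ Finset.range (n - j), (-1 : ℤ) ^ (i + j + 2 + j) • x (i + j + 2) j) := by
    intro j hj
    rw [Finset.mem_range] at hj
    rw [show n + 2 = j + (n - j + 1 + 1) by omega, Finset.sum_range_add,
      Finset.sum_range_succ' _ (n - j + 1), Finset.sum_range_succ' _ (n - j)]
    have e1 : z j = x j j := if_neg (by omega)
    have e2 : ∀ i, j + (i + 1 + 1) = i + j + 2 := fun i => by ring
    simp only [e2, zero_add, add_zero]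
    rw [← hz j (by omega), e1, show j + 1 + j = 2 * j + 1 by ring, show j + j = 2 * j by ring,
      pow_succ, pow_mul]
    simp only [even_two, Even.neg_pow, one_pow, one_smul, one_mul, neg_smul]
    abel
  -- The terms of `y` cancel the remaining ones of `x`: those below the diagonal after a shift of
  -- `j` (`h1`), those above it after a shift of `i` (`h3`). Each shift changes the sign.
  have hB : ∀ j ∈ Finset.range n, ∑ i ∈ Finset.range (n + 1), (-1 : ℤ) ^ (i + j) • y i j =
      -(∑ i ∈ Finset.range (j + 1), (-1 : ℤ) ^ (i + (j + 1)) • x i (j + 1)) -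
        ∑ i ∈ Finset.range (n - j), (-1 : ℤ) ^ (i + j + 2 + j) • x (i + j + 2) j := by
    intro j hj
    rw [Finset.mem_range] at hj
    rw [show n + 1 = (j + 1) + (n - j) by omega, Finset.sum_range_add, sub_eq_add_neg,
      ← Finset.sum_neg_distrib, ← Finset.sum_neg_distrib]
    congr 1
    · refine Finset.sum_congr rfl fun i hi => ?_
      rw [Finset.mem_range] at hi
      rw [h1 i j (by omega) hj, ← add_assoc, pow_succ, mul_neg_one, neg_smul, neg_neg]
    · refine Finset.sum_congr rfl fun i hi => ?_
      rw [Finset.mem_range] at hi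
      rw [show i + j + 2 = (j + 1 + i) + 1 by ring, h3 _ j (by omega) (by omega),
        show j + 1 + i + 1 + j = (j + 1 + i + j) + 1 by ring, pow_succ, mul_neg_one, neg_smul,
        neg_neg]
  rw [Finset.sum_congr rfl hA, Finset.sum_congr rfl hB, Finset.sum_add_distrib,
    Finset.sum_range_sub', Finset.sum_sub_distrib, Finset.sum_neg_distrib, Finset.sum_add_distrib,
    Finset.sum_range_succ' (fun j => ∑ i ∈ Finset.range j, (-1 : ℤ) ^ (i + j) • x i j) n,
    Finset.sum_range_succ (fun j => ∑ i ∈ Finset.range (n - j), _) n]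
  simp [z]
  abel

namespace HomContraction

variable {X : C} {F : ℕ → C} {δ : ∀ n, ℕ → (F (n + 1) ⟶ F n)} {len : ℕ}
  (H : HomContraction X δ len)

/-- The prism operator. -/
noncomputable def prism (c n : ℕ) :
    ((⟨X⟩ : FormalSums C) ⟶ ⟨F n⟩) →+ ((⟨X⟩ : FormalSums C) ⟶ ⟨F (n + 1)⟩) :=
  ∑ i ∈ Finset.range (n + 1), (-1 : ℤ) ^ i • mapHom (H.h c n i)

theorem prism_single (c n : ℕ) (a : X ⟶ F n) : H.prism c n (single a) =
    ∑ i ∈ Finset.range (n + 1), (-1 : ℤ) ^ i • single (H.h c n i a) := by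
  rw [prism, AddMonoidHom.finsetSum_apply]
  refine Finset.sum_congr rfl fun i _ => ?_
  rw [AddMonoidHom.smul_apply, mapHom_single]

theorem single_boundary (n : ℕ) (a : X ⟶ F (n + 1)) :
    (single a : (⟨X⟩ : FormalSums C) ⟶ ⟨F (n + 1)⟩) ≫ formalBoundary δ n =
      ∑ i ∈ Finset.range (n + 2), (-1 : ℤ) ^ i • single (a ≫ δ n i) := by
  rw [formalBoundary, Preadditive.comp_sum]
  refine Finset.sum_congr rfl fun i _ => ?_
  rw [Preadditive.comp_zsmul, single_comp]

theorem prism_single_boundary (c n : ℕ) (a : X ⟶ F n) :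
    H.prism c n (single a) ≫ formalBoundary δ n =
      ∑ j ∈ Finset.range (n + 1), ∑ i ∈ Finset.range (n + 2),
        (-1 : ℤ) ^ (i + j) • single (H.h c n j a ≫ δ n i) := by
  rw [prism_single, Preadditive.sum_comp]
  refine Finset.sum_congr rfl fun j _ => ?_
  rw [Preadditive.zsmul_comp, single_boundary, Finset.smul_sum]
  refine Finset.sum_congr rfl fun i _ => ?_
  rw [smul_smul, ← pow_add, add_comm]

theorem prism_boundary_zero (c : ℕ) (u : (⟨X⟩ : FormalSums C) ⟶ ⟨F 0⟩) :
    H.prism c 0 u ≫ formalBoundary δ 0 = mapHom (H.φ (c + 1) 0) u - mapHom (H.φ c 0) u := by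
  refine addHom_congr ((Preadditive.rightComp _ (formalBoundary δ 0)).comp (H.prism c 0))
    (mapHom (H.φ (c + 1) 0) - mapHom (H.φ c 0)) (fun a => ?_) u
  refine (H.prism_single_boundary c 0 a).trans ?_
  have := sum_prism 0 (fun i j => (single (H.h c 0 j a ≫ δ 0 i) : (⟨X⟩ : FormalSums C) ⟶ ⟨F 0⟩))
    (fun _ _ => 0) (by simp) (by simp) (by omega)
  simp only [smul_zero, Finset.sum_const_zero, add_zero] at this
  rw [this, H.h_δ_zero, H.h_δ_last, AddMonoidHom.sub_apply, mapHom_single, mapHom_single]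

theorem prism_boundary (c n : ℕ) (u : (⟨X⟩ : FormalSums C) ⟶ ⟨F (n + 1)⟩) :
    H.prism c (n + 1) u ≫ formalBoundary δ (n + 1) + H.prism c n (u ≫ formalBoundary δ n) =
      mapHom (H.φ (c + 1) (n + 1)) u - mapHom (H.φ c (n + 1)) u := by
  refine addHom_congr
    ((Preadditive.rightComp _ (formalBoundary δ (n + 1))).comp (H.prism c (n + 1)) +
      (H.prism c n).comp (Preadditive.rightComp _ (formalBoundary δ n)))
    (mapHom (H.φ (c + 1) (n + 1)) - mapHom (H.φ c (n + 1))) (fun a => ?_) u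
  have e : H.prism c n (single a ≫ formalBoundary δ n) =
      ∑ j ∈ Finset.range (n + 1), ∑ i ∈ Finset.range (n + 2),
        (-1 : ℤ) ^ (i + j) • single (H.h c n j (a ≫ δ n i)) := by
    rw [single_boundary, map_sum, Finset.sum_comm]
    refine Finset.sum_congr rfl fun i _ => ?_
    rw [map_zsmul, prism_single, Finset.smul_sum]
    refine Finset.sum_congr rfl fun j _ => ?_
    rw [smul_smul, ← pow_add]
  refine (congrArg₂ (· + ·) (H.prism_single_boundary c (n + 1) a) e).trans ?_
  rw [AddMonoidHom.sub_apply, mapHom_single, mapHom_single, ← H.h_δ_zero, ← H.h_δ_last]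
  refine sum_prism (n + 1)
    (fun i j => (single (H.h c (n + 1) j a ≫ δ (n + 1) i) : (⟨X⟩ : FormalSums C) ⟶ ⟨F (n + 1)⟩))
    (fun i j => single (H.h c n j (a ≫ δ n i))) ?_ ?_ ?_
  · intro i j hij hj
    simp only
    rw [H.h_δ_of_le c n i j hij (by omega)]
  · intro j hj
    simp only
    rw [H.h_δ_self c (n + 1) j hj]
  · intro i j hij hi
    simp only
    rw [H.h_δ_of_lt c n i j hij (by omega)]

/-- The contracting homotopy of the last map. -/
noncomputable def coneHom (n : ℕ) :
    ((⟨X⟩ : FormalSums C) ⟶ ⟨F n⟩) →+ ((⟨X⟩ : FormalSums C) ⟶ ⟨F (n + 1)⟩) :=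
  mapHom (H.cone n)

/-- The augmentation, followed by the constant map. -/
noncomputable def aug (n : ℕ) :
    ((⟨X⟩ : FormalSums C) ⟶ ⟨F n⟩) →+ ((⟨X⟩ : FormalSums C) ⟶ ⟨F n⟩) :=
  mapHom (H.const n)

/-- The contracting homotopy. -/
noncomputable def contr (n : ℕ) :
    ((⟨X⟩ : FormalSums C) ⟶ ⟨F n⟩) →+ ((⟨X⟩ : FormalSums C) ⟶ ⟨F (n + 1)⟩) :=
  H.coneHom n - ∑ c ∈ Finset.range len, H.prism c n

theorem coneHom_single_boundary (n : ℕ) (a : X ⟶ F n) :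
    H.coneHom n (single a) ≫ formalBoundary δ n =
      (∑ i ∈ Finset.range (n + 2), (-1 : ℤ) ^ i) • single (H.const n a) := by
  rw [coneHom, mapHom_single, single_boundary, Finset.sum_smul]
  refine Finset.sum_congr rfl fun i hi => ?_
  rw [Finset.mem_range] at hi
  rw [H.cone_δ n i (by omega)]

theorem coneHom_boundary_single (n : ℕ) (a : X ⟶ F (n + 1)) :
    H.coneHom n (single a ≫ formalBoundary δ n) =
      (∑ i ∈ Finset.range (n + 2), (-1 : ℤ) ^ i) • single (H.const (n + 1) a) := by
  rw [coneHom, single_boundary, map_sum, Finset.sum_smul]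
  refine Finset.sum_congr rfl fun i hi => ?_
  rw [Finset.mem_range] at hi
  rw [map_zsmul, mapHom_single, H.cone_comp_δ n i (by omega)]

theorem aug_boundary (u : (⟨X⟩ : FormalSums C) ⟶ ⟨F 1⟩) :
    H.aug 0 (u ≫ formalBoundary δ 0) = 0 := by
  refine addHom_congr ((H.aug 0).comp (Preadditive.rightComp _ (formalBoundary δ 0))) 0
    (fun a => ?_) u
  change H.aug 0 (single a ≫ formalBoundary δ 0) = 0
  rw [single_boundary, map_sum, Finset.sum_range_succ, Finset.sum_range_one, map_zsmul, map_zsmul,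
    aug, mapHom_single, mapHom_single, H.const_comp_δ]
  simp

theorem mapHom_len (n : ℕ) : (mapHom (H.φ len n) :
    ((⟨X⟩ : FormalSums C) ⟶ ⟨F n⟩) →+ ((⟨X⟩ : FormalSums C) ⟶ ⟨F n⟩)) = H.aug n :=
  addHom_ext fun a => by rw [aug, mapHom_single, mapHom_single, H.φ_len]

theorem sum_neg_one_pow (m : ℕ) :
    ∑ i ∈ Finset.range (m + 1), (-1 : ℤ) ^ i + ∑ i ∈ Finset.range m, (-1 : ℤ) ^ i = 1 := by
  induction m with
  | zero => simp
  | succ m ih =>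
    have h1 := Finset.sum_range_succ (fun i => (-1 : ℤ) ^ i) (m + 1)
    have h2 := Finset.sum_range_succ (fun i => (-1 : ℤ) ^ i) m
    rw [pow_succ] at h1
    linarith

/-- The boundary of the cone is the difference of two equal faces, hence zero, so in degree zero the
constant part is not contracted and remains as the augmentation. -/
theorem contr_boundary_zero (u : (⟨X⟩ : FormalSums C) ⟶ ⟨F 0⟩) :
    H.contr 0 u ≫ formalBoundary δ 0 = mapHom (H.φ 0 0) u - H.aug 0 u := by
  have h1 : H.coneHom 0 u ≫ formalBoundary δ 0 = 0 := by
    refine addHom_congr ((Preadditive.rightComp _ (formalBoundary δ 0)).comp (H.coneHom 0)) 0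
      (fun a => ?_) u
    refine (H.coneHom_single_boundary 0 a).trans ?_
    simp [Finset.sum_range_succ]
  rw [contr, AddMonoidHom.sub_apply, AddMonoidHom.finsetSum_apply, Preadditive.sub_comp, h1,
    Preadditive.sum_comp, Finset.sum_congr rfl fun c _ => H.prism_boundary_zero c u,
    Finset.sum_range_sub (fun c => mapHom (H.φ c 0) u), mapHom_len]
  abel

/-- The prisms telescope along the chain of homotopies from `φ 0` to the constant map. The cone
contracts the constant part, because of two consecutive alternating sums of ones exactly one is
equal to 1 and the other vanishes. -/
theorem contr_boundary (n : ℕ) (u : (⟨X⟩ : FormalSums C) ⟶ ⟨F (n + 1)⟩) :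
    H.contr (n + 1) u ≫ formalBoundary δ (n + 1) + H.contr n (u ≫ formalBoundary δ n) =
      mapHom (H.φ 0 (n + 1)) u := by
  have h1 : H.coneHom (n + 1) u ≫ formalBoundary δ (n + 1) +
      H.coneHom n (u ≫ formalBoundary δ n) = H.aug (n + 1) u := by
    refine addHom_congr
      ((Preadditive.rightComp _ (formalBoundary δ (n + 1))).comp (H.coneHom (n + 1)) +
        (H.coneHom n).comp (Preadditive.rightComp _ (formalBoundary δ n))) (H.aug (n + 1))
      (fun a => ?_) u
    refine (congrArg₂ (· + ·) (H.coneHom_single_boundary (n + 1) a)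
      (H.coneHom_boundary_single n a)).trans ?_
    rw [← add_smul, sum_neg_one_pow, one_smul, aug, mapHom_single]
  have h2 : ∀ c ∈ Finset.range len, H.prism c n (u ≫ formalBoundary δ n) =
      (mapHom (H.φ (c + 1) (n + 1)) u - mapHom (H.φ c (n + 1)) u) -
        H.prism c (n + 1) u ≫ formalBoundary δ (n + 1) := fun c _ => by
    rw [← H.prism_boundary c n u]; abel
  rw [contr, contr, AddMonoidHom.sub_apply, AddMonoidHom.finsetSum_apply, AddMonoidHom.sub_apply,
    AddMonoidHom.finsetSum_apply, Preadditive.sub_comp, Finset.sum_congr rfl h2,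
    Finset.sum_sub_distrib, Preadditive.sum_comp,
    Finset.sum_range_sub (fun c => mapHom (H.φ c (n + 1)) u), mapHom_len, ← h1]
  abel

end HomContraction

end

/-! ### Contractions of the paracyclic category -/

namespace Paracyclic

/-- The face maps, numbered by natural numbers. -/
def faceN (n i : ℕ) : (⟨n + 1⟩ : Paracyclic) ⟶ ⟨n⟩ :=
  Lift.ofSeq (fun k => if k < i then (k : ℤ) else k + 1)
    (fun k _ => by split_ifs <;> push_cast <;> omega) (by split_ifs <;> push_cast <;> omega)

theorem faceN_apply (n i k : ℕ) (hk : k ≤ n) :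
    Lift.toFun (faceN n i) k = if k < i then (k : ℤ) else k + 1 := Lift.ofSeq_apply _ _ _ k hk

theorem faceN_val {n : ℕ} (i : Fin (n + 2)) : faceN n i = face i := by
  ext k hk
  rw [faceN_apply n i k hk, face_apply i k hk]

/-- Truncation of an integer to the interval from `c - k` to `k`. -/
def clamp (k c : ℕ) (x : ℤ) : ℤ := min (max x (c - k)) k

theorem clamp_mono (k c : ℕ) {x y : ℤ} (h : x ≤ y) : clamp k c x ≤ clamp k c y := by
  simp only [clamp]; omega

theorem clamp_le_succ (k c : ℕ) {x y : ℤ} (h : x ≤ y) : clamp k c x ≤ clamp k (c + 1) y := by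
  simp only [clamp]; push_cast; omega

theorem clamp_le_add (k c n : ℕ) {x y : ℤ} (h : y ≤ x + (n + 1)) :
    clamp k c y ≤ clamp k c x + (n + 1) := by
  simp only [clamp]; omega

/-- The lower end moves by one and a period is at least one. This is why the interval is shrunk one
unit at a time: a larger step could violate the bound on the last entry of a sequence. -/
theorem clamp_succ_le_add (k c n : ℕ) {x y : ℤ} (h : y ≤ x + (n + 1)) :
    clamp k (c + 1) y ≤ clamp k c x + (n + 1) := by
  simp only [clamp]; push_cast; omega

theorem mono {X Y : Paracyclic} (a : X ⟶ Y) {i j : ℤ} (h : i ≤ j) :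
    Lift.toFun a i ≤ Lift.toFun a j := Lift.monotone' a h

theorem last_le {X : Paracyclic} {n : ℕ} (a : X ⟶ ⟨n⟩) :
    Lift.toFun a n ≤ Lift.toFun a ((0 : ℕ) : ℤ) + (X.len + 1) := Lift.toFun_last_le a

theorem succ_last {X : Paracyclic} {n : ℕ} (a : X ⟶ ⟨n⟩) :
    Lift.toFun a ((n + 1 : ℕ) : ℤ) = Lift.toFun a ((0 : ℕ) : ℤ) + (X.len + 1) := by
  have := Lift.map_add' a ((0 : ℕ) : ℤ)
  simpa using this

/-- Truncation of the values of a lift. -/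
def truncate (X : Paracyclic) (k c n : ℕ) (a : X ⟶ ⟨n⟩) : X ⟶ ⟨n⟩ :=
  Lift.ofSeq (fun j => clamp k c (Lift.toFun a j))
    (fun _ _ => clamp_mono k c (mono a (by push_cast; omega))) (clamp_le_add k c _ (last_le a))

theorem truncate_apply {X : Paracyclic} (k c n : ℕ) (a : X ⟶ ⟨n⟩) (j : ℕ) (hj : j ≤ n) :
    Lift.toFun (truncate X k c n a) j = clamp k c (Lift.toFun a j) := Lift.ofSeq_apply _ _ _ j hj

/-- The simplices of the homotopy from one truncation to the next. -/
def truncateHomotopy (X : Paracyclic) (k c n i : ℕ) (a : X ⟶ ⟨n⟩) : X ⟶ ⟨n + 1⟩ :=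
  -- For i ≤ n, the entries a_0, …, a_i truncated at level `c`, followed by a_i, …, a_n truncated at
  -- level `c + 1`; the entry a_i occurs twice.
  Lift.ofSeq (fun j => if j ≤ i then clamp k c (Lift.toFun a j) else
      clamp k (c + 1) (Lift.toFun a (j - 1)))
    (fun j _ => by
      split_ifs
      · exact clamp_mono k c (mono a (by push_cast; omega))
      · exact clamp_le_succ k c (mono a (by push_cast; omega))
      · omega
      · exact clamp_mono k (c + 1) (mono a (by push_cast; omega)))
    (by
      simp only [Nat.zero_le, if_true]
      split_ifs
      -- The case `i ≥ n + 1` does not occur in the prism, but it must still define a lift: the last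
      -- entry is then the truncation of a_0 plus one period.
      · exact clamp_le_add k c _ (succ_last a).le
      · refine clamp_succ_le_add k c _ ((mono a ?_).trans (last_le a))
        push_cast; omega)

theorem truncateHomotopy_apply {X : Paracyclic} (k c n i : ℕ) (a : X ⟶ ⟨n⟩) (j : ℕ)
    (hj : j ≤ n + 1) : Lift.toFun (truncateHomotopy X k c n i a) j =
      if j ≤ i then clamp k c (Lift.toFun a j) else clamp k (c + 1) (Lift.toFun a (j - 1)) :=
  Lift.ofSeq_apply _ _ _ j hj

/-- The constant lift with value `k` on `0, …, n`. -/
def constLift (X : Paracyclic) (k n : ℕ) : X ⟶ ⟨n⟩ :=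
  Lift.ofSeq (fun _ => (k : ℤ)) (fun _ _ => le_rfl) (by omega)

theorem constLift_apply {X : Paracyclic} (k n j : ℕ) (hj : j ≤ n) :
    Lift.toFun (constLift X k n) j = k := Lift.ofSeq_apply _ _ _ j hj

theorem comp_faceN_apply {X : Paracyclic} {n : ℕ} (a : X ⟶ ⟨n + 1⟩) (i j : ℕ) (hj : j ≤ n) :
    Lift.toFun (a ≫ faceN n i) j = Lift.toFun a ((if j < i then j else j + 1 : ℕ) : ℤ) := by
  rw [comp_toFun, faceN_apply n i j hj]
  split_ifs <;> push_cast <;> rfl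

/-- The contraction of the semisimplicial set of morphisms from a paracyclic object to its value
at `k`, along truncations of `[-k, k]`. -/
def contraction (X : Paracyclic) (k : ℕ) :
    HomContraction X (F := fun n => (⟨n⟩ : Paracyclic)) faceN (2 * k) where
  φ c n := truncate X k c n
  h c n i := truncateHomotopy X k c n i
  const n _ := constLift X k n
  cone n _ := constLift X k (n + 1)
  h_δ_zero c n a := by
    ext j hj
    simp only at hj
    rw [comp_faceN_apply _ _ _ hj, truncate_apply _ _ _ _ _ hj,
      truncateHomotopy_apply _ _ _ _ _ _ (by split_ifs <;> omega)]
    simp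
  h_δ_last c n a := by
    ext j hj
    simp only at hj
    rw [comp_faceN_apply _ _ _ hj, truncate_apply _ _ _ _ _ hj,
      truncateHomotopy_apply _ _ _ _ _ _ (by split_ifs <;> omega), if_pos (show j < n + 1 by omega),
      if_pos hj]
  h_δ_of_le c n i j hij hj a := by
    ext l hl
    simp only at hl
    rw [comp_faceN_apply _ _ _ hl, truncateHomotopy_apply _ _ _ _ _ _ (by split_ifs <;> omega),
      truncateHomotopy_apply _ _ _ _ _ _ hl]
    by_cases h1 : l ≤ j
    · rw [if_pos (by split_ifs <;> omega), if_pos h1, comp_faceN_apply _ _ _ (by omega)]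
    · rw [if_neg (by split_ifs <;> omega), if_neg h1, if_neg (by omega),
        show ((l + 1 : ℕ) : ℤ) - 1 = l by push_cast; ring,
        show (l : ℤ) - 1 = ((l - 1 : ℕ) : ℤ) by omega, comp_faceN_apply _ _ _ (by omega)]
      congr 2
      rw [if_neg (by omega)]
      omega
  h_δ_self c n j hj a := by
    ext l hl
    simp only at hl
    rw [comp_faceN_apply _ _ _ hl, comp_faceN_apply _ _ _ hl,
      truncateHomotopy_apply _ _ _ _ _ _ (by split_ifs <;> omega),
      truncateHomotopy_apply _ _ _ _ _ _ (by split_ifs <;> omega)]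
    by_cases h1 : l ≤ j
    · rw [if_pos (show l < j + 1 by omega), if_pos (by omega), if_pos h1]
    · rw [if_neg (show ¬ l < j + 1 by omega), if_neg (by omega), if_neg (by omega)]
  h_δ_of_lt c n i j hij hi a := by
    ext l hl
    simp only at hl
    rw [comp_faceN_apply _ _ _ hl, truncateHomotopy_apply _ _ _ _ _ _ (by split_ifs <;> omega),
      truncateHomotopy_apply _ _ _ _ _ _ hl]
    by_cases h1 : l ≤ j
    · rw [if_pos h1, if_pos (show l < i + 1 by omega), if_pos h1,
        comp_faceN_apply _ _ _ (by omega), if_pos (by omega)]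
    · rw [if_neg h1, if_neg (by split_ifs <;> omega),
        show (l : ℤ) - 1 = ((l - 1 : ℕ) : ℤ) by omega, comp_faceN_apply _ _ _ (by omega)]
      congr 2
      split_ifs <;> omega
  cone_δ n i hi a := by
    ext l hl
    simp only at hl
    rw [comp_faceN_apply _ _ _ hl, constLift_apply _ _ _ hl,
      constLift_apply _ _ _ (by split_ifs <;> omega)]
  cone_comp_δ n i hi a := rfl
  const_comp_δ a := rfl
  -- After 2k steps the interval from c - k to k is reduced to the point k.
  φ_len n a := by
    ext l hl
    simp only at hl
    rw [truncate_apply _ _ _ _ _ hl, constLift_apply _ _ _ hl]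
    simp only [clamp]
    push_cast
    omega

/-- The entries lie between the first and the last one, so a `k` that bounds both absolute values is
enough. -/
theorem exists_truncate_eq {X : Paracyclic} {n : ℕ} (a : X ⟶ ⟨n⟩) :
    ∃ k₀ : ℕ, ∀ k, k₀ ≤ k → truncate X k 0 n a = a := by
  refine ⟨(Lift.toFun a 0).natAbs + (Lift.toFun a n).natAbs, fun k hk => ?_⟩
  ext j hj
  simp only at hj
  rw [truncate_apply _ _ _ _ _ hj]
  have h1 := mono a (i := 0) (j := j) (by omega)
  have h2 := mono a (i := j) (j := n) (by omega)
  simp only [clamp]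
  push_cast
  omega

end Paracyclic

/-! ### Contractions in products of categories -/

namespace HomContraction

variable {C C' : Type*} [Category* C] [Category* C'] {X : C} {X' : C'} {F : ℕ → C} {F' : ℕ → C'}
  {δ : ∀ n, ℕ → (F (n + 1) ⟶ F n)} {δ' : ∀ n, ℕ → (F' (n + 1) ⟶ F' n)} {len : ℕ}
  (H : HomContraction X δ len) (H' : HomContraction X' δ' len)

open CategoryTheory.Prod

/-- The product of two contractions. -/
def prod : HomContraction (X, X') (F := fun n => (F n, F' n)) (fun n i => δ n i ×ₘ δ' n i) len where
  φ c n a := H.φ c n a.1 ×ₘ H'.φ c n a.2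
  h c n i a := H.h c n i a.1 ×ₘ H'.h c n i a.2
  const n a := H.const n a.1 ×ₘ H'.const n a.2
  cone n a := H.cone n a.1 ×ₘ H'.cone n a.2
  h_δ_zero c n a := Prod.hom_ext (H.h_δ_zero c n _) (H'.h_δ_zero c n _)
  h_δ_last c n a := Prod.hom_ext (H.h_δ_last c n _) (H'.h_δ_last c n _)
  h_δ_of_le c n i j hij hj a :=
    Prod.hom_ext (H.h_δ_of_le c n i j hij hj _) (H'.h_δ_of_le c n i j hij hj _)
  h_δ_self c n j hj a := Prod.hom_ext (H.h_δ_self c n j hj _) (H'.h_δ_self c n j hj _)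
  h_δ_of_lt c n i j hij hi a :=
    Prod.hom_ext (H.h_δ_of_lt c n i j hij hi _) (H'.h_δ_of_lt c n i j hij hi _)
  cone_δ n i hi a := Prod.hom_ext (H.cone_δ n i hi _) (H'.cone_δ n i hi _)
  cone_comp_δ n i hi a := Prod.hom_ext (H.cone_comp_δ n i hi _) (H'.cone_comp_δ n i hi _)
  const_comp_δ a := Prod.hom_ext (H.const_comp_δ _) (H'.const_comp_δ _)
  φ_len n a := Prod.hom_ext (H.φ_len n _) (H'.φ_len n _)

/-- The contraction of the semisimplicial set of morphisms to the first variable. -/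
def left (X' Y' : C') : HomContraction (X, X') (F := fun n => (F n, Y'))
    (fun n i => δ n i ×ₘ 𝟙 Y') len where
  φ c n a := H.φ c n a.1 ×ₘ a.2
  h c n i a := H.h c n i a.1 ×ₘ a.2
  const n a := H.const n a.1 ×ₘ a.2
  cone n a := H.cone n a.1 ×ₘ a.2
  h_δ_zero c n a := Prod.hom_ext (H.h_δ_zero c n _) (Category.comp_id _)
  h_δ_last c n a := Prod.hom_ext (H.h_δ_last c n _) (Category.comp_id _)
  h_δ_of_le c n i j hij hj a := Prod.hom_ext (H.h_δ_of_le c n i j hij hj _) rfl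
  h_δ_self c n j hj a := Prod.hom_ext (H.h_δ_self c n j hj _) rfl
  h_δ_of_lt c n i j hij hi a := Prod.hom_ext (H.h_δ_of_lt c n i j hij hi _) rfl
  cone_δ n i hi a := Prod.hom_ext (H.cone_δ n i hi _) (Category.comp_id _)
  cone_comp_δ n i hi a := Prod.hom_ext (H.cone_comp_δ n i hi _) (Category.comp_id _)
  const_comp_δ a := Prod.hom_ext (H.const_comp_δ _) rfl
  φ_len n a := Prod.hom_ext (H.φ_len n _) rfl

/-- The contraction of the semisimplicial set of morphisms to the second variable. -/
def right (X Y : C) : HomContraction (X, X') (F := fun n => (Y, F' n))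
    (fun n i => 𝟙 Y ×ₘ δ' n i) len where
  φ c n a := a.1 ×ₘ H'.φ c n a.2
  h c n i a := a.1 ×ₘ H'.h c n i a.2
  const n a := a.1 ×ₘ H'.const n a.2
  cone n a := a.1 ×ₘ H'.cone n a.2
  h_δ_zero c n a := Prod.hom_ext (Category.comp_id _) (H'.h_δ_zero c n _)
  h_δ_last c n a := Prod.hom_ext (Category.comp_id _) (H'.h_δ_last c n _)
  h_δ_of_le c n i j hij hj a := Prod.hom_ext rfl (H'.h_δ_of_le c n i j hij hj _)
  h_δ_self c n j hj a := Prod.hom_ext rfl (H'.h_δ_self c n j hj _)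
  h_δ_of_lt c n i j hij hi a := Prod.hom_ext rfl (H'.h_δ_of_lt c n i j hij hi _)
  cone_δ n i hi a := Prod.hom_ext (Category.comp_id _) (H'.cone_δ n i hi _)
  cone_comp_δ n i hi a := Prod.hom_ext (Category.comp_id _) (H'.cone_comp_δ n i hi _)
  const_comp_δ a := Prod.hom_ext rfl (H'.const_comp_δ _)
  φ_len n a := Prod.hom_ext rfl (H'.φ_len n _)

end HomContraction

/-- A formal sum has finitely many terms, so a common bound exists. -/
theorem FormalSums.exists_mapHom_eq {C : Type*} [Category* C] {X Y : FormalSums C}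
    (φ : ℕ → (X.obj ⟶ Y.obj) → (X.obj ⟶ Y.obj))
    (h : ∀ f, ∃ k₀ : ℕ, ∀ k, k₀ ≤ k → φ k f = f) (u : X ⟶ Y) :
    ∃ k₀ : ℕ, ∀ k, k₀ ≤ k → mapHom (φ k) u = u := by
  induction u using FormalSums.induction with
  | zero => exact ⟨0, fun k _ => map_zero _⟩
  | add u v hu hv =>
    obtain ⟨k, hk⟩ := hu
    obtain ⟨l, hl⟩ := hv
    exact ⟨max k l, fun m hm => by
      rw [map_add, hk m ((le_max_left _ _).trans hm), hl m ((le_max_right _ _).trans hm)]⟩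
  | neg u hu =>
    obtain ⟨k, hk⟩ := hu
    exact ⟨k, fun m hm => by rw [map_neg, hk m hm]⟩
  | single f =>
    obtain ⟨k, hk⟩ := h f
    exact ⟨k, fun m hm => by rw [mapHom_single, hk m hm]⟩

/-! ### Boundaries of semisimplicial objects -/

section

open FormalSums CategoryTheory.Prod

/-- The usual cancellation, as a sign-reversing involution: the pair (a, i) with i < a is matched
with (i, a - 1). -/
theorem formalBoundary_comp {C : Type*} [Category* C] {F : ℕ → C}
    (δ : ∀ n, ℕ → (F (n + 1) ⟶ F n))
    (h : ∀ n i j, i ≤ j → j ≤ n + 1 → δ (n + 1) (j + 1) ≫ δ n i = δ (n + 1) i ≫ δ n j) (n : ℕ) :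
    formalBoundary δ (n + 1) ≫ formalBoundary δ n = 0 := by
  have e : formalBoundary δ (n + 1) ≫ formalBoundary δ n =
      ∑ x ∈ Finset.range (n + 3) ×ˢ Finset.range (n + 2), (-1 : ℤ) ^ (x.1 + x.2) •
        (single (δ (n + 1) x.1 ≫ δ n x.2) : (⟨F (n + 2)⟩ : FormalSums C) ⟶ ⟨F n⟩) := by
    rw [formalBoundary, formalBoundary, Preadditive.sum_comp, Finset.sum_product]
    refine Finset.sum_congr rfl fun i _ => ?_
    rw [Preadditive.comp_sum]
    refine Finset.sum_congr rfl fun j _ => ?_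
    rw [Preadditive.zsmul_comp, Preadditive.comp_zsmul, single_comp, smul_smul, ← pow_add]
  rw [e]
  refine Finset.sum_involution
    (fun x _ => if x.2 < x.1 then (x.2, x.1 - 1) else (x.2 + 1, x.1)) ?_ ?_ ?_ ?_
  · rintro ⟨a, i⟩ hx
    simp only [Finset.mem_product, Finset.mem_range] at hx ⊢
    split_ifs with hai
    · obtain ⟨a, rfl⟩ : ∃ b, a = b + 1 := ⟨a - 1, by omega⟩
      simp only [Nat.add_sub_cancel]
      rw [h n i a (by omega) (by omega), show a + 1 + i = i + a + 1 by ring, pow_succ, mul_neg_one,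
        neg_smul, neg_add_cancel]
    · simp only
      rw [h n a i (by omega) (by omega), show i + 1 + a = a + i + 1 by ring, pow_succ, mul_neg_one,
        neg_smul, add_neg_cancel]
  · rintro ⟨a, i⟩ hx _
    simp only
    split_ifs with hai <;> simp only [ne_eq, Prod.mk.injEq] <;> omega
  · rintro ⟨a, i⟩ hx
    simp only [Finset.mem_product, Finset.mem_range] at hx ⊢
    split_ifs with hai <;> simp only <;> omega
  · rintro ⟨a, i⟩ hx
    simp only
    by_cases hai : i < a
    · simp only [if_pos hai]
      rw [if_neg (by omega)]
      ext <;> simp only <;> omega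
    · simp only [if_neg hai]
      rw [if_pos (by omega)]
      ext <;> simp only <;> omega

namespace Paracyclic

theorem faceN_comp_faceN (n i j : ℕ) (hij : i ≤ j) :
    faceN (n + 1) (j + 1) ≫ faceN n i = faceN (n + 1) i ≫ faceN n j := by
  ext k hk
  simp only at hk
  rw [comp_faceN_apply _ _ _ hk, comp_faceN_apply _ _ _ hk,
    faceN_apply _ _ _ (by split_ifs <;> omega), faceN_apply _ _ _ (by split_ifs <;> omega)]
  split_ifs <;> push_cast <;> omega

/-- The objects of the category of formal sums of pairs of paracyclic morphisms. -/
abbrev bi (p q : ℕ) : FormalSums (Paracyclic × Paracyclic) := ⟨(⟨p⟩, ⟨q⟩)⟩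

/-- The first partial boundary. -/
noncomputable def boundary₁ (p q : ℕ) : bi (p + 1) q ⟶ bi p q :=
  formalBoundary (F := fun n => ((⟨n⟩, ⟨q⟩) : Paracyclic × Paracyclic))
    (fun n i => faceN n i ×ₘ 𝟙 _) p

/-- The second partial boundary. -/
noncomputable def boundary₂ (p q : ℕ) : bi p (q + 1) ⟶ bi p q :=
  formalBoundary (F := fun n => ((⟨p⟩, ⟨n⟩) : Paracyclic × Paracyclic))
    (fun n i => 𝟙 _ ×ₘ faceN n i) q

/-- The boundary of the diagonal. -/
noncomputable def diagBoundary (n : ℕ) : bi (n + 1) (n + 1) ⟶ bi n n :=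
  formalBoundary (F := fun n => ((⟨n⟩, ⟨n⟩) : Paracyclic × Paracyclic))
    (fun n i => faceN n i ×ₘ faceN n i) n

theorem diagBoundary_comp (n : ℕ) : diagBoundary (n + 1) ≫ diagBoundary n = 0 :=
  formalBoundary_comp _ (fun n i j hij _ =>
    Prod.hom_ext (faceN_comp_faceN n i j hij) (faceN_comp_faceN n i j hij)) n

theorem boundary₁_comp (p q : ℕ) : boundary₁ (p + 1) q ≫ boundary₁ p q = 0 :=
  formalBoundary_comp _ (fun n i j hij _ => by
    rw [prod_comp, prod_comp]
    exact Prod.hom_ext (faceN_comp_faceN n i j hij) rfl) p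

theorem boundary₂_comp (p q : ℕ) : boundary₂ p (q + 1) ≫ boundary₂ p q = 0 :=
  formalBoundary_comp _ (fun n i j hij _ => by
    rw [prod_comp, prod_comp]
    exact Prod.hom_ext rfl (faceN_comp_faceN n i j hij)) q

theorem boundary₁_boundary₂ (p q : ℕ) :
    boundary₁ p (q + 1) ≫ boundary₂ p q = boundary₂ (p + 1) q ≫ boundary₁ p q := by
  simp only [boundary₁, boundary₂, formalBoundary, Preadditive.sum_comp, Preadditive.comp_sum,
    Preadditive.zsmul_comp, Preadditive.comp_zsmul, Finset.smul_sum]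
  rw [Finset.sum_comm]
  refine Finset.sum_congr rfl fun i _ => Finset.sum_congr rfl fun j _ => ?_
  rw [smul_comm, single_comp, single_comp]
  congr 3

/-! ### Exactness -/

section

variable {X : FormalSums (Paracyclic × Paracyclic)} (k : ℕ)

/-- The contraction of the first variable. -/
noncomputable def contr₁ (p q : ℕ) : (X ⟶ bi p q) →+ (X ⟶ bi (p + 1) q) :=
  ((contraction X.obj.1 k).left X.obj.2 ⟨q⟩).contr p

/-- The contraction of the second variable. -/
noncomputable def contr₂ (p q : ℕ) : (X ⟶ bi p q) →+ (X ⟶ bi p (q + 1)) :=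
  ((contraction X.obj.2 k).right X.obj.1 ⟨p⟩).contr q

/-- The augmentation of the first variable. -/
noncomputable def aug₁ (q : ℕ) : (X ⟶ bi 0 q) →+ (X ⟶ bi 0 q) :=
  ((contraction X.obj.1 k).left X.obj.2 ⟨q⟩).aug 0

/-- The truncation of the first variable. -/
noncomputable def truncate₁ (p q : ℕ) : (X ⟶ bi p q) →+ (X ⟶ bi p q) :=
  mapHom (((contraction X.obj.1 k).left X.obj.2 ⟨q⟩).φ 0 p)

/-- The truncation of the second variable. -/
noncomputable def truncate₂ (p q : ℕ) : (X ⟶ bi p q) →+ (X ⟶ bi p q) :=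
  mapHom (((contraction X.obj.2 k).right X.obj.1 ⟨p⟩).φ 0 q)

theorem contr₁_boundary₁_zero (q : ℕ) (v : X ⟶ bi 0 q) :
    contr₁ k 0 q v ≫ boundary₁ 0 q = truncate₁ k 0 q v - aug₁ k q v :=
  ((contraction X.obj.1 k).left X.obj.2 ⟨q⟩).contr_boundary_zero v

theorem contr₁_boundary₁ (p q : ℕ) (v : X ⟶ bi (p + 1) q) :
    contr₁ k (p + 1) q v ≫ boundary₁ (p + 1) q + contr₁ k p q (v ≫ boundary₁ p q) =
      truncate₁ k (p + 1) q v :=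
  ((contraction X.obj.1 k).left X.obj.2 ⟨q⟩).contr_boundary p v

theorem contr₂_boundary₂ (p q : ℕ) (v : X ⟶ bi p (q + 1)) :
    contr₂ k p (q + 1) v ≫ boundary₂ p (q + 1) + contr₂ k p q (v ≫ boundary₂ p q) =
      truncate₂ k p (q + 1) v :=
  ((contraction X.obj.2 k).right X.obj.1 ⟨p⟩).contr_boundary q v

theorem aug₁_boundary₁ (q : ℕ) (v : X ⟶ bi 1 q) : aug₁ k q (v ≫ boundary₁ 0 q) = 0 :=
  ((contraction X.obj.1 k).left X.obj.2 ⟨q⟩).aug_boundary v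

/-- The operators of the first contraction leave the second component as it is, so they commute with
every morphism in the second variable. -/
theorem contr₁_single_comp (p : ℕ) {q q' : ℕ} (β : (⟨q⟩ : Paracyclic) ⟶ ⟨q'⟩) (v : X ⟶ bi p q) :
    contr₁ k p q' (v ≫ (single (𝟙 _ ×ₘ β) : bi p q ⟶ bi p q')) =
      contr₁ k p q v ≫ (single (𝟙 _ ×ₘ β) : bi (p + 1) q ⟶ bi (p + 1) q') := by
  simp only [contr₁, HomContraction.contr, HomContraction.coneHom, HomContraction.prism,
    AddMonoidHom.sub_apply, AddMonoidHom.finsetSum_apply, AddMonoidHom.smul_apply,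
    Preadditive.sub_comp, Preadditive.sum_comp, Preadditive.zsmul_comp]
  congr 1
  · exact mapHom_comp _ _ _ _ (fun f => rfl) v
  · refine Finset.sum_congr rfl fun c _ => Finset.sum_congr rfl fun i _ => ?_
    congr 1
    exact mapHom_comp _ _ _ _ (fun f => rfl) v

theorem contr₂_single_comp (q : ℕ) {p p' : ℕ} (β : (⟨p⟩ : Paracyclic) ⟶ ⟨p'⟩) (v : X ⟶ bi p q) :
    contr₂ k p' q (v ≫ (single (β ×ₘ 𝟙 _) : bi p q ⟶ bi p' q)) =
      contr₂ k p q v ≫ (single (β ×ₘ 𝟙 _) : bi p (q + 1) ⟶ bi p' (q + 1)) := by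
  simp only [contr₂, HomContraction.contr, HomContraction.coneHom, HomContraction.prism,
    AddMonoidHom.sub_apply, AddMonoidHom.finsetSum_apply, AddMonoidHom.smul_apply,
    Preadditive.sub_comp, Preadditive.sum_comp, Preadditive.zsmul_comp]
  congr 1
  · exact mapHom_comp _ _ _ _ (fun f => rfl) v
  · refine Finset.sum_congr rfl fun c _ => Finset.sum_congr rfl fun i _ => ?_
    congr 1
    exact mapHom_comp _ _ _ _ (fun f => rfl) v

theorem contr₁_boundary₂ (p q : ℕ) (v : X ⟶ bi p (q + 1)) :
    contr₁ k p q (v ≫ boundary₂ p q) = contr₁ k p (q + 1) v ≫ boundary₂ (p + 1) q := by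
  simp only [boundary₂, formalBoundary, Preadditive.comp_sum, Preadditive.comp_zsmul, map_sum,
    map_zsmul]
  exact Finset.sum_congr rfl fun i _ => congrArg _ (contr₁_single_comp k p _ v)

theorem contr₂_boundary₁ (p q : ℕ) (v : X ⟶ bi (p + 1) q) :
    contr₂ k p q (v ≫ boundary₁ p q) = contr₂ k (p + 1) q v ≫ boundary₁ p (q + 1) := by
  simp only [boundary₁, formalBoundary, Preadditive.comp_sum, Preadditive.comp_zsmul, map_sum,
    map_zsmul]
  exact Finset.sum_congr rfl fun i _ => congrArg _ (contr₂_single_comp k q _ v)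

theorem aug₁_boundary₂ (q : ℕ) (v : X ⟶ bi 0 (q + 1)) :
    aug₁ k q (v ≫ boundary₂ 0 q) = aug₁ k (q + 1) v ≫ boundary₂ 0 q := by
  simp only [boundary₂, formalBoundary, Preadditive.comp_sum, Preadditive.comp_zsmul, map_sum,
    map_zsmul]
  exact Finset.sum_congr rfl fun i _ => congrArg _ (mapHom_comp _ _ _ _ (fun f => rfl) v)

theorem exists_truncate₁ (p q : ℕ) (v : X ⟶ bi p q) :
    ∃ k₀ : ℕ, ∀ k, k₀ ≤ k → truncate₁ k p q v = v :=
  exists_mapHom_eq (Y := bi p q) (fun k => ((contraction X.obj.1 k).left X.obj.2 ⟨q⟩).φ 0 p)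
    (fun f => (exists_truncate_eq f.1).imp fun _ h k hk => Prod.hom_ext (h k hk) rfl) v

theorem exists_truncate₂ (p q : ℕ) (v : X ⟶ bi p q) :
    ∃ k₀ : ℕ, ∀ k, k₀ ≤ k → truncate₂ k p q v = v :=
  exists_mapHom_eq (Y := bi p q) (fun k => ((contraction X.obj.2 k).right X.obj.1 ⟨p⟩).φ 0 q)
    (fun f => (exists_truncate_eq f.2).imp fun _ h k hk => Prod.hom_ext rfl (h k hk)) v

/-- The contraction depends on `k`, and `k` on the cycle. No contraction of the whole complex
results, but each single cycle bounds, and this suffices for the inductive constructions of maps. -/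
theorem diag_exact (n : ℕ) (v : X ⟶ bi (n + 1) (n + 1)) (hv : v ≫ diagBoundary n = 0) :
    ∃ s : X ⟶ bi (n + 2) (n + 2), s ≫ diagBoundary (n + 1) = v := by
  obtain ⟨k, hk⟩ := exists_mapHom_eq (Y := bi (n + 1) (n + 1))
    (fun k => ((contraction X.obj.1 k).prod (contraction X.obj.2 k)).φ 0 (n + 1))
    (fun f => by
      obtain ⟨k, h⟩ := exists_truncate_eq f.1
      obtain ⟨l, h'⟩ := exists_truncate_eq f.2
      exact ⟨max k l, fun m hm => Prod.hom_ext (h m ((le_max_left _ _).trans hm))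
        (h' m ((le_max_right _ _).trans hm))⟩) v
  refine ⟨((contraction X.obj.1 k).prod (contraction X.obj.2 k)).contr (n + 1) v, ?_⟩
  have := ((contraction X.obj.1 k).prod (contraction X.obj.2 k)).contr_boundary n v
  rw [hk k le_rfl] at this
  refine ((add_zero _).symm.trans (congrArg _ ?_)).trans this
  exact ((congrArg _ hv).trans (map_zero _)).symm

/-- Contracting the rows in the first variable deals with the columns p > 0. In the column p = 0 it
leaves the augmentation, which turns a first boundary into zero; there the contraction of the second
variable finishes. -/
theorem total_exact (n : ℕ) (v : ∀ p q, X ⟶ bi p q)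
    (hv : ∀ p q, p + q = n → v (p + 1) q ≫ boundary₁ p q +
      (-1 : ℤ) ^ p • (v p (q + 1) ≫ boundary₂ p q) = 0) :
    ∃ s : ∀ p q, X ⟶ bi p q, ∀ p q, p + q = n + 1 → s (p + 1) q ≫ boundary₁ p q +
      (-1 : ℤ) ^ p • (s p (q + 1) ≫ boundary₂ p q) = v p q := by
  choose k₁ hk₁ using fun p q => exists_truncate₁ p q (v p q)
  choose k₂ hk₂ using fun p q => exists_truncate₂ p q (v p q)
  -- The cycle has finitely many components, so one truncation fixes all of them in both variables.
  obtain ⟨k, hk⟩ : ∃ k, ∀ p q, p + q = n + 1 → k₁ p q ≤ k ∧ k₂ p q ≤ k := by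
    refine ⟨∑ x ∈ Finset.HasAntidiagonal.antidiagonal (n + 1), (k₁ x.1 x.2 + k₂ x.1 x.2),
      fun p q hpq => ?_⟩
    have := Finset.single_le_sum
      (f := fun x : ℕ × ℕ => k₁ x.1 x.2 + k₂ x.1 x.2) (fun _ _ => Nat.zero_le _)
      (Finset.HasAntidiagonal.mem_antidiagonal.2 hpq : (p, q) ∈ _)
    simp only at this
    omega
  -- Only the components of total degree n + 2 matter; the value at (0, 0) is a default.
  let s : ∀ p q, X ⟶ bi p q := fun p q => match p, q with
    | 0, 0 => 0
    | 0, q + 1 => aug₁ k (q + 1) (contr₂ k 0 q (v 0 q))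
    | p + 1, q => contr₁ k p q (v p q)
  refine ⟨s, fun p q hpq => ?_⟩
  obtain _ | p := p
  · obtain rfl : q = n + 1 := by omega
    change contr₁ k 0 (n + 1) _ ≫ _ +
      (-1 : ℤ) ^ 0 • (aug₁ k (n + 2) (contr₂ k 0 (n + 1) _) ≫ _) = _
    have h1 := hv 0 n (by omega)
    rw [pow_zero, one_smul] at h1 ⊢
    -- The cycle condition replaces the second boundary of `v 0 (n + 1)` by minus the first boundary
    -- of `v 1 n`, and the augmentation kills first boundaries.
    have h2 := contr₂_boundary₂ k 0 n (v 0 (n + 1))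
    rw [eq_neg_of_add_eq_zero_right h1, map_neg, contr₂_boundary₁, ← sub_eq_add_neg,
      sub_eq_iff_eq_add, hk₂ 0 (n + 1) k (hk _ _ (by omega)).2] at h2
    rw [contr₁_boundary₁_zero, ← aug₁_boundary₂, h2, map_add, aug₁_boundary₁, add_zero,
      hk₁ 0 (n + 1) k (hk _ _ (by omega)).1, sub_add_cancel]
  · change contr₁ k (p + 1) q _ ≫ _ + (-1 : ℤ) ^ (p + 1) • (contr₁ k p (q + 1) _ ≫ _) = _
    have h1 := contr₁_boundary₁ k p q (v (p + 1) q)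
    rw [hk₁ _ _ k (hk _ _ (by omega)).1] at h1
    have h2 := congrArg (contr₁ k p q) (hv p q (by omega))
    rw [map_add, map_zero, map_zsmul, contr₁_boundary₂] at h2
    rw [pow_succ, mul_neg_one, neg_smul, eq_neg_of_add_eq_zero_right h2, neg_neg, h1]

end

end Paracyclic

end

/-! ### Chain maps into acyclic complexes -/

section

variable {C : Type*} [Category* C] [Preadditive C]

/-- Acyclicity in positive degrees, tested by all objects. -/
def LiftsCycles {L : ℕ → C} (d : ∀ n, L (n + 1) ⟶ L n) : Prop :=
  ∀ (M : C) (n : ℕ) (g : M ⟶ L (n + 1)), g ≫ d n = 0 → ∃ s : M ⟶ L (n + 2), s ≫ d (n + 1) = g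

/-- In each new degree the composite to be lifted is a cycle. No projectivity of `A` is required,
since cycles lift from every object. Degrees zero and one are prescribed because nothing is assumed
on the homology of `L` in degree zero. -/
theorem LiftsCycles.exists_hom {A L : ChainComplex C ℕ}
    (hL : LiftsCycles fun n => L.d (n + 1) n)
    (f₀ : A.X 0 ⟶ L.X 0) (f₁ : A.X 1 ⟶ L.X 1) (h : f₁ ≫ L.d 1 0 = A.d 1 0 ≫ f₀) :
    ∃ f : A ⟶ L, f.f 0 = f₀ := by
  have key : ∀ (n : ℕ) (p : Σ' (f : A.X n ⟶ L.X n) (f' : A.X (n + 1) ⟶ L.X (n + 1)),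
      f' ≫ L.d (n + 1) n = A.d (n + 1) n ≫ f),
      ∃ f'' : A.X (n + 2) ⟶ L.X (n + 2), f'' ≫ L.d (n + 2) (n + 1) = A.d (n + 2) (n + 1) ≫ p.2.1 :=
    fun n p => hL _ n _ (by rw [Category.assoc, p.2.2]; simp)
  exact ⟨ChainComplex.mkHom A L f₀ f₁ h fun n p => ⟨(key n p).choose, (key n p).choose_spec⟩,
    ChainComplex.mkHom_f_0 _ _ _ _ _ _⟩

/-- The sign `e` makes one induction serve for two purposes: chain maps (`e = 1`) and maps of degree
one that anticommute with the boundaries (`e = -1`). -/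
theorem LiftsCycles.exists_homotopy {A L : ℕ → C} {dA : ∀ n, A (n + 1) ⟶ A n}
    {d : ∀ n, L (n + 1) ⟶ L n} (hL : LiftsCycles d) (hA : ∀ n, dA (n + 1) ≫ dA n = 0)
    (e : ℤˣ) (f : ∀ n, A n ⟶ L n) (hf : ∀ n, f (n + 1) ≫ d n = e • (dA n ≫ f n))
    (s₀ : A 0 ⟶ L 1) (h₀ : s₀ ≫ d 0 = f 0) :
    ∃ s : ∀ n, A n ⟶ L (n + 1), s 0 ≫ d 0 = f 0 ∧
      ∀ n, s (n + 1) ≫ d (n + 1) = f (n + 1) - e • (dA n ≫ s n) := by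
  -- The invariant of the induction. It is all that is needed to see that the right-hand side in the
  -- next degree is a cycle.
  let P : ∀ n, (A n ⟶ L (n + 1)) → Prop := fun n s => dA n ≫ s ≫ d n = dA n ≫ f n
  have step : ∀ n (s : A n ⟶ L (n + 1)), P n s →
      ∃ s' : A (n + 1) ⟶ L (n + 2), s' ≫ d (n + 1) = f (n + 1) - e • (dA n ≫ s) := by
    intro n s hs
    refine hL _ n _ ?_
    rw [Preadditive.sub_comp, hf, ParacyclicObject.units_smul_comp, Category.assoc, hs, sub_self]
  have hP : ∀ n s s', s' ≫ d (n + 1) = f (n + 1) - e • (dA n ≫ s) → P (n + 1) s' := by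
    intro n s s' h
    simp only [P]
    rw [h, Preadditive.comp_sub, ParacyclicObject.comp_units_smul, ← Category.assoc (dA (n + 1)),
      hA, Limits.zero_comp, smul_zero, sub_zero]
  let S : ∀ n, {s : A n ⟶ L (n + 1) // P n s} := fun n => Nat.rec
    ⟨s₀, by simp only [P]; rw [h₀]⟩
    (fun n s => ⟨(step n s.1 s.2).choose, hP n s.1 _ (step n s.1 s.2).choose_spec⟩) n
  exact ⟨fun n => (S n).1, h₀, fun n => (step n (S n).1 (S n).2).choose_spec⟩

end

/-! ### The two models -/

namespace Paracyclic

open FormalSums CategoryTheory.Prod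

/-- Matrices of formal sums of pairs of paracyclic morphisms. -/
abbrev Models : Type 1 := Mat_ (FormalSums (Paracyclic × Paracyclic))

/-- The object of bidegree `(n, n)`. -/
noncomputable abbrev diagObj (n : ℕ) : Models := (Mat_.embedding _).obj (bi n n)

/-- The chain complex of the diagonal. -/
noncomputable def diagComplex : ChainComplex Models ℕ :=
  ChainComplex.of diagObj (fun n => (Mat_.embedding _).map (diagBoundary n)) fun n => by
    rw [← Functor.map_comp, diagBoundary_comp, Functor.map_zero]

theorem diagComplex_d (n : ℕ) : diagComplex.d (n + 1) n =
    (Mat_.embedding _).map (diagBoundary n) :=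
  ChainComplex.of_d diagObj (fun n => (Mat_.embedding _).map (diagBoundary n)) n

/-- A matrix into an object with a single entry is a family of formal sums, and `diag_exact` is
applied to each of them. -/
theorem diagComplex_liftsCycles : LiftsCycles fun n => diagComplex.d (n + 1) n := by
  intro M n g hg
  simp only [diagComplex_d] at hg
  have h : ∀ i, ∃ s : M.X i ⟶ bi (n + 2) (n + 2), s ≫ diagBoundary (n + 1) = g i PUnit.unit := by
    intro i
    refine diag_exact n _ ?_
    have := congrFun (congrFun hg i) PUnit.unit
    refine Eq.trans ?_ this
    exact (Fintype.sum_unique (fun j : PUnit => g i j ≫ diagBoundary n)).symm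
  choose s hs using h
  refine ⟨fun i _ => s i, ?_⟩
  simp only [diagComplex_d]
  refine Mat_.hom_ext _ _ fun i _ => ?_
  exact (Fintype.sum_unique (fun j : PUnit => s i ≫ diagBoundary (n + 1))).trans (hs i)

/-- The sum of the objects of bidegrees `(p, q)` with `p + q = n`. -/
abbrev totalObj (n : ℕ) : Models :=
  ⟨Finset.HasAntidiagonal.antidiagonal n, fun x => bi x.1.1 x.1.2⟩

/-- The index of a summand. -/
abbrev idx {n : ℕ} (p q : ℕ) (h : p + q = n) : (totalObj n).ι :=
  ⟨(p, q), Finset.HasAntidiagonal.mem_antidiagonal.2 h⟩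

theorem sum_totalObj {A : Type*} [AddCommMonoid A] {n : ℕ} (f : (totalObj n).ι → A) (p q : ℕ)
    (h : p + q = n) (hf : ∀ x : (totalObj n).ι, x.1 ≠ (p, q) → f x = 0) :
    ∑ x, f x = f (idx p q h) :=
  Finset.sum_eq_single _ (fun x _ hx => hf x fun h => hx (Subtype.ext h))
    (fun h => absurd (Finset.mem_univ _) h)

theorem bi_eq {x : ℕ × ℕ} {p q : ℕ} (h : x = (p, q)) : bi x.1 x.2 = bi p q := by rw [h]

/-- The matrix with the entries `boundary₁` and `(-1) ^ p • boundary₂`. -/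
noncomputable def totalBoundary (n : ℕ) : totalObj (n + 1) ⟶ totalObj n := fun x y =>
  (if h : x.1 = (y.1.1 + 1, y.1.2) then eqToHom (bi_eq h) ≫ boundary₁ y.1.1 y.1.2 else 0) +
    (-1 : ℤ) ^ y.1.1 •
      (if h : x.1 = (y.1.1, y.1.2 + 1) then eqToHom (bi_eq h) ≫ boundary₂ y.1.1 y.1.2 else 0)

/-- Only two entries of a column of `totalBoundary` are nonzero. This formula keeps the case
distinctions and the transports along equalities of bidegrees out of the later proofs. -/
theorem comp_totalBoundary {M : Models} {n : ℕ} (w : M ⟶ totalObj (n + 1)) (i : M.ι) (p q : ℕ)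
    (h : p + q = n) : (w ≫ totalBoundary n) i (idx p q h) =
      w i (idx (p + 1) q (by omega)) ≫ boundary₁ p q +
        (-1 : ℤ) ^ p • (w i (idx p (q + 1) (by omega)) ≫ boundary₂ p q) := by
  rw [Mat_.comp_apply]
  simp only [totalBoundary, Preadditive.comp_add, Preadditive.comp_zsmul, Finset.sum_add_distrib]
  rw [← Finset.smul_sum]
  congr 1
  · rw [sum_totalObj _ (p + 1) q (by omega)]
    · simp
    · intro x hx
      rw [dif_neg hx, Limits.comp_zero]
  · rw [sum_totalObj _ p (q + 1) (by omega)]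
    · simp
    · intro x hx
      rw [dif_neg hx, Limits.comp_zero]

theorem total_hom_ext {M : Models} {n : ℕ} {v w : M ⟶ totalObj n}
    (h : ∀ i p q (hpq : p + q = n), v i (idx p q hpq) = w i (idx p q hpq)) : v = w :=
  Mat_.hom_ext _ _ fun i x => h i x.1.1 x.1.2 (Finset.HasAntidiagonal.mem_antidiagonal.1 x.2)

theorem totalBoundary_comp (n : ℕ) : totalBoundary (n + 1) ≫ totalBoundary n = 0 := by
  -- The identity plays the role of a generic matrix, to which the formula for the entries of a
  -- composite applies.
  rw [← Category.id_comp (totalBoundary (n + 1))]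
  refine total_hom_ext fun i p q h => ?_
  rw [comp_totalBoundary, comp_totalBoundary _ i (p + 1) q (by omega),
    comp_totalBoundary _ i p (q + 1) (by omega)]
  simp only [Preadditive.add_comp, Preadditive.zsmul_comp, Preadditive.neg_comp, Category.assoc, boundary₁_comp,
    boundary₂_comp, boundary₁_boundary₂, Limits.comp_zero, smul_zero, add_zero, zero_add, pow_succ,
    mul_neg_one, neg_smul, neg_add_cancel]
  rfl

/-- The chain complex of the total complex. -/
noncomputable def totalComplex : ChainComplex Models ℕ :=
  ChainComplex.of totalObj totalBoundary totalBoundary_comp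

theorem totalComplex_d (n : ℕ) : totalComplex.d (n + 1) n = totalBoundary n :=
  ChainComplex.of_d totalObj totalBoundary n

theorem totalComplex_liftsCycles : LiftsCycles fun n => totalComplex.d (n + 1) n := by
  intro M n g hg
  simp only [totalComplex_d] at hg
  change M ⟶ totalObj (n + 1) at g
  have h : ∀ i, ∃ s : ∀ p q, M.X i ⟶ bi p q, ∀ p q (hpq : p + q = n + 1),
      s (p + 1) q ≫ boundary₁ p q + (-1 : ℤ) ^ p • (s p (q + 1) ≫ boundary₂ p q) =
        g i (idx p q hpq) := by
    intro i
    obtain ⟨s, hs⟩ := total_exact n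
      (fun p q => if h : p + q = n + 1 then g i (idx p q h) else 0) (fun p q hpq => by
        rw [dif_pos (by omega), dif_pos (by omega), ← comp_totalBoundary g i p q hpq]
        exact congrFun (congrFun hg i) _)
    exact ⟨s, fun p q hpq => (hs p q hpq).trans (dif_pos hpq)⟩
  choose s hs using h
  refine ⟨(fun i x => s i x.1.1 x.1.2 : M ⟶ totalObj (n + 2)), ?_⟩
  simp only [totalComplex_d]
  refine total_hom_ext fun i p q hpq => ?_
  exact (comp_totalBoundary (fun i x => s i x.1.1 x.1.2 : M ⟶ totalObj (n + 2)) i p q hpq).trans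
    (hs i p q hpq)

end Paracyclic

/-! ### Naturality of the Connes operator -/

namespace ParacyclicObject

open Paracyclic

variable {C : Type*} [Category* C] [Preadditive C] {F G : Paracyclic ⥤ C} (φ : F ⟶ G)

theorem t_naturality (n : ℕ) (j : ℤ) : t F n j ≫ φ.app ⟨n⟩ = φ.app ⟨n⟩ ≫ t G n j := by
  rw [t, t, units_smul_comp, comp_units_smul, φ.naturality]

theorem connesB_naturality (n : ℕ) :
    connesB F n ≫ φ.app ⟨n + 1⟩ = φ.app ⟨n⟩ ≫ connesB G n := by
  have h : normOp F n ≫ φ.app ⟨n⟩ = φ.app ⟨n⟩ ≫ normOp G n := by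
    rw [normOp, normOp, Preadditive.sum_comp, Preadditive.comp_sum]
    exact Finset.sum_congr rfl fun j _ => t_naturality φ n j
  rw [connesB, connesB, ← Category.assoc (φ.app _), ← h]
  simp only [Category.assoc, Preadditive.sub_comp, Preadditive.comp_sub,
    Category.comp_id, t_naturality, NatTrans.naturality, NatTrans.naturality_assoc]

theorem b_eq_sum_range (F : Paracyclic ⥤ C) (n : ℕ) :
    b F n = ∑ i ∈ Finset.range (n + 2), (-1 : ℤ) ^ i • F.map (Paracyclic.faceN n i) := by
  rw [b, ← Fin.sum_univ_eq_sum_range (fun i => (-1 : ℤ) ^ i • F.map (Paracyclic.faceN n i))]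
  refine Finset.sum_congr rfl fun i _ => ?_
  rw [faceN_val]

end ParacyclicObject

/-- The inclusion of a category in the category of formal sums of its morphisms. -/
noncomputable def FormalSums.incl (C : Type*) [Category* C] : C ⥤ FormalSums C where
  obj X := ⟨X⟩
  map f := single f
  map_comp f g := (single_comp (X := ⟨_⟩) (Y := ⟨_⟩) (Z := ⟨_⟩) f g).symm

namespace Paracyclic

open FormalSums CategoryTheory.Prod

/-! ### The Connes operators of the models -/

/-- The first variable. -/
noncomputable abbrev var₁ (Y : Paracyclic) : Paracyclic ⥤ FormalSums (Paracyclic × Paracyclic) :=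
  sectL Paracyclic Y ⋙ incl _

/-- The second variable. -/
noncomputable abbrev var₂ (X : Paracyclic) : Paracyclic ⥤ FormalSums (Paracyclic × Paracyclic) :=
  sectR X Paracyclic ⋙ incl _

/-- The diagonal. -/
noncomputable abbrev diagVar : Paracyclic ⥤ FormalSums (Paracyclic × Paracyclic) :=
  (𝟭 Paracyclic).prod' (𝟭 Paracyclic) ⋙ incl _

/-- The natural transformation induced by a morphism in the second variable. -/
noncomputable def var₁Map {Y Y' : Paracyclic} (g : Y ⟶ Y') : var₁ Y ⟶ var₁ Y' where
  app X := (incl _).map (𝟙 X ×ₘ g)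
  naturality X X' f := by
    change (single (f ×ₘ 𝟙 Y) : (⟨(X, Y)⟩ : FormalSums _) ⟶ ⟨(X', Y)⟩) ≫
        (single (𝟙 X' ×ₘ g) : _ ⟶ (⟨(X', Y')⟩ : FormalSums _)) =
      (single (𝟙 X ×ₘ g) : _ ⟶ (⟨(X, Y')⟩ : FormalSums _)) ≫ single (f ×ₘ 𝟙 Y')
    rw [single_comp, single_comp, prod_comp, prod_comp]
    simp only [Category.id_comp, Category.comp_id]

/-- The natural transformation induced by a morphism in the first variable. -/
noncomputable def var₂Map {X X' : Paracyclic} (f : X ⟶ X') : var₂ X ⟶ var₂ X' where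
  app Y := (incl _).map (f ×ₘ 𝟙 Y)
  naturality Y Y' g := by
    change (single (𝟙 X ×ₘ g) : (⟨(X, Y)⟩ : FormalSums _) ⟶ ⟨(X, Y')⟩) ≫
        (single (f ×ₘ 𝟙 Y') : _ ⟶ (⟨(X', Y')⟩ : FormalSums _)) =
      (single (f ×ₘ 𝟙 Y) : _ ⟶ (⟨(X', Y)⟩ : FormalSums _)) ≫ single (𝟙 X' ×ₘ g)
    rw [single_comp, single_comp, prod_comp, prod_comp]
    simp only [Category.id_comp, Category.comp_id]

/-- The deck transformation of the first variable. -/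
noncomputable def deck₁ (p q : ℕ) : bi p q ⟶ bi p q := single (deck ⟨p⟩ ×ₘ 𝟙 _)

/-- The deck transformation of the second variable. -/
noncomputable def deck₂ (p q : ℕ) : bi p q ⟶ bi p q := single (𝟙 _ ×ₘ deck ⟨q⟩)

/-- The Connes operator of the first variable. -/
noncomputable def connes₁ (p q : ℕ) : bi p q ⟶ bi (p + 1) q :=
  ParacyclicObject.connesB (var₁ ⟨q⟩) p

/-- The Connes operator of the second variable. -/
noncomputable def connesVar₂ (p q : ℕ) : bi p q ⟶ bi p (q + 1) :=
  ParacyclicObject.connesB (var₂ ⟨p⟩) q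

/-- The Connes operator of the second variable, twisted by the deck transformation of the first
variable. -/
noncomputable def connes₂ (p q : ℕ) : bi p q ⟶ bi p (q + 1) := deck₁ p q ≫ connesVar₂ p q

/-- The Connes operator of the diagonal. -/
noncomputable def diagConnes (n : ℕ) : bi n n ⟶ bi (n + 1) (n + 1) :=
  ParacyclicObject.connesB diagVar n

theorem b_var₁ (p q : ℕ) : ParacyclicObject.b (var₁ ⟨q⟩) p = boundary₁ p q :=
  ParacyclicObject.b_eq_sum_range _ _

theorem b_var₂ (p q : ℕ) : ParacyclicObject.b (var₂ ⟨p⟩) q = boundary₂ p q :=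
  ParacyclicObject.b_eq_sum_range _ _

theorem b_diagVar (n : ℕ) : ParacyclicObject.b diagVar n = diagBoundary n :=
  ParacyclicObject.b_eq_sum_range _ _

theorem connes₁_boundary₁_zero (q : ℕ) :
    connes₁ 0 q ≫ boundary₁ 0 q = 𝟙 _ - deck₁ 0 q := by
  rw [← b_var₁]
  exact ParacyclicObject.connesB_b_zero (var₁ ⟨q⟩)

theorem connes₁_boundary₁ (p q : ℕ) :
    connes₁ (p + 1) q ≫ boundary₁ (p + 1) q + boundary₁ p q ≫ connes₁ p q =
      𝟙 _ - deck₁ (p + 1) q := by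
  rw [← b_var₁, ← b_var₁]
  exact ParacyclicObject.connesB_b (var₁ ⟨q⟩) p

theorem connesVar₂_boundary₂_zero (p : ℕ) :
    connesVar₂ p 0 ≫ boundary₂ p 0 = 𝟙 _ - deck₂ p 0 := by
  rw [← b_var₂]
  exact ParacyclicObject.connesB_b_zero (var₂ ⟨p⟩)

theorem connesVar₂_boundary₂ (p q : ℕ) :
    connesVar₂ p (q + 1) ≫ boundary₂ p (q + 1) + boundary₂ p q ≫ connesVar₂ p q =
      𝟙 _ - deck₂ p (q + 1) := by
  rw [← b_var₂, ← b_var₂]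
  exact ParacyclicObject.connesB_b (var₂ ⟨p⟩) q

theorem connes₂_boundary₂_zero (p : ℕ) :
    connes₂ p 0 ≫ boundary₂ p 0 = deck₁ p 0 - deck₁ p 0 ≫ deck₂ p 0 := by
  rw [connes₂, Category.assoc, connesVar₂_boundary₂_zero, Preadditive.comp_sub, Category.comp_id]

theorem connes₁_single (p : ℕ) {q q' : ℕ} (g : (⟨q⟩ : Paracyclic) ⟶ ⟨q'⟩) :
    connes₁ p q ≫ (single (𝟙 _ ×ₘ g) : bi (p + 1) q ⟶ bi (p + 1) q') =
      (single (𝟙 _ ×ₘ g) : bi p q ⟶ bi p q') ≫ connes₁ p q' :=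
  ParacyclicObject.connesB_naturality (var₁Map g) p

theorem connesVar₂_single (q : ℕ) {p p' : ℕ} (f : (⟨p⟩ : Paracyclic) ⟶ ⟨p'⟩) :
    connesVar₂ p q ≫ (single (f ×ₘ 𝟙 _) : bi p (q + 1) ⟶ bi p' (q + 1)) =
      (single (f ×ₘ 𝟙 _) : bi p q ⟶ bi p' q) ≫ connesVar₂ p' q :=
  ParacyclicObject.connesB_naturality (var₂Map f) q

theorem connes₂_single (q : ℕ) {p p' : ℕ} (f : (⟨p⟩ : Paracyclic) ⟶ ⟨p'⟩) :
    connes₂ p q ≫ (single (f ×ₘ 𝟙 _) : bi p (q + 1) ⟶ bi p' (q + 1)) =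
      (single (f ×ₘ 𝟙 _) : bi p q ⟶ bi p' q) ≫ connes₂ p' q := by
  rw [connes₂, connes₂, Category.assoc, connesVar₂_single, ← Category.assoc, ← Category.assoc]
  congr 1
  rw [deck₁, deck₁, single_comp, single_comp, prod_comp, prod_comp, deck_naturality]

theorem deck₁_single (p : ℕ) {q q' : ℕ} (g : (⟨q⟩ : Paracyclic) ⟶ ⟨q'⟩) :
    deck₁ p q ≫ (single (𝟙 _ ×ₘ g) : bi p q ⟶ bi p q') =
      (single (𝟙 _ ×ₘ g) : bi p q ⟶ bi p q') ≫ deck₁ p q' := by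
  rw [deck₁, deck₁, single_comp, single_comp, prod_comp, prod_comp]
  simp only [Category.id_comp, Category.comp_id]

theorem deck₁_boundary₂ (p q : ℕ) :
    deck₁ p (q + 1) ≫ boundary₂ p q = boundary₂ p q ≫ deck₁ p q := by
  simp only [boundary₂, formalBoundary, Preadditive.comp_sum, Preadditive.comp_zsmul,
    Preadditive.sum_comp, Preadditive.zsmul_comp]
  exact Finset.sum_congr rfl fun i _ => congrArg _ (deck₁_single p _)

theorem connes₁_boundary₂ (p q : ℕ) :
    connes₁ p (q + 1) ≫ boundary₂ (p + 1) q = boundary₂ p q ≫ connes₁ p q := by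
  simp only [boundary₂, formalBoundary, Preadditive.comp_sum, Preadditive.comp_zsmul,
    Preadditive.sum_comp, Preadditive.zsmul_comp]
  exact Finset.sum_congr rfl fun i _ => congrArg _ (connes₁_single p _)

theorem connes₂_boundary₁ (p q : ℕ) :
    connes₂ (p + 1) q ≫ boundary₁ p (q + 1) = boundary₁ p q ≫ connes₂ p q := by
  simp only [boundary₁, formalBoundary, Preadditive.comp_sum, Preadditive.comp_zsmul,
    Preadditive.sum_comp, Preadditive.zsmul_comp]
  exact Finset.sum_congr rfl fun i _ => congrArg _ (connes₂_single q _)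

/-- Because of the twist the defect is T₁ - T₁T₂. Added to the defect 1 - T₁ of the first variable
it gives 1 - T₁T₂, as on the diagonal. -/
theorem connes₂_boundary₂ (p q : ℕ) :
    connes₂ p (q + 1) ≫ boundary₂ p (q + 1) + boundary₂ p q ≫ connes₂ p q =
      deck₁ p (q + 1) - deck₁ p (q + 1) ≫ deck₂ p (q + 1) := by
  rw [connes₂, connes₂, Category.assoc, ← Category.assoc (boundary₂ p q), ← deck₁_boundary₂,
    Category.assoc, ← Preadditive.comp_add, connesVar₂_boundary₂, Preadditive.comp_sub,
    Category.comp_id]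

/-- The matrix with the entries `connes₁` and `(-1) ^ p • connes₂`. -/
noncomputable def totalConnes (n : ℕ) : totalObj n ⟶ totalObj (n + 1) := fun x y =>
  (if h : y.1 = (x.1.1 + 1, x.1.2) then connes₁ x.1.1 x.1.2 ≫ eqToHom (bi_eq h).symm else 0) +
    (-1 : ℤ) ^ x.1.1 •
      (if h : y.1 = (x.1.1, x.1.2 + 1) then connes₂ x.1.1 x.1.2 ≫ eqToHom (bi_eq h).symm else 0)

/-- The entries of a row of a matrix, extended by zero. -/
noncomputable def row {M : Models} {n : ℕ} (v : M ⟶ totalObj n) (i : M.ι) (p q : ℕ) :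
    M.X i ⟶ bi p q :=
  if h : p + q = n then v i (idx p q h) else 0

theorem row_of {M : Models} {n : ℕ} (v : M ⟶ totalObj n) (i : M.ι) (p q : ℕ) (h : p + q = n) :
    row v i p q = v i (idx p q h) := dif_pos h

/-- The contribution of `connes₁`. -/
noncomputable def raise₁ {X : FormalSums (Paracyclic × Paracyclic)} (v : ∀ p q, X ⟶ bi p q) :
    ∀ p q, X ⟶ bi p q
  | 0, _ => 0
  | p + 1, q => v p q ≫ connes₁ p q

/-- The contribution of `connes₂`. -/
noncomputable def raise₂ {X : FormalSums (Paracyclic × Paracyclic)} (v : ∀ p q, X ⟶ bi p q) :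
    ∀ p q, X ⟶ bi p q
  | _, 0 => 0
  | p, q + 1 => v p q ≫ connes₂ p q

theorem comp_totalConnes {M : Models} {n : ℕ} (v : M ⟶ totalObj n) (i : M.ι) (p q : ℕ)
    (h : p + q = n + 1) : (v ≫ totalConnes n) i (idx p q h) =
      raise₁ (row v i) p q + (-1 : ℤ) ^ p • raise₂ (row v i) p q := by
  rw [Mat_.comp_apply]
  simp only [totalConnes, Preadditive.comp_add, Preadditive.comp_zsmul, Finset.sum_add_distrib]
  congr 1
  · obtain _ | p := p
    · refine Finset.sum_eq_zero fun x _ => ?_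
      rw [dif_neg (by simp), Limits.comp_zero]
    · rw [sum_totalObj _ p q (by omega)]
      · simp [raise₁, row_of v i p q (by omega)]
      · intro x hx
        rw [dif_neg fun h => hx (by ext <;> simp_all), Limits.comp_zero]
  · obtain _ | q := q
    · rw [raise₂, smul_zero]
      refine Finset.sum_eq_zero fun x _ => ?_
      rw [dif_neg (by simp), Limits.comp_zero, smul_zero]
    · rw [sum_totalObj _ p q (by omega)]
      · simp [raise₂, row_of v i p q (by omega)]
      · intro x hx
        rw [dif_neg fun h => hx (by ext <;> simp_all), Limits.comp_zero, smul_zero]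

/-- The deck transformation of both variables. -/
noncomputable def totalDeck (n : ℕ) : totalObj n ⟶ totalObj n := fun x y =>
  if h : x.1 = y.1 then eqToHom (bi_eq h) ≫ deck₁ y.1.1 y.1.2 ≫ deck₂ y.1.1 y.1.2 else 0

theorem comp_totalDeck {M : Models} {n : ℕ} (v : M ⟶ totalObj n) (i : M.ι) (p q : ℕ)
    (h : p + q = n) : (v ≫ totalDeck n) i (idx p q h) =
      v i (idx p q h) ≫ deck₁ p q ≫ deck₂ p q := by
  rw [Mat_.comp_apply, sum_totalObj _ p q h]
  · simp [totalDeck]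
  · intro x hx
    rw [totalDeck, dif_neg hx, Limits.comp_zero]

theorem totalConnes_totalBoundary_zero :
    totalConnes 0 ≫ totalBoundary 0 = 𝟙 _ - totalDeck 0 := by
  rw [← Category.id_comp (totalConnes 0), ← Category.id_comp (totalDeck 0)]
  refine total_hom_ext fun i p q h => ?_
  obtain ⟨rfl, rfl⟩ : p = 0 ∧ q = 0 := by omega
  rw [comp_totalBoundary, comp_totalConnes, comp_totalConnes]
  simp only [raise₁, raise₂, smul_zero, add_zero, zero_add, pow_zero, one_smul, Category.assoc]
  rw [connes₁_boundary₁_zero, connes₂_boundary₂_zero, row_of _ i 0 0 h]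
  refine Eq.trans ?_ (b := (𝟙 (totalObj 0)) i (idx 0 0 h) - (𝟙 _ ≫ totalDeck 0) i (idx 0 0 h)) rfl
  rw [comp_totalDeck, ← Preadditive.comp_add, sub_add_sub_cancel, Preadditive.comp_sub,
    Category.comp_id]

/-- The mixed terms cancel: each operator commutes with the boundary of the other variable, and the
sign (-1) ^ p enters the two products with opposite parity. The defects of the two variables add up.
-/
theorem totalConnes_totalBoundary (n : ℕ) :
    totalConnes (n + 1) ≫ totalBoundary (n + 1) + totalBoundary n ≫ totalConnes n =
      𝟙 _ - totalDeck (n + 1) := by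
  rw [← Category.id_comp (totalConnes (n + 1)), ← Category.id_comp (totalDeck (n + 1)),
    ← Category.id_comp (totalBoundary n)]
  set v := 𝟙 (totalObj (n + 1))
  refine total_hom_ext fun i p q h => ?_
  change ((v ≫ totalConnes (n + 1)) ≫ totalBoundary (n + 1)) i _ +
    ((v ≫ totalBoundary n) ≫ totalConnes n) i _ = v i _ - (v ≫ totalDeck (n + 1)) i _
  have hrow : ∀ p q, p + q = n → row (v ≫ totalBoundary n) i p q =
      row v i (p + 1) q ≫ boundary₁ p q + (-1 : ℤ) ^ p • (row v i p (q + 1) ≫ boundary₂ p q) := by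
    intro p q hpq
    rw [row_of _ i p q hpq, comp_totalBoundary, row_of _ i (p + 1) q (by omega),
      row_of _ i p (q + 1) (by omega)]
  have hsign : ∀ k : ℕ, (-1 : ℤ) ^ k * (-1) ^ k = 1 := fun k => by rw [← mul_pow]; simp
  rw [comp_totalBoundary _ i p q h, comp_totalConnes, comp_totalConnes, comp_totalConnes,
    comp_totalDeck, ← row_of v i p q h]
  -- On the edges p = 0 and q = 0 of the quadrant some of the generic terms are absent, and the
  -- degree zero forms of the relations are used.
  obtain _ | p := p
  · obtain rfl : q = n + 1 := by omega
    simp only [raise₁, raise₂, hrow 0 n (by omega), smul_zero, add_zero, zero_add, pow_zero,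
      one_smul, Category.assoc, Preadditive.add_comp, Preadditive.zsmul_comp, pow_one, neg_smul,
      Preadditive.neg_comp]
    have h1 := congrArg (row v i 0 (n + 1) ≫ ·) (connes₁_boundary₁_zero (n + 1))
    have h2 := congrArg (row v i 0 (n + 1) ≫ ·) (connes₂_boundary₂ 0 n)
    have h3 := congrArg (row v i 1 n ≫ ·) (connes₂_boundary₁ 0 n)
    simp only [Preadditive.comp_add, Preadditive.comp_sub, Category.comp_id] at h1 h2 h3
    rw [h3, ← sub_add_sub_cancel (row v i 0 (n + 1)) (row v i 0 (n + 1) ≫ deck₁ 0 (n + 1))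
      (row v i 0 (n + 1) ≫ deck₁ 0 (n + 1) ≫ deck₂ 0 (n + 1)), ← h1, ← h2]
    abel
  · obtain _ | q := q
    · obtain rfl : p = n := by omega
      simp only [raise₁, raise₂, hrow p 0 (by omega), smul_zero, add_zero, zero_add,
        Category.assoc, Preadditive.add_comp, Preadditive.zsmul_comp, smul_add,
        smul_smul, hsign, one_smul]
      have h1 := congrArg (row v i (p + 1) 0 ≫ ·) (connes₁_boundary₁ p 0)
      have h2 := congrArg (row v i (p + 1) 0 ≫ ·) (connes₂_boundary₂_zero (p + 1))
      have h3 := congrArg (row v i p 1 ≫ ·) (connes₁_boundary₂ p 0)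
      simp only [Preadditive.comp_add, Preadditive.comp_sub, Category.comp_id] at h1 h2 h3
      rw [h3, ← sub_add_sub_cancel (row v i (p + 1) 0) (row v i (p + 1) 0 ≫ deck₁ (p + 1) 0)
        (row v i (p + 1) 0 ≫ deck₁ (p + 1) 0 ≫ deck₂ (p + 1) 0), ← h1, ← h2, pow_succ, mul_neg_one, neg_smul]
      abel
    · simp only [raise₁, raise₂, hrow p (q + 1) (by omega), hrow (p + 1) q (by omega),
        Category.assoc, Preadditive.add_comp, Preadditive.zsmul_comp, smul_add,
        smul_smul, hsign, one_smul]
      have h1 := congrArg (row v i (p + 1) (q + 1) ≫ ·) (connes₁_boundary₁ p (q + 1))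
      have h2 := congrArg (row v i (p + 1) (q + 1) ≫ ·) (connes₂_boundary₂ (p + 1) q)
      have h3 := congrArg (row v i p (q + 1 + 1) ≫ ·) (connes₁_boundary₂ p (q + 1))
      have h4 := congrArg (row v i (p + 1 + 1) q ≫ ·) (connes₂_boundary₁ (p + 1) q)
      simp only [Preadditive.comp_add, Preadditive.comp_sub, Category.comp_id] at h1 h2 h3 h4
      rw [h3, h4, ← sub_add_sub_cancel (row v i (p + 1) (q + 1))
        (row v i (p + 1) (q + 1) ≫ deck₁ (p + 1) (q + 1))
        (row v i (p + 1) (q + 1) ≫ deck₁ (p + 1) (q + 1) ≫ deck₂ (p + 1) (q + 1)), ← h1, ← h2]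
      simp only [pow_succ, mul_neg_one, neg_smul, neg_neg]
      abel

end Paracyclic

namespace Paracyclic

open FormalSums CategoryTheory.Prod

/-! ### The Alexander–Whitney map of the models -/

/-- The front face. -/
def front (p q n : ℕ) (h : p + q = n) : (⟨n⟩ : Paracyclic) ⟶ ⟨p⟩ :=
  simplexMap (SimplexCategory.subinterval (n := n) 0 p (by omega))

/-- The back face. -/
def back (p q n : ℕ) (h : p + q = n) : (⟨n⟩ : Paracyclic) ⟶ ⟨q⟩ :=
  simplexMap (SimplexCategory.subinterval (n := n) p q (by omega))

theorem front_apply (p q n : ℕ) (h : p + q = n) (k : ℕ) (hk : k ≤ p) :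
    Lift.toFun (front p q n h) k = k :=
  periodic_apply _ k (Nat.lt_succ_of_le hk)

theorem back_apply (p q n : ℕ) (h : p + q = n) (k : ℕ) (hk : k ≤ q) :
    Lift.toFun (back p q n h) k = ((k + p : ℕ) : ℤ) :=
  periodic_apply _ k (Nat.lt_succ_of_le hk)

variable (p q n : ℕ) (h : p + q = n)

theorem face_front (i : ℕ) :
    faceN n i ≫ front p q n h = front (p + 1) q (n + 1) (by omega) ≫ faceN p i := by
  ext k hk
  simp only at hk
  rw [comp_faceN_apply _ _ _ hk, comp_toFun, front_apply _ _ _ _ _ hk,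
    front_apply _ _ _ _ _ (by split_ifs <;> omega), faceN_apply _ _ _ (by omega)]
  split_ifs <;> push_cast <;> rfl

theorem face_front' (i : ℕ) (hi : p + 1 ≤ i) :
    faceN n i ≫ front p q n h = front p (q + 1) (n + 1) (by omega) := by
  ext k hk
  simp only at hk
  rw [comp_toFun, front_apply _ _ _ _ _ hk, front_apply _ _ _ _ _ hk,
    faceN_apply _ _ _ (by omega), if_pos (by omega)]

theorem face_back (i : ℕ) (hi : i ≤ p) :
    faceN n i ≫ back p q n h = back (p + 1) q (n + 1) (by omega) := by
  ext k hk
  simp only at hk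
  rw [comp_toFun, back_apply _ _ _ _ _ hk, back_apply _ _ _ _ _ hk,
    faceN_apply _ _ _ (by omega), if_neg (by omega)]
  push_cast; ring

theorem face_back' (j : ℕ) :
    faceN n (p + j) ≫ back p q n h = back p (q + 1) (n + 1) (by omega) ≫ faceN q j := by
  ext k hk
  simp only at hk
  rw [comp_faceN_apply _ _ _ hk, comp_toFun, back_apply _ _ _ _ _ hk,
    back_apply _ _ _ _ _ (by split_ifs <;> omega), faceN_apply _ _ _ (by omega)]
  split_ifs <;> push_cast <;> omega

/-- The component of bidegree `(p, q)`. -/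
noncomputable def frontBack : bi n n ⟶ bi p q := single (front p q n h ×ₘ back p q n h)

/-- The faces with i ≤ p act on the front and the others on the back. The last face of the front and
the zeroth face of the back occur on the right only, and cancel there. -/
theorem diagBoundary_frontBack : diagBoundary n ≫ frontBack p q n h =
    frontBack (p + 1) q (n + 1) (by omega) ≫ boundary₁ p q +
      (-1 : ℤ) ^ p • (frontBack p (q + 1) (n + 1) (by omega) ≫ boundary₂ p q) := by
  simp only [diagBoundary, boundary₁, boundary₂, formalBoundary, frontBack, Preadditive.comp_sum,
    Preadditive.sum_comp, Preadditive.comp_zsmul, Preadditive.zsmul_comp, single_comp, prod_comp,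
    Category.comp_id]
  refine CyclicComplex.alternating_sum_split p q n h _ _ _ ?_ ?_ ?_
  · intro i hi
    rw [face_front, face_back _ _ _ _ _ hi]
  · intro j hj
    rw [face_front' _ _ _ _ _ (by omega), show p + 1 + j = p + (j + 1) by ring, face_back']
  · rw [← face_front p q n h, face_front' p q n h _ le_rfl, ← face_back' p q n h 0,
      face_back p q n h _ (by omega)]

theorem frontBack_deck : frontBack p q n h ≫ deck₁ p q ≫ deck₂ p q =
    (single (deck ⟨n⟩ ×ₘ deck ⟨n⟩) : bi n n ⟶ bi n n) ≫ frontBack p q n h := by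
  rw [frontBack, deck₁, deck₂, single_comp, single_comp, single_comp, prod_comp, prod_comp,
    prod_comp]
  simp only [Category.comp_id, Category.id_comp]
  rw [deck_naturality, deck_naturality]

/-- The Alexander–Whitney map in degree `n`. -/
noncomputable def awMap : diagObj n ⟶ totalObj n := fun _ x =>
  frontBack x.1.1 x.1.2 n (Finset.HasAntidiagonal.mem_antidiagonal.1 x.2)

theorem embedding_comp_apply {X Y : FormalSums (Paracyclic × Paracyclic)} {N : Models}
    (f : X ⟶ Y) (g : (Mat_.embedding _).obj Y ⟶ N) (i : PUnit) (j : N.ι) :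
    ((Mat_.embedding _).map f ≫ g) i j = f ≫ g i j :=
  Fintype.sum_unique (fun k : PUnit => f ≫ g k j)

theorem awMap_totalBoundary :
    awMap (n + 1) ≫ totalBoundary n = (Mat_.embedding _).map (diagBoundary n) ≫ awMap n := by
  refine total_hom_ext fun i p q h => ?_
  refine (comp_totalBoundary _ i p q h).trans (Eq.trans ?_
    (embedding_comp_apply (diagBoundary n) (awMap n) i _).symm)
  exact (diagBoundary_frontBack p q n h).symm

/-- The Alexander–Whitney map. -/
noncomputable def aw : diagComplex ⟶ totalComplex where
  f n := awMap n
  comm' i j hij := by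
    obtain rfl : j + 1 = i := hij
    rw [totalComplex_d, diagComplex_d]
    exact awMap_totalBoundary j

/-! ### The shuffle map -/

/-- The inverse of the Alexander–Whitney map in degree zero. -/
noncomputable def shuffleZero : totalObj 0 ⟶ diagObj 0 := fun x _ =>
  if h : x.1 = (0, 0) then eqToHom (bi_eq h) else 0

/-- The shuffle map in degree one. -/
noncomputable def shuffleOne : totalObj 1 ⟶ diagObj 1 := fun x _ =>
  (if h : x.1 = (1, 0) then eqToHom (bi_eq h) ≫
    (single (𝟙 _ ×ₘ degen 0) : bi 1 0 ⟶ bi 1 1) else 0) +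
  (if h : x.1 = (0, 1) then eqToHom (bi_eq h) ≫
    (single (degen 0 ×ₘ 𝟙 _) : bi 0 1 ⟶ bi 1 1) else 0)

theorem degen_faceN_zero (i : ℕ) (hi : i < 2) : degen (0 : Fin 1) ≫ faceN 0 i = 𝟙 _ := by
  ext k hk
  simp only at hk
  obtain rfl : k = 0 := by omega
  rw [comp_faceN_apply _ _ _ (by omega), degen_apply _ _ (by split_ifs <;> omega), id_toFun]
  simp only [Fin.val_zero]
  split_ifs <;> push_cast <;> omega

/-- Cycles lift in positive degrees only, so the inverse map has to be given in degrees zero and one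
before it can be extended. -/
theorem shuffleOne_diagBoundary : shuffleOne ≫ (Mat_.embedding _).map (diagBoundary 0) =
    totalBoundary 0 ≫ shuffleZero := by
  refine Mat_.hom_ext _ _ fun x u => ?_
  have h1 : (shuffleOne ≫ (Mat_.embedding _).map (diagBoundary 0)) x u =
      shuffleOne x u ≫ diagBoundary 0 :=
    Fintype.sum_unique (fun k : PUnit => shuffleOne x k ≫ diagBoundary 0)
  have h2 : (totalBoundary 0 ≫ shuffleZero) x u = totalBoundary 0 x (idx 0 0 rfl) := by
    rw [Mat_.comp_apply, sum_totalObj _ 0 0 rfl]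
    · exact Category.comp_id _
    · intro y hy
      rw [shuffleZero, dif_neg hy, Limits.comp_zero]
  refine h1.trans (Eq.trans ?_ h2.symm)
  change ((if h : x.1 = (1, 0) then eqToHom (bi_eq h) ≫
    (single (𝟙 _ ×ₘ degen 0) : bi 1 0 ⟶ bi 1 1) else 0) +
    (if h : x.1 = (0, 1) then eqToHom (bi_eq h) ≫
    (single (degen 0 ×ₘ 𝟙 _) : bi 0 1 ⟶ bi 1 1) else 0)) ≫ diagBoundary 0 =
    (if h : x.1 = (1, 0) then eqToHom (bi_eq h) ≫ boundary₁ 0 0 else 0) +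
    (-1 : ℤ) ^ 0 •
      (if h : x.1 = (0, 1) then eqToHom (bi_eq h) ≫ boundary₂ 0 0 else 0)
  simp only [pow_zero, one_smul, Preadditive.add_comp, dite_comp, Limits.zero_comp, Category.assoc,
    zero_add]
  congr 3
  · funext hx
    congr 1
    simp only [diagBoundary, boundary₁, formalBoundary, Preadditive.comp_sum,
      Preadditive.comp_zsmul, single_comp, prod_comp, Category.id_comp]
    refine Finset.sum_congr rfl fun i hi => ?_
    rw [Finset.mem_range] at hi
    rw [degen_faceN_zero i hi]
  · funext hx
    congr 1
    simp only [diagBoundary, boundary₂, formalBoundary, Preadditive.comp_sum,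
      Preadditive.comp_zsmul, single_comp, prod_comp, Category.id_comp]
    refine Finset.sum_congr rfl fun i hi => ?_
    rw [Finset.mem_range] at hi
    rw [degen_faceN_zero i hi]

theorem front_zero : front 0 0 0 rfl = 𝟙 _ := by
  ext k hk
  rw [front_apply _ _ _ _ _ hk, id_toFun]

theorem back_zero : back 0 0 0 rfl = 𝟙 _ := by
  ext k hk
  rw [back_apply _ _ _ _ _ hk, id_toFun, add_zero]

theorem awMap_shuffleZero : awMap 0 ≫ shuffleZero = 𝟙 _ := by
  refine Mat_.hom_ext _ _ fun i u => ?_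
  rw [Mat_.comp_apply, sum_totalObj _ 0 0 rfl]
  · refine (Category.comp_id _).trans ?_
    refine Eq.trans (?_ : frontBack 0 0 0 rfl = 𝟙 (bi 0 0))
      (Mat_.id_apply_self (diagObj 0) PUnit.unit).symm
    rw [frontBack, front_zero, back_zero]
    rfl
  · intro y hy
    rw [shuffleZero, dif_neg hy, Limits.comp_zero]

theorem shuffleZero_awMap : shuffleZero ≫ awMap 0 = 𝟙 _ := by
  refine total_hom_ext fun x p q h => ?_
  obtain ⟨rfl, rfl⟩ : p = 0 ∧ q = 0 := by omega
  have hx : x = idx 0 0 rfl := by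
    obtain ⟨⟨a, b⟩, hx⟩ := x
    have := Finset.HasAntidiagonal.mem_antidiagonal.1 hx
    simp only at this
    obtain ⟨rfl, rfl⟩ : a = 0 ∧ b = 0 := by omega
    rfl
  subst hx
  refine (Fintype.sum_unique (fun k : PUnit => shuffleZero (idx 0 0 rfl) k ≫
    awMap 0 k (idx 0 0 h))).trans ?_
  rw [Mat_.id_apply_self]
  change (if h : (0, 0) = (0, 0) then eqToHom (bi_eq h) else 0) ≫ frontBack 0 0 0 rfl = _
  rw [dif_pos rfl, frontBack, front_zero, back_zero]
  exact Category.id_comp _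

/-- The Alexander–Whitney map is a chain homotopy equivalence. -/
theorem exists_shuffle : ∃ (sh : totalComplex ⟶ diagComplex)
    (s : ∀ n, diagComplex.X n ⟶ diagComplex.X (n + 1))
    (s' : ∀ n, totalComplex.X n ⟶ totalComplex.X (n + 1)),
    (s 0 ≫ diagComplex.d 1 0 = (aw ≫ sh - 𝟙 _).f 0 ∧
      ∀ n, s (n + 1) ≫ diagComplex.d (n + 2) (n + 1) + diagComplex.d (n + 1) n ≫ s n =
        (aw ≫ sh - 𝟙 _).f (n + 1)) ∧
    (s' 0 ≫ totalComplex.d 1 0 = (sh ≫ aw - 𝟙 _).f 0 ∧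
      ∀ n, s' (n + 1) ≫ totalComplex.d (n + 2) (n + 1) + totalComplex.d (n + 1) n ≫ s' n =
        (sh ≫ aw - 𝟙 _).f (n + 1)) := by
  -- The higher components come from acyclicity alone.
  obtain ⟨sh, hsh⟩ := diagComplex_liftsCycles.exists_hom (A := totalComplex) shuffleZero shuffleOne
    (by
      rw [diagComplex_d, totalComplex_d]
      exact shuffleOne_diagBoundary)
  have hd : ∀ n, diagComplex.d (n + 2) (n + 1) ≫ diagComplex.d (n + 1) n = 0 :=
    fun n => diagComplex.d_comp_d _ _ _
  have ht : ∀ n, totalComplex.d (n + 2) (n + 1) ≫ totalComplex.d (n + 1) n = 0 :=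
    fun n => totalComplex.d_comp_d _ _ _
  -- In degree zero both composites are identities, so both homotopies can start with zero.
  have e1 : (aw ≫ sh - 𝟙 _).f 0 = 0 := by
    rw [HomologicalComplex.sub_f_apply, HomologicalComplex.comp_f, hsh]
    exact sub_eq_zero.2 awMap_shuffleZero
  have e2 : (sh ≫ aw - 𝟙 _).f 0 = 0 := by
    rw [HomologicalComplex.sub_f_apply, HomologicalComplex.comp_f, hsh]
    exact sub_eq_zero.2 shuffleZero_awMap
  have c1 : ∀ n, (aw ≫ sh - 𝟙 _).f (n + 1) ≫ diagComplex.d (n + 1) n =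
      (1 : ℤˣ) • (diagComplex.d (n + 1) n ≫ (aw ≫ sh - 𝟙 _).f n) :=
    fun n => by rw [one_smul]; exact HomologicalComplex.Hom.comm _ _ _
  have c2 : ∀ n, (sh ≫ aw - 𝟙 _).f (n + 1) ≫ totalComplex.d (n + 1) n =
      (1 : ℤˣ) • (totalComplex.d (n + 1) n ≫ (sh ≫ aw - 𝟙 _).f n) :=
    fun n => by rw [one_smul]; exact HomologicalComplex.Hom.comm _ _ _
  obtain ⟨s, h0, hs⟩ := LiftsCycles.exists_homotopy (A := fun n => diagComplex.X n)
    (L := fun n => diagComplex.X n) (dA := fun n => diagComplex.d (n + 1) n)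
    (d := fun n => diagComplex.d (n + 1) n) diagComplex_liftsCycles hd 1 _ c1 0
    (Limits.zero_comp.trans e1.symm)
  obtain ⟨s', h0', hs'⟩ := LiftsCycles.exists_homotopy (A := fun n => totalComplex.X n)
    (L := fun n => totalComplex.X n) (dA := fun n => totalComplex.d (n + 1) n)
    (d := fun n => totalComplex.d (n + 1) n) totalComplex_liftsCycles ht 1 _ c2 0
    (Limits.zero_comp.trans e2.symm)
  refine ⟨sh, s, s', ⟨h0, fun n => ?_⟩, h0', fun n => ?_⟩
  · rw [hs n, one_smul, sub_add_cancel]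
  · rw [hs' n, one_smul, sub_add_cancel]

/-! ### The Connes operators and the Alexander–Whitney map -/

/-- The difference of the two composites of the Alexander–Whitney map and the Connes operators. -/
noncomputable def connesDiff : diagObj n ⟶ totalObj (n + 1) :=
  (Mat_.embedding _).map (diagConnes n) ≫ awMap (n + 1) - awMap n ≫ totalConnes n

theorem awMap_totalDeck : awMap n ≫ totalDeck n = (Mat_.embedding _).map
    (single (deck ⟨n⟩ ×ₘ deck ⟨n⟩) : bi n n ⟶ bi n n) ≫ awMap n := by
  refine total_hom_ext fun i p q h => ?_
  refine (comp_totalDeck _ i p q h).trans (Eq.trans ?_ (embedding_comp_apply _ (awMap n) i _).symm)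
  exact frontBack_deck p q n h

theorem diagConnes_diagBoundary_zero :
    diagConnes 0 ≫ diagBoundary 0 = 𝟙 (bi 0 0) - single (deck ⟨0⟩ ×ₘ deck ⟨0⟩) := by
  rw [← b_diagVar]
  exact ParacyclicObject.connesB_b_zero diagVar

theorem diagConnes_diagBoundary :
    diagConnes (n + 1) ≫ diagBoundary (n + 1) + diagBoundary n ≫ diagConnes n =
      𝟙 (bi (n + 1) (n + 1)) - single (deck ⟨n + 1⟩ ×ₘ deck ⟨n + 1⟩) := by
  rw [← b_diagVar, ← b_diagVar]
  exact ParacyclicObject.connesB_b diagVar n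

theorem embedding_map_id_comp {M : Models} (g : diagObj n ⟶ M) :
    (Mat_.embedding _).map (𝟙 (bi n n)) ≫ g = g :=
  (congrArg (· ≫ g) ((Mat_.embedding _).map_id (bi n n))).trans (Category.id_comp g)

theorem connesDiff_totalBoundary_zero : connesDiff 0 ≫ totalBoundary 0 = 0 := by
  rw [connesDiff, Preadditive.sub_comp, Category.assoc, Category.assoc, awMap_totalBoundary,
    ← Category.assoc, ← Functor.map_comp, diagConnes_diagBoundary_zero,
    totalConnes_totalBoundary_zero, Functor.map_sub, Preadditive.sub_comp, Preadditive.comp_sub,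
    awMap_totalDeck, embedding_map_id_comp, Category.comp_id, sub_self]

/-- Both operators have the defect 1 - T, with T the deck transformation of both variables at once,
and the Alexander–Whitney map commutes with T. So the defects cancel in the difference. -/
theorem connesDiff_totalBoundary : connesDiff (n + 1) ≫ totalBoundary (n + 1) =
    (-1 : ℤˣ) • ((Mat_.embedding _).map (diagBoundary n) ≫ connesDiff n) := by
  have h1 := congrArg (fun x => (Mat_.embedding _).map x ≫ awMap (n + 1))
    (diagConnes_diagBoundary n)
  have h2 := congrArg (awMap (n + 1) ≫ ·) (totalConnes_totalBoundary n)
  simp only [Functor.map_sub, Functor.map_add, Preadditive.add_comp, Preadditive.sub_comp,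
    Preadditive.comp_add, Preadditive.comp_sub,
    Category.comp_id, Functor.map_comp, Category.assoc, awMap_totalDeck] at h1 h2
  rw [embedding_map_id_comp] at h1
  have h3 := h1.trans h2.symm
  rw [← Category.assoc (awMap (n + 1)) (totalBoundary n), awMap_totalBoundary,
    Category.assoc] at h3
  rw [connesDiff, connesDiff, Preadditive.sub_comp, Category.assoc, Category.assoc,
    awMap_totalBoundary, Preadditive.comp_sub, Units.neg_smul, one_smul, neg_sub,
    sub_eq_sub_iff_add_eq_add, h3]
  abel

/-- The two composites of the Alexander–Whitney map and the Connes operators are homotopic. -/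
theorem exists_connes_homotopy : ∃ s : ∀ n, diagComplex.X n ⟶ totalComplex.X (n + 2),
    s 0 ≫ totalComplex.d 2 1 = connesDiff 0 ∧
      ∀ n, s (n + 1) ≫ totalComplex.d (n + 3) (n + 2) - diagComplex.d (n + 1) n ≫ s n =
        connesDiff (n + 1) := by
  have hd : ∀ n, diagComplex.d (n + 2) (n + 1) ≫ diagComplex.d (n + 1) n = 0 :=
    fun n => diagComplex.d_comp_d _ _ _
  -- The difference raises degrees by one, so its target is the shifted complex, which inherits the
  -- lifting of cycles.
  have hL : LiftsCycles (L := fun n => totalComplex.X (n + 1))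
      fun n => totalComplex.d (n + 2) (n + 1) :=
    fun M n g hg => totalComplex_liftsCycles M (n + 1) g hg
  have c0 : connesDiff 0 ≫ totalComplex.d 1 0 = 0 := by
    rw [totalComplex_d]
    exact connesDiff_totalBoundary_zero
  have c : ∀ n, connesDiff (n + 1) ≫ totalComplex.d (n + 2) (n + 1) =
      (-1 : ℤˣ) • (diagComplex.d (n + 1) n ≫ connesDiff n) := fun n => by
    rw [diagComplex_d, totalComplex_d]
    exact connesDiff_totalBoundary n
  -- The start of the induction: a cycle of degree one, where the total complex is already acyclic.
  -- Unlike for the homotopy equivalence, nothing has to be computed in degree zero.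
  obtain ⟨s₀, hs₀⟩ := totalComplex_liftsCycles (diagObj 0) 0 (connesDiff 0) c0
  obtain ⟨s, h0, hs⟩ := LiftsCycles.exists_homotopy (A := fun n => diagComplex.X n)
    (L := fun n => totalComplex.X (n + 1)) (dA := fun n => diagComplex.d (n + 1) n)
    (d := fun n => totalComplex.d (n + 2) (n + 1)) hL hd (-1) (fun n => connesDiff n) c s₀ hs₀
  refine ⟨s, h0, fun n => ?_⟩
  refine sub_eq_of_eq_add ((hs n).trans ?_)
  rw [Units.neg_smul, one_smul]
  exact sub_neg_eq_add _ _

end Paracyclic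

/-! ### Additive functors -/

namespace ParacyclicObject

open Paracyclic

variable {C D : Type*} [Category* C] [Category* D] [Preadditive C] [Preadditive D]

theorem b_naturality {F G : Paracyclic ⥤ C} (φ : F ⟶ G) (n : ℕ) :
    b F n ≫ φ.app ⟨n⟩ = φ.app ⟨n + 1⟩ ≫ b G n := by
  simp only [b, Preadditive.sum_comp, Preadditive.comp_sum, Preadditive.zsmul_comp,
    Preadditive.comp_zsmul, φ.naturality]

variable (F : Paracyclic ⥤ C) (T : C ⥤ D) [T.Additive]

theorem b_comp (n : ℕ) : b (F ⋙ T) n = T.map (b F n) := by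
  simp only [b, Functor.map_sum, Functor.map_zsmul, Functor.comp_map]

theorem t_comp_functor (n : ℕ) (j : ℤ) : t (F ⋙ T) n j = T.map (t F n j) := by
  rw [t, t, Units.smul_def, Units.smul_def, Functor.map_zsmul, Functor.comp_map]

theorem connesB_comp (n : ℕ) : connesB (F ⋙ T) n = T.map (connesB F n) := by
  simp only [connesB, normOp, t_comp_functor, Functor.map_comp, Functor.map_sum, Functor.map_sub,
    Functor.comp_map]
  rw [T.map_id]
  rfl

end ParacyclicObject

namespace CyclicObject

variable {C D : Type*} [Category* C] [Category* D] [Preadditive C] [Preadditive D]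
  (F : CyclicCat ⥤ C) (T : C ⥤ D) [T.Additive]

theorem b_comp (n : ℕ) : b (F ⋙ T) n = T.map (b F n) := by
  rw [← ParacyclicObject.b_toCyclic, ← ParacyclicObject.b_toCyclic]
  exact ParacyclicObject.b_comp (Paracyclic.toCyclic ⋙ F) T n

theorem connesB_comp (n : ℕ) : connesB (F ⋙ T) n = T.map (connesB F n) := by
  rw [← ParacyclicObject.connesB_toCyclic, ← ParacyclicObject.connesB_toCyclic]
  exact ParacyclicObject.connesB_comp (Paracyclic.toCyclic ⋙ F) T n

end CyclicObject

/-! ### Additive functors on matrices -/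

section

open Limits

variable {C D : Type*} [Category* C] [Category* D] [Preadditive C] [Preadditive D]

theorem biproduct_entry {I J : Type} {A : I → D} {B : J → D} [Finite I] [Finite J]
    [HasFiniteBiproducts D] (m : ∀ i j, A i ⟶ B j) (i : I) (j : J) :
    (biproduct.ι A i ≫ biproduct.matrix m) ≫ biproduct.π B j = m i j := by
  rw [biproduct.ι_matrix, biproduct.lift_π]

theorem biproduct_hom_ext {I J : Type} {A : I → D} {B : J → D} [Finite I] [Finite J]
    [HasFiniteBiproducts D] {f g : (⨁ A) ⟶ ⨁ B}
    (h : ∀ i j, (biproduct.ι A i ≫ f) ≫ biproduct.π B j =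
      (biproduct.ι A i ≫ g) ≫ biproduct.π B j) : f = g :=
  biproduct.hom_ext' _ _ fun i => biproduct.hom_ext _ _ fun j => h i j

/-- The extension of an additive functor to matrices. -/
noncomputable def matRealize [HasFiniteBiproducts D] (T : C ⥤ D) [T.Additive] : Mat_ C ⥤ D where
  obj X := ⨁ fun i => T.obj (X.X i)
  map f := biproduct.matrix fun i j => T.map (f i j)
  map_id X := by
    classical
    refine biproduct_hom_ext fun i j => (biproduct_entry _ i j).trans ?_
    rw [Category.comp_id]
    by_cases h : i = j
    · subst h
      exact ((congrArg T.map (Mat_.id_apply_self X i)).trans (T.map_id _)).trans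
        (biproduct.ι_π_self (fun i => T.obj (X.X i)) i).symm
    · exact ((congrArg T.map (Mat_.id_apply_of_ne X i j h)).trans (T.map_zero _ _)).trans
        (biproduct.ι_π_ne (fun i => T.obj (X.X i)) h).symm
  map_comp {X Y Z} f g := by
    refine biproduct_hom_ext fun i j => (biproduct_entry _ i j).trans ?_
    refine ((congrArg T.map (Mat_.comp_apply f g i j)).trans (T.map_sum _ _)).trans ?_
    rw [biproduct.ι_matrix_assoc, Category.assoc, biproduct.matrix_π, biproduct.lift_desc]
    exact Finset.sum_congr rfl fun k _ => T.map_comp _ _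

instance [HasFiniteBiproducts D] (T : C ⥤ D) [T.Additive] : (matRealize T).Additive where
  map_add {X Y f g} := by
    refine biproduct_hom_ext fun i j => (biproduct_entry _ i j).trans ?_
    refine (T.map_add (f := f i j) (g := g i j)).trans ?_
    refine (congrArg₂ (· + ·) (biproduct_entry (fun i j => T.map (f i j)) i j).symm
      (biproduct_entry (fun i j => T.map (g i j)) i j).symm).trans ?_
    exact (Preadditive.add_comp _ _ _ _ _ _).symm.trans
      (congrArg (· ≫ _) (Preadditive.comp_add _ _ _ _ _ _).symm)

end

/-! ### Realisation of the models -/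

namespace CyclicComplex

open Paracyclic FormalSums CategoryTheory.Prod

variable {R : Type u} [CommRing R] (E E' : CyclicComplex R)

/-- The tensor product of the complexes which are attached to a pair of objects. -/
noncomputable def pairing : Paracyclic × Paracyclic ⥤ CochainComplex (ModuleCat.{u} R) ℤ where
  obj x := E.obj (toCyclic.obj x.1) ⊗ E'.obj (toCyclic.obj x.2)
  map f := E.map (toCyclic.map f.1) ⊗ₘ E'.map (toCyclic.map f.2)
  map_id x := by
    rw [prod_id_fst, prod_id_snd, toCyclic.map_id, toCyclic.map_id, E.map_id, E'.map_id,
      id_tensorHom_id]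
  map_comp f g := by
    rw [prod_comp_fst, prod_comp_snd, toCyclic.map_comp, toCyclic.map_comp, E.map_comp,
      E'.map_comp, ← tensorHom_comp_tensorHom]

/-- The realisation of formal sums. -/
noncomputable abbrev realize :
    FormalSums (Paracyclic × Paracyclic) ⥤ CochainComplex (ModuleCat.{u} R) ℤ :=
  FormalSums.lift (pairing E E')

/-- The two functors have the same objects by definition. A natural transformation with identity
components makes the naturality of `b` and of `connesB` available, instead of a rewriting along an
equality of functors. -/
noncomputable def var₁Realize (q : ℕ) :
    var₁ ⟨q⟩ ⋙ realize E E' ⟶ toCyclic ⋙ E ⋙ tensorRight (E'.obj ⟨q⟩) where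
  app X := 𝟙 (E.obj (toCyclic.obj X) ⊗ E'.obj ⟨q⟩)
  naturality X Y f := by
    refine (Category.comp_id _).trans (Eq.trans ?_ (Category.id_comp _).symm)
    refine (lift_map_single (X := ⟨_⟩) (Y := ⟨_⟩) (pairing E E') (f ×ₘ 𝟙 _)).trans ?_
    change E.map (toCyclic.map f) ⊗ₘ E'.map (toCyclic.map (𝟙 _)) = _
    rw [toCyclic.map_id, E'.map_id, tensorHom_id]
    rfl

noncomputable def var₂Realize (p : ℕ) :
    var₂ ⟨p⟩ ⋙ realize E E' ⟶ toCyclic ⋙ E' ⋙ tensorLeft (E.obj ⟨p⟩) where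
  app X := 𝟙 (E.obj ⟨p⟩ ⊗ E'.obj (toCyclic.obj X))
  naturality X Y f := by
    refine (Category.comp_id _).trans (Eq.trans ?_ (Category.id_comp _).symm)
    refine (lift_map_single (X := ⟨_⟩) (Y := ⟨_⟩) (pairing E E') (𝟙 _ ×ₘ f)).trans ?_
    change E.map (toCyclic.map (𝟙 _)) ⊗ₘ E'.map (toCyclic.map f) = _
    rw [toCyclic.map_id, E.map_id, id_tensorHom]
    rfl

noncomputable def diagRealize : diagVar ⋙ realize E E' ⟶ toCyclic ⋙ (E ⊗ E') where
  app X := 𝟙 (E.obj (toCyclic.obj X) ⊗ E'.obj (toCyclic.obj X))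
  naturality X Y f := by
    refine (Category.comp_id _).trans (Eq.trans ?_ (Category.id_comp _).symm)
    exact lift_map_single (X := ⟨_⟩) (Y := ⟨_⟩) (pairing E E') (f ×ₘ f)

variable (p q n : ℕ)

theorem realize_boundary₁ : (realize E E').map (boundary₁ p q) =
    (CyclicObject.b E p ▷ E'.obj ⟨q⟩ :) := by
  have h := ParacyclicObject.b_naturality (var₁Realize E E' q) p
  rw [ParacyclicObject.b_comp, b_var₁, ParacyclicObject.b_toCyclic, CyclicObject.b_comp] at h
  exact (Category.comp_id _).symm.trans (h.trans (Category.id_comp _))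

theorem realize_boundary₂ : (realize E E').map (boundary₂ p q) =
    (E.obj ⟨p⟩ ◁ CyclicObject.b E' q :) := by
  have h := ParacyclicObject.b_naturality (var₂Realize E E' p) q
  rw [ParacyclicObject.b_comp, b_var₂, ParacyclicObject.b_toCyclic, CyclicObject.b_comp] at h
  exact (Category.comp_id _).symm.trans (h.trans (Category.id_comp _))

theorem realize_diagBoundary :
    (realize E E').map (diagBoundary n) = (CyclicObject.b (E ⊗ E') n :) := by
  have h := ParacyclicObject.b_naturality (diagRealize E E') n
  rw [ParacyclicObject.b_comp, b_diagVar, ParacyclicObject.b_toCyclic] at h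
  exact (Category.comp_id _).symm.trans (h.trans (Category.id_comp _))

theorem realize_connes₁ : (realize E E').map (connes₁ p q) =
    (CyclicObject.connesB E p ▷ E'.obj ⟨q⟩ :) := by
  have h := ParacyclicObject.connesB_naturality (var₁Realize E E' q) p
  rw [ParacyclicObject.connesB_comp, ParacyclicObject.connesB_toCyclic,
    CyclicObject.connesB_comp] at h
  exact (Category.comp_id _).symm.trans (h.trans (Category.id_comp _))

/-- The functor E lives on the cyclic category, so the twist in `connes₂` disappears after
realisation. -/
theorem realize_deck₁ : (realize E E').map (deck₁ p q) = 𝟙 _ := by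
  refine (lift_map_single (X := ⟨_⟩) (Y := ⟨_⟩) (pairing E E') _).trans ?_
  change E.map (toCyclic.map (deck ⟨p⟩)) ⊗ₘ E'.map (toCyclic.map (𝟙 _)) = _
  rw [toCyclic_deck, toCyclic.map_id, E.map_id, E'.map_id, id_tensorHom_id]
  rfl

theorem realize_connes₂ : (realize E E').map (connes₂ p q) =
    (E.obj ⟨p⟩ ◁ CyclicObject.connesB E' q :) := by
  have h := ParacyclicObject.connesB_naturality (var₂Realize E E' p) q
  rw [ParacyclicObject.connesB_comp, ParacyclicObject.connesB_toCyclic,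
    CyclicObject.connesB_comp] at h
  rw [connes₂, Functor.map_comp, realize_deck₁]
  refine (Category.id_comp _).trans ?_
  exact (Category.comp_id _).symm.trans (h.trans (Category.id_comp _))

theorem realize_diagConnes :
    (realize E E').map (diagConnes n) = (CyclicObject.connesB (E ⊗ E') n :) := by
  have h := ParacyclicObject.connesB_naturality (diagRealize E E') n
  rw [ParacyclicObject.connesB_comp, ParacyclicObject.connesB_toCyclic] at h
  exact (Category.comp_id _).symm.trans (h.trans (Category.id_comp _))

theorem realize_frontBack (h : p + q = n) :
    (realize E E').map (Paracyclic.frontBack p q n h) = (frontBack E E' p q n h :) := by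
  refine (lift_map_single (X := ⟨_⟩) (Y := ⟨_⟩) (pairing E E') _).trans ?_
  change E.map (toCyclic.map (simplexMap _)) ⊗ₘ E'.map (toCyclic.map (simplexMap _)) = _
  rw [toCyclic_simplexMap, toCyclic_simplexMap]
  rfl

instance : Limits.HasFiniteBiproducts (CochainComplex (ModuleCat.{u} R) ℤ) :=
  Limits.HasFiniteBiproducts.of_hasFiniteProducts

/-- The realisation of matrices of formal sums. -/
noncomputable abbrev realizeMat : Models ⥤ CochainComplex (ModuleCat.{u} R) ℤ :=
  matRealize (realize E E')

/-- The bicomplex of the diagonal. -/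
noncomputable def diagBicomplex :
    HomologicalComplex₂ (ModuleCat.{u} R) (ComplexShape.down ℕ) (ComplexShape.up ℤ) :=
  ((realizeMat E E').mapHomologicalComplex _).obj diagComplex

/-- The bicomplex with the terms `⨁ E p ⊗ E' q`. -/
noncomputable def totalBicomplex :
    HomologicalComplex₂ (ModuleCat.{u} R) (ComplexShape.down ℕ) (ComplexShape.up ℤ) :=
  ((realizeMat E E').mapHomologicalComplex _).obj totalComplex

end CyclicComplex

/-! ### Homotopies on total complexes -/

/-- A homotopy between maps of cochain complexes, from its components of degree `-1`. -/
noncomputable def homotopyOfComponents {C : Type*} [Category* C] [Preadditive C]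
    {X Y : CochainComplex C ℤ} (f g : X ⟶ Y) (S : ∀ i j : ℤ, j + 1 = i → (X.X i ⟶ Y.X j))
    (h : ∀ i, f.f i = X.d i (i + 1) ≫ S (i + 1) i rfl +
      S i (i - 1) (by ring) ≫ Y.d (i - 1) i + g.f i) : Homotopy f g where
  hom i j := if hij : j + 1 = i then S i j hij else 0
  zero i j hij := dif_neg hij
  comm i := by
    rw [dNext_eq _ (show (ComplexShape.up ℤ).Rel i (i + 1) from rfl),
      prevD_eq _ (show (ComplexShape.up ℤ).Rel (i - 1) i by simp), h i, dif_pos rfl, dif_pos]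

namespace SimplicialTotal

variable {R : Type u} [CommRing R]
  {K L : HomologicalComplex₂ (ModuleCat.{u} R) (ComplexShape.down ℕ) (ComplexShape.up ℤ)}

/-- The map of total complexes which is induced by maps raising the simplicial degree by `k`. -/
noncomputable def raiseBy {r : ℕ → ℕ} (k : ℤ) (hr : ∀ p, (r p : ℤ) = p + k)
    (u : ∀ p, K.X p ⟶ L.X (r p)) (m n : ℤ) (h : n + k = m) :
    (K.total (ComplexShape.up ℤ)).X m ⟶ (L.total (ComplexShape.up ℤ)).X n :=
  K.totalDesc fun p a hpa => (u p).f a ≫ ι L (r p) a n (by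
    change a - (p : ℤ) = m at hpa
    rw [hr]
    omega)

theorem ι_raiseBy {r : ℕ → ℕ} (k : ℤ) (hr : ∀ p, (r p : ℤ) = p + k)
    (u : ∀ p, K.X p ⟶ L.X (r p)) (m n : ℤ) (h : n + k = m) (p : ℕ) (a : ℤ) (hpa : a - p = m) :
    ι K p a m hpa ≫ raiseBy k hr u m n h = (u p).f a ≫ ι L (r p) a n (by rw [hr]; omega) :=
  HomologicalComplex₂.ι_totalDesc _ _ _ _ _

theorem hom_ext {m : ℤ} {A : ModuleCat.{u} R} {f g : (K.total (ComplexShape.up ℤ)).X m ⟶ A}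
    (h : ∀ (p : ℕ) (a : ℤ) (hpa : a - p = m), ι K p a m hpa ≫ f = ι K p a m hpa ≫ g) : f = g :=
  HomologicalComplex₂.total.hom_ext (c₁₂ := ComplexShape.up ℤ) fun p a hpa => h p a hpa

/-- The internal differential carries the sign (-1) ^ p, which changes when the simplicial degree is
raised by one. The internal contributions therefore cancel in the sum, and the simplicial identity
remains. -/
theorem raiseBy_one_d (s : ∀ p, K.X p ⟶ L.X (p + 1)) (f : ∀ p, K.X p ⟶ L.X p)
    (h0 : s 0 ≫ L.d 1 0 = f 0)
    (hs : ∀ p, s (p + 1) ≫ L.d (p + 2) (p + 1) + K.d (p + 1) p ≫ s p = f (p + 1))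
    (m m' n : ℤ) (hm : m + 1 = m') (hn : n + 1 = m) :
    raiseBy 1 (fun p => Nat.cast_succ p) s m n hn ≫ (L.total (ComplexShape.up ℤ)).d n m +
      (K.total (ComplexShape.up ℤ)).d m m' ≫ raiseBy 1 (fun p => Nat.cast_succ p) s m' m hm =
      raiseBy 0 (fun p => (add_zero _).symm) f m m (add_zero m) := by
  refine hom_ext fun p a h => ?_
  rw [Preadditive.comp_add, ← Category.assoc, ι_raiseBy, ι_raiseBy, Category.assoc,
    ι_d_succ L p a n m (by push_cast; omega) (by omega), Preadditive.comp_add, ← Category.assoc]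
  cases p with
  | zero =>
    have h1 := congrArg (fun x => HomologicalComplex.Hom.f x a ≫ ι L 0 a m h) h0
    simp only [HomologicalComplex.comp_f, Category.assoc] at h1
    rw [← Category.assoc (ι K 0 a m h), ι_d_zero K a m m' h hm, ← h1]
    simp [ι_raiseBy]
  | succ p =>
    have h1 := congrArg (fun x => HomologicalComplex.Hom.f x a ≫ ι L (p + 1) a m h) (hs p)
    simp only [HomologicalComplex.comp_f, HomologicalComplex.add_f_apply,
      Preadditive.add_comp] at h1
    rw [← Category.assoc (ι K (p + 1) a m h), ι_d_succ K p a m m' h hm, ← h1]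
    simp only [Preadditive.add_comp, Preadditive.neg_comp, Linear.units_smul_comp, ι_raiseBy, Nat.cast_add, Nat.cast_one, Int.negOnePow_succ, Units.neg_smul,
      Linear.comp_units_smul, neg_neg, Preadditive.comp_neg, Category.assoc,
      HomologicalComplex.Hom.comm_assoc]
    abel

/-- Raising the simplicial degree by two preserves the sign of the internal differential, so here
the internal contributions cancel in a difference. This agrees with the sign of the homotopy between
maps of degree one. -/
theorem raiseBy_two_d (s : ∀ p, K.X p ⟶ L.X (p + 2)) (f : ∀ p, K.X p ⟶ L.X (p + 1))
    (h0 : s 0 ≫ L.d 2 1 = f 0)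
    (hs : ∀ p, s (p + 1) ≫ L.d (p + 3) (p + 2) - K.d (p + 1) p ≫ s p = f (p + 1))
    (m m' n n' : ℤ) (hm : m + 1 = m') (hn : n + 1 = n') (hn' : n' + 1 = m) :
    raiseBy 2 (fun p => Nat.cast_add p 2) s m n (by omega) ≫
        (L.total (ComplexShape.up ℤ)).d n n' -
      (K.total (ComplexShape.up ℤ)).d m m' ≫
        raiseBy 2 (fun p => Nat.cast_add p 2) s m' n' (by omega) =
      raiseBy 1 (fun p => Nat.cast_succ p) f m n' hn' := by
  refine hom_ext fun p a h => ?_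
  rw [Preadditive.comp_sub, ← Category.assoc, ι_raiseBy, ι_raiseBy, Category.assoc,
    ι_d_succ L (p + 1) a n n' (by push_cast; omega) (by omega), Preadditive.comp_add,
    ← Category.assoc]
  cases p with
  | zero =>
    have h1 := congrArg (fun x => HomologicalComplex.Hom.f x a ≫ ι L 1 a n' (by push_cast at h ⊢; omega)) h0
    simp only [HomologicalComplex.comp_f, Category.assoc] at h1
    rw [← Category.assoc (ι K 0 a m h), ι_d_zero K a m m' h hm, ← h1]
    simp [ι_raiseBy, show Int.negOnePow 2 = 1 from rfl]
  | succ p =>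
    have h1 := congrArg (fun x => HomologicalComplex.Hom.f x a ≫ ι L (p + 2) a n'
      (by push_cast at h ⊢; omega)) (hs p)
    simp only [HomologicalComplex.comp_f, HomologicalComplex.sub_f_apply,
      Preadditive.sub_comp] at h1
    rw [← Category.assoc (ι K (p + 1) a m h), ι_d_succ K p a m m' h hm, ← h1]
    simp only [Preadditive.add_comp, Preadditive.neg_comp, Linear.units_smul_comp, ι_raiseBy, Nat.cast_add, Nat.cast_one, Int.negOnePow_succ, Units.neg_smul,
      Linear.comp_units_smul, neg_neg, Preadditive.comp_neg, Category.assoc,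
      HomologicalComplex.Hom.comm_assoc]
    abel

theorem raiseBy_zero (f : K ⟶ L) (m : ℤ) :
    raiseBy 0 (fun p => (add_zero _).symm) f.f m m (add_zero m) =
      (HomologicalComplex₂.total.map f (ComplexShape.up ℤ)).f m :=
  hom_ext fun p a h => (ι_raiseBy _ _ _ _ _ _ _ _ _).trans (ι_map f p a m h).symm

/-- A homotopy in the simplicial direction induces a homotopy on total complexes. -/
noncomputable def totalHomotopy (f : K ⟶ L) (s : ∀ p, K.X p ⟶ L.X (p + 1))
    (h0 : s 0 ≫ L.d 1 0 = f.f 0)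
    (hs : ∀ p, s (p + 1) ≫ L.d (p + 2) (p + 1) + K.d (p + 1) p ≫ s p = f.f (p + 1)) :
    Homotopy (HomologicalComplex₂.total.map f (ComplexShape.up ℤ)) 0 :=
  homotopyOfComponents _ _ (fun i j hij => raiseBy 1 (fun p => Nat.cast_succ p) s i j hij) fun i => by
    rw [HomologicalComplex.zero_f, add_zero, add_comm, raiseBy_one_d s f.f h0 hs, raiseBy_zero]

end SimplicialTotal

/-! ### Tensor products of total complexes -/

namespace SimplicialTotal

variable {R : Type u} [CommRing R]
  {K L : HomologicalComplex₂ (ModuleCat.{u} R) (ComplexShape.down ℕ) (ComplexShape.up ℤ)}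

/-- A map from the tensor product of terms of total complexes, from its restrictions to the tensor
products of the summands. -/
noncomputable def tensorDesc {i j : ℤ} {A : ModuleCat.{u} R}
    (φ : ∀ (p : ℕ) (a : ℤ) (q : ℕ) (b : ℤ), a - p = i → b - q = j →
      ((K.X p).X a ⊗ (L.X q).X b ⟶ A)) :
    (K.total (ComplexShape.up ℤ)).X i ⊗ (L.total (ComplexShape.up ℤ)).X j ⟶ A :=
  -- Tensoring commutes with the direct sums in total complexes because it has a right adjoint. The
  -- braiding reduces the first variable to the second.
  MonoidalClosed.uncurry (L.totalDesc fun q b hb => MonoidalClosed.curry ((β_ _ _).hom ≫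
    MonoidalClosed.uncurry (K.totalDesc fun p a ha => MonoidalClosed.curry ((β_ _ _).hom ≫
      φ p a q b ha hb))))

theorem ι_tensorDesc {i j : ℤ} {A : ModuleCat.{u} R}
    (φ : ∀ (p : ℕ) (a : ℤ) (q : ℕ) (b : ℤ), a - p = i → b - q = j →
      ((K.X p).X a ⊗ (L.X q).X b ⟶ A)) (p : ℕ) (a : ℤ) (q : ℕ) (b : ℤ)
    (ha : a - p = i) (hb : b - q = j) :
    (ι K p a i ha ⊗ₘ ι L q b j hb) ≫ tensorDesc φ = φ p a q b ha hb := by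
  rw [MonoidalCategory.tensorHom_def, Category.assoc, tensorDesc, ← MonoidalClosed.uncurry_natural_left, ι,
    HomologicalComplex₂.ι_totalDesc, MonoidalClosed.uncurry_curry,
    BraidedCategory.braiding_naturality_left_assoc, ← MonoidalClosed.uncurry_natural_left,
    HomologicalComplex₂.ι_totalDesc, MonoidalClosed.uncurry_curry, SymmetricCategory.symmetry_assoc]

/-- By adjunction, joint epimorphy of the inclusions of summands is used in one variable at a time.
-/
theorem tensor_total_hom_ext {i j : ℤ} {A : ModuleCat.{u} R}
    {f g : (K.total (ComplexShape.up ℤ)).X i ⊗ (L.total (ComplexShape.up ℤ)).X j ⟶ A}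
    (h : ∀ (p : ℕ) (a : ℤ) (q : ℕ) (b : ℤ) (ha : a - p = i) (hb : b - q = j),
      (ι K p a i ha ⊗ₘ ι L q b j hb) ≫ f = (ι K p a i ha ⊗ₘ ι L q b j hb) ≫ g) : f = g := by
  refine MonoidalClosed.curry_injective (hom_ext fun q b hb => ?_)
  rw [← MonoidalClosed.curry_natural_left, ← MonoidalClosed.curry_natural_left]
  congr 1
  rw [← cancel_epi (β_ _ _).hom]
  refine MonoidalClosed.curry_injective (hom_ext fun p a ha => ?_)
  rw [← MonoidalClosed.curry_natural_left, ← MonoidalClosed.curry_natural_left,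
    BraidedCategory.braiding_naturality_right_assoc,
    BraidedCategory.braiding_naturality_right_assoc, ← Category.assoc (_ ▷ _), ← MonoidalCategory.tensorHom_def,
    ← Category.assoc (_ ▷ _), ← MonoidalCategory.tensorHom_def, h]

variable {W : HomologicalComplex₂ (ModuleCat.{u} R) (ComplexShape.down ℕ) (ComplexShape.up ℤ)}
  (π : ∀ p q n : ℕ, p + q = n → (W.X n ⟶ K.X p ⊗ L.X q))
  (j : ∀ p q n : ℕ, p + q = n → (K.X p ⊗ L.X q ⟶ W.X n))

/-- The restriction of `glueComponents` to the tensor product of two summands. -/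
noncomputable def glueTerm (m k l : ℤ) (hkl : k + l = m) (p : ℕ) (a : ℤ) (q : ℕ) (b : ℤ)
    (ha : a - p = k) (hb : b - q = l) :
    (K.X p).X a ⊗ (L.X q).X b ⟶ (W.total (ComplexShape.up ℤ)).X m :=
  -- The same sign as in `columns`; it is its own inverse.
  (a * q).negOnePow • (ιTensor (K.X p) (L.X q) a b (a + b) rfl ≫ (j p q (p + q) rfl).f (a + b) ≫
    ι W (p + q) (a + b) m (by push_cast; omega))

/-- The inverse of `sumComponents`. -/
noncomputable def glueComponents (m : ℤ) :
    (K.total (ComplexShape.up ℤ) ⊗ L.total (ComplexShape.up ℤ)).X m ⟶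
      (W.total (ComplexShape.up ℤ)).X m :=
  HomologicalComplex.mapBifunctorDesc fun k l hkl => tensorDesc (glueTerm j m k l hkl)

theorem ι_glueComponents (m k l : ℤ) (hkl : k + l = m) (p : ℕ) (a : ℤ) (q : ℕ) (b : ℤ)
    (ha : a - p = k) (hb : b - q = l) (c : ℤ) (hc : a + b = c) (n : ℕ) (hn : p + q = n) :
    (ι K p a k ha ⊗ₘ ι L q b l hb) ≫ ιTensor _ _ k l m hkl ≫ glueComponents j m =
      (a * q).negOnePow • (ιTensor (K.X p) (L.X q) a b c hc ≫ (j p q n hn).f c ≫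
        ι W n c m (by subst hn; push_cast; omega)) := by
  subst hc hn
  refine Eq.trans ?_ (ι_tensorDesc (glueTerm j m k l hkl) p a q b ha hb)
  congr 1
  exact HomologicalComplex.ι_mapBifunctorDesc _ _ _ _

theorem units_smul_units_smul {A : Type*} [AddCommGroup A] (e : ℤˣ) (x : A) : e • e • x = x := by
  rw [smul_smul, Int.units_mul_self, one_smul]

theorem columns_glueComponents (p q n : ℕ) (hn : p + q = n) (c m : ℤ) (h : c - n = m) :
    columns K L p q c m (by omega) ≫ glueComponents j m = (j p q n hn).f c ≫ ι W n c m h := by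
  refine tensor_hom_ext _ _ fun a b hab => ?_
  rw [← Category.assoc, ι_columns K L p q c m (by omega) a b hab _ _ rfl rfl,
    Linear.units_smul_comp, Category.assoc,
    ι_glueComponents j m _ _ _ p a q b rfl rfl c hab n hn, units_smul_units_smul]

theorem component_glueComponents (n : ℕ) (c m : ℤ) (h : c - n = m) (p q : ℕ) (hx : p + q = n) :
    component π n c m h (p, q) ≫ glueComponents j m = (π p q n hx ≫ j p q n hx).f c ≫ ι W n c m h := by
  rw [component_of _ _ _ _ _ _ _ hx, Category.assoc, columns_glueComponents j p q n hx c m h,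
    HomologicalComplex.comp_f, Category.assoc]

theorem sumComponents_glueComponents
    (hj : ∀ n, ∑ x : Finset.HasAntidiagonal.antidiagonal n,
      (π x.1.1 x.1.2 n (Finset.HasAntidiagonal.mem_antidiagonal.1 x.2) ≫
        j x.1.1 x.1.2 n (Finset.HasAntidiagonal.mem_antidiagonal.1 x.2)) = 𝟙 (W.X n)) (m : ℤ) :
    sumComponents π m ≫ glueComponents j m = 𝟙 _ := by
  refine hom_ext fun n c h => ?_
  rw [← Category.assoc, ι_sumComponents, Preadditive.sum_comp, ← Finset.sum_coe_sort,
    Finset.sum_congr rfl fun x _ => component_glueComponents π j n c m h x.1.1 x.1.2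
      (Finset.HasAntidiagonal.mem_antidiagonal.1 x.2), ← Preadditive.sum_comp, Category.comp_id]
  have := congrArg (fun f => HomologicalComplex.Hom.f f c ≫ ι W n c m h) (hj n)
  simp only [HomologicalComplex.id_f, Category.id_comp] at this
  exact (congrArg (· ≫ ι W n c m h) ((HomologicalComplex.eval _ _ c).map_sum _ _).symm).trans this

theorem glueComponents_sumComponents
    (h1 : ∀ p q n (h : p + q = n), j p q n h ≫ π p q n h = 𝟙 _)
    (h0 : ∀ p q p' q' n (h : p + q = n) (h' : p' + q' = n), p' ≠ p →
      j p q n h ≫ π p' q' n h' = 0) (m : ℤ) :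
    glueComponents j m ≫ sumComponents π m = 𝟙 _ := by
  refine tensor_hom_ext _ _ fun k l hkl => tensor_total_hom_ext fun p a q b ha hb => ?_
  have e := ι_glueComponents j m k l hkl p a q b ha hb _ rfl _ rfl
  have e2 : (j p q (p + q) rfl).f (a + b) ≫ ι W (p + q) (a + b) m (by push_cast; omega) ≫
      sumComponents π m = columns K L p q (a + b) m (by omega) := by
    rw [ι_sumComponents, Preadditive.comp_sum, Finset.sum_eq_single (p, q)]
    · rw [component_of _ _ _ _ _ _ _ rfl, ← Category.assoc, ← HomologicalComplex.comp_f, h1,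
        HomologicalComplex.id_f, Category.id_comp]
    · rintro ⟨p', q'⟩ hx hne
      have hx' : p' + q' = p + q := Finset.HasAntidiagonal.mem_antidiagonal.1 hx
      rw [component_of _ _ _ _ _ _ _ hx', ← Category.assoc, ← HomologicalComplex.comp_f, h0,
        HomologicalComplex.zero_f, Limits.zero_comp]
      rintro rfl
      exact hne (by congr 1; omega)
    · intro hx
      exact absurd ((Finset.HasAntidiagonal.mem_antidiagonal (a := (p, q))).2 rfl) hx
  have e' := congrArg (· ≫ sumComponents π m) e
  simp only [Category.assoc, Linear.units_smul_comp] at e'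
  rw [e', e2, ι_columns K L p q _ m (by omega) a b rfl _ _ ha hb, units_smul_units_smul,
    Category.comp_id]

end SimplicialTotal

/-! ### The comparison with the tensor product of Hochschild complexes -/

namespace CyclicComplex

open Paracyclic FormalSums CategoryTheory.Prod

variable {R : Type u} [CommRing R] (E E' : CyclicComplex R)

/-- The projection on the summand of bidegree `(p, q)`. -/
noncomputable def bidegreeπ (p q n : ℕ) (h : p + q = n) :
    (totalBicomplex E E').X n ⟶ (hochschildBicomplex.obj E).X p ⊗ (hochschildBicomplex.obj E').X q :=
  Limits.biproduct.π (fun i => (realize E E').obj ((totalObj n).X i)) (idx p q h)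

/-- The inclusion of the summand of bidegree `(p, q)`. -/
noncomputable def bidegreeι (p q n : ℕ) (h : p + q = n) :
    (hochschildBicomplex.obj E).X p ⊗ (hochschildBicomplex.obj E').X q ⟶ (totalBicomplex E E').X n :=
  Limits.biproduct.ι (fun i => (realize E E').obj ((totalObj n).X i)) (idx p q h)

theorem bidegreeι_π (p q n : ℕ) (h : p + q = n) :
    bidegreeι E E' p q n h ≫ bidegreeπ E E' p q n h = 𝟙 _ :=
  Limits.biproduct.ι_π_self _ _

theorem bidegreeι_π_ne (p q p' q' n : ℕ) (h : p + q = n) (h' : p' + q' = n) (hp : p' ≠ p) :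
    bidegreeι E E' p q n h ≫ bidegreeπ E E' p' q' n h' = 0 :=
  Limits.biproduct.ι_π_ne _ fun e => hp (congrArg (fun x => x.1.1) e).symm

theorem sum_bidegreeπ_ι (n : ℕ) : ∑ x : Finset.HasAntidiagonal.antidiagonal n,
      (bidegreeπ E E' x.1.1 x.1.2 n (Finset.HasAntidiagonal.mem_antidiagonal.1 x.2) ≫
        bidegreeι E E' x.1.1 x.1.2 n (Finset.HasAntidiagonal.mem_antidiagonal.1 x.2)) =
      𝟙 ((totalBicomplex E E').X n) :=
  Limits.biproduct.total

theorem totalBicomplex_d (n : ℕ) : (totalBicomplex E E').d (n + 1) n =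
    (realizeMat E E').map (totalBoundary n) :=
  congrArg (realizeMat E E').map (totalComplex_d n)

theorem diagBicomplex_d (n : ℕ) : (diagBicomplex E E').d (n + 1) n =
    (realizeMat E E').map ((Mat_.embedding _).map (diagBoundary n)) :=
  congrArg (realizeMat E E').map (diagComplex_d n)

theorem realizeMat_entry {M N : Models} (f : M ⟶ N) (i : M.ι) (k : N.ι) :
    (Limits.biproduct.ι (fun i => (realize E E').obj (M.X i)) i ≫ (realizeMat E E').map f) ≫
      Limits.biproduct.π (fun i => (realize E E').obj (N.X i)) k = (realize E E').map (f i k) :=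
  biproduct_entry (fun i k => (realize E E').map (f i k)) i k

end CyclicComplex

/-! ### The Alexander–Whitney map as a quasi-isomorphism -/

namespace CyclicComplex

open Paracyclic FormalSums CategoryTheory.Prod

variable {R : Type u} [CommRing R] (E E' : CyclicComplex R)

/-- The terms of the diagonal bicomplex are biproducts over a point. -/
noncomputable def diagUnit (n : ℕ) :
    (hochschildBicomplex.obj (E ⊗ E')).X n ⟶ (diagBicomplex E E').X n :=
  Limits.biproduct.ι (fun i => (realize E E').obj ((diagObj n).X i)) PUnit.unit

/-- The inverse of `diagUnit`. -/
noncomputable def diagCounit (n : ℕ) :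
    (diagBicomplex E E').X n ⟶ (hochschildBicomplex.obj (E ⊗ E')).X n :=
  Limits.biproduct.π (fun i => (realize E E').obj ((diagObj n).X i)) PUnit.unit

theorem diagUnit_counit (n : ℕ) : diagUnit E E' n ≫ diagCounit E E' n = 𝟙 _ :=
  Limits.biproduct.ι_π_self _ _

theorem diagCounit_unit (n : ℕ) : diagCounit E E' n ≫ diagUnit E E' n = 𝟙 _ :=
  (Fintype.sum_unique (ι := PUnit) (fun i =>
    Limits.biproduct.π (fun i : (diagObj n).ι => (realize E E').obj ((diagObj n).X i)) i ≫
      Limits.biproduct.ι (fun i : (diagObj n).ι => (realize E E').obj ((diagObj n).X i)) i)).symm.trans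
    (Limits.biproduct.total (f := fun i : (diagObj n).ι => (realize E E').obj ((diagObj n).X i)))

theorem diagUnit_entry (n : ℕ) {N : Models} (f : diagObj n ⟶ N) (k : N.ι) :
    (diagUnit E E' n ≫ (realizeMat E E').map f) ≫
      Limits.biproduct.π (fun i => (realize E E').obj (N.X i)) k =
        (realize E E').map (f PUnit.unit k) :=
  realizeMat_entry E E' f PUnit.unit k

theorem eq_comp_of_comp_eq {C : Type*} [Category* C] {X Y Z : C} {π : Y ⟶ Z} {ι : Z ⟶ Y}
    (h : π ≫ ι = 𝟙 Y) {f : X ⟶ Y} {g : X ⟶ Z} (e : f ≫ π = g) : f = g ≫ ι := by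
  rw [← e, Category.assoc, h, Category.comp_id]

theorem comp_add_zsmul {C : Type*} [Category* C] [Preadditive C] {X Y Z Z' A : C} (u : X ⟶ Y)
    (v : Y ⟶ Z) (a : Z ⟶ A) (w : Y ⟶ Z') (b : Z' ⟶ A) (z : ℤ) :
    u ≫ (v ≫ a + z • (w ≫ b)) = (u ≫ v) ≫ a + z • ((u ≫ w) ≫ b) := by
  rw [Preadditive.comp_add, Preadditive.comp_zsmul, Category.assoc, Category.assoc]

theorem diagUnit_comm (n : ℕ) : diagUnit E E' (n + 1) ≫ (diagBicomplex E E').d (n + 1) n =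
    (hochschildBicomplex.obj (E ⊗ E')).d (n + 1) n ≫ diagUnit E E' n := by
  refine eq_comp_of_comp_eq (diagCounit_unit E E' n) ?_
  rw [diagBicomplex_d, hochschildBicomplex_d]
  refine (diagUnit_entry E E' (n + 1) ((Mat_.embedding _).map (diagBoundary n)) _).trans ?_
  exact realize_diagBoundary E E' n

/-- The bicomplex of the diagonal is isomorphic to the bicomplex of the tensor product. -/
noncomputable def diagIso : hochschildBicomplex.obj (E ⊗ E') ≅ diagBicomplex E E' :=
  HomologicalComplex.Hom.isoOfComponents
    (fun n => ⟨diagUnit E E' n, diagCounit E E' n, diagUnit_counit E E' n, diagCounit_unit E E' n⟩)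
    fun i j hij => by
      obtain rfl : j + 1 = i := hij
      exact diagUnit_comm E E' j

/-- The Alexander–Whitney map of bicomplexes. -/
noncomputable def awBicomplex : diagBicomplex E E' ⟶ totalBicomplex E E' :=
  ((realizeMat E E').mapHomologicalComplex _).map aw

theorem diagUnit_aw (p q n : ℕ) (h : p + q = n) :
    (diagUnit E E' n ≫ (awBicomplex E E').f n) ≫ bidegreeπ E E' p q n h =
      frontBack E E' p q n h :=
  (diagUnit_entry E E' n (awMap n) (idx p q h)).trans (realize_frontBack E E' p q n h)

/-- The formula for the entries of the total boundary, for the identity matrix and after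
realisation. In this form the projections define a map to the tensor product of total complexes by
`sumComponents_d`. -/
theorem total_d_bidegreeπ (p q n : ℕ) (h : p + q = n) :
    (totalBicomplex E E').d (n + 1) n ≫ bidegreeπ E E' p q n h =
      bidegreeπ E E' (p + 1) q (n + 1) (by omega) ≫
        ((hochschildBicomplex.obj E).d (p + 1) p ▷ (hochschildBicomplex.obj E').X q) +
      (-1 : ℤ) ^ p • (bidegreeπ E E' p (q + 1) (n + 1) (by omega) ≫
        ((hochschildBicomplex.obj E).X p ◁ (hochschildBicomplex.obj E').d (q + 1) q)) := by
  rw [totalBicomplex_d, hochschildBicomplex_d, hochschildBicomplex_d]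
  refine Limits.biproduct.hom_ext' _ _ fun x => ?_
  have e : ∀ p' q' (h' : p' + q' = n + 1),
      (realize E E').map ((𝟙 (totalObj (n + 1))) x (idx p' q' h')) =
      Limits.biproduct.ι (fun i => (realize E E').obj ((totalObj (n + 1)).X i)) x ≫
        bidegreeπ E E' p' q' (n + 1) h' := by
    intro p' q' h'
    refine (realizeMat_entry E E' (𝟙 (totalObj (n + 1))) x (idx p' q' h')).symm.trans ?_
    rw [(realizeMat E E').map_id]
    exact congrArg (· ≫ _) (Category.comp_id _)
  refine (Category.assoc _ _ _).symm.trans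
    ((realizeMat_entry E E' (totalBoundary n) x (idx p q h)).trans ?_)
  have e1 := congrArg (realize E E').map (comp_totalBoundary (𝟙 (totalObj (n + 1))) x p q h)
  rw [Category.id_comp, Functor.map_add, Functor.map_zsmul, Functor.map_comp, Functor.map_comp,
    realize_boundary₁, realize_boundary₂] at e1
  refine e1.trans ?_
  rw [e, e]
  exact (comp_add_zsmul _ _ _ _ _ _).symm

/-- The total complex of `⨁ E p ⊗ E' q` is the tensor product of the Hochschild complexes. -/
noncomputable def totalIso :
    (totalBicomplex E E').total (ComplexShape.up ℤ) ≅ CH.obj E ⊗ CH.obj E' :=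
  HomologicalComplex.Hom.isoOfComponents
    (fun m => ⟨SimplicialTotal.sumComponents (bidegreeπ E E') m,
      SimplicialTotal.glueComponents (bidegreeι E E') m,
      SimplicialTotal.sumComponents_glueComponents _ _ (sum_bidegreeπ_ι E E') m,
      SimplicialTotal.glueComponents_sumComponents _ _ (bidegreeι_π E E')
        (bidegreeι_π_ne E E') m⟩)
    fun m m' hm => SimplicialTotal.sumComponents_d _ (total_d_bidegreeπ E E') m m' hm

/-- The map of the statement is the realised map of the models between two isomorphisms, so that
what is known for the models applies to it. -/
theorem alexanderWhitney_eq : alexanderWhitney E E' =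
    HomologicalComplex₂.total.map ((diagIso E E').hom ≫ awBicomplex E E') (ComplexShape.up ℤ) ≫
      (totalIso E E').hom := by
  refine HomologicalComplex.hom_ext _ _ fun m => SimplicialTotal.hom_ext fun n c h => ?_
  rw [HomologicalComplex.comp_f, ← Category.assoc, SimplicialTotal.ι_map, Category.assoc]
  refine (SimplicialTotal.ι_sumComponents _ _ _ _ _).trans ?_
  refine Eq.trans ?_ (congrArg (_ ≫ ·) (SimplicialTotal.ι_sumComponents _ _ _ _ _).symm)
  rw [Preadditive.comp_sum]
  refine Finset.sum_congr rfl fun x hx => ?_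
  obtain ⟨p, q⟩ := x
  have hx' : p + q = n := Finset.HasAntidiagonal.mem_antidiagonal.1 hx
  refine (SimplicialTotal.component_of _ n c m h p q hx').trans (Eq.trans ?_
    (congrArg (_ ≫ ·) (SimplicialTotal.component_of _ n c m h p q hx').symm))
  refine Eq.trans ?_ (Category.assoc _ _ _)
  refine congrArg (· ≫ SimplicialTotal.columns _ _ p q c m _) ?_
  exact congrArg (fun f => HomologicalComplex.Hom.f f c) (diagUnit_aw E E' p q n hx').symm

theorem total_map_comp_sub_id {K L : HomologicalComplex₂ (ModuleCat.{u} R) (ComplexShape.down ℕ)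
    (ComplexShape.up ℤ)} (f : K ⟶ L) (g : L ⟶ K) :
    HomologicalComplex₂.total.map (f ≫ g - 𝟙 K) (ComplexShape.up ℤ) =
      HomologicalComplex₂.total.map f (ComplexShape.up ℤ) ≫
        HomologicalComplex₂.total.map g (ComplexShape.up ℤ) - 𝟙 _ := by
  refine HomologicalComplex.hom_ext _ _ fun m => SimplicialTotal.hom_ext fun p a h => ?_
  rw [SimplicialTotal.ι_map, ← HomologicalComplex₂.total.map_comp, HomologicalComplex.sub_f_apply,
    HomologicalComplex.sub_f_apply, HomologicalComplex.sub_f_apply,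
    Preadditive.comp_sub, SimplicialTotal.ι_map]
  refine Eq.trans ?_ (congrArg (_ - ·) (Category.comp_id _).symm)
  rw [Preadditive.sub_comp]
  exact congrArg (_ - ·) (Category.id_comp (SimplicialTotal.ι K p a m h))

/-- An additive functor preserves the simplicial homotopies of `exists_shuffle`, and these induce
homotopies of total complexes. The equivalence already holds for the underived tensor product. -/
theorem exists_total_homotopyEquiv :
    ∃ e : HomotopyEquiv ((diagBicomplex E E').total (ComplexShape.up ℤ))
      ((totalBicomplex E E').total (ComplexShape.up ℤ)),
      e.hom = HomologicalComplex₂.total.map (awBicomplex E E') (ComplexShape.up ℤ) := by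
  obtain ⟨sh, s, s', ⟨h0, h⟩, h0', h'⟩ := exists_shuffle
  let Φ := (realizeMat E E').mapHomologicalComplex (ComplexShape.down ℕ)
  have H1 := SimplicialTotal.totalHomotopy (Φ.map (aw ≫ sh - 𝟙 _))
    (fun n => (realizeMat E E').map (s n))
    (((realizeMat E E').map_comp _ _).symm.trans (congrArg _ h0))
    (fun n => by
      refine Eq.trans ?_ (congrArg (realizeMat E E').map (h n))
      rw [Functor.map_add, Functor.map_comp, Functor.map_comp]
      rfl)
  have H2 := SimplicialTotal.totalHomotopy (Φ.map (sh ≫ aw - 𝟙 _))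
    (fun n => (realizeMat E E').map (s' n))
    (((realizeMat E E').map_comp _ _).symm.trans (congrArg _ h0'))
    (fun n => by
      refine Eq.trans ?_ (congrArg (realizeMat E E').map (h' n))
      rw [Functor.map_add, Functor.map_comp, Functor.map_comp]
      rfl)
  rw [Φ.map_sub, Φ.map_comp, Φ.map_id] at H1 H2
  erw [total_map_comp_sub_id] at H1 H2
  exact ⟨⟨_, HomologicalComplex₂.total.map (Φ.map sh) (ComplexShape.up ℤ),
    (Homotopy.equivSubZero).symm H1, (Homotopy.equivSubZero).symm H2⟩, rfl⟩

/-- The Alexander–Whitney map is a quasi-isomorphism. -/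
instance quasiIso_alexanderWhitney : QuasiIso (alexanderWhitney E E') := by
  obtain ⟨e, he⟩ := exists_total_homotopyEquiv E E'
  have : QuasiIso (HomologicalComplex₂.total.map (awBicomplex E E') (ComplexShape.up ℤ)) := by
    rw [← he]
    infer_instance
  have h : IsIso (HomologicalComplex₂.total.map (diagIso E E').hom (ComplexShape.up ℤ)) :=
    inferInstanceAs (IsIso ((HomologicalComplex₂.totalFunctor _ _ _ _).map (diagIso E E').hom))
  have h1 : QuasiIso (HomologicalComplex₂.total.map (diagIso E E').hom (ComplexShape.up ℤ)) :=
    inferInstance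
  have h2 : QuasiIso (totalIso E E').hom := inferInstance
  rw [alexanderWhitney_eq, HomologicalComplex₂.total.map_comp]
  have h3 := quasiIso_comp (HomologicalComplex₂.total.map (diagIso E E').hom (ComplexShape.up ℤ))
    (HomologicalComplex₂.total.map (awBicomplex E E') (ComplexShape.up ℤ))
  exact quasiIso_comp (hφ := h3) _ (totalIso E E').hom

end CyclicComplex

/-! ### Maps of degree minus one on tensor products, in components -/

section

variable {R : Type u} [CommRing R]

/-- The components of a morphism to a shifted complex, as maps of degree `-1`. -/
def unshift {X Y : CochainComplex (ModuleCat.{u} R) ℤ} (f : X ⟶ Y⟦(-1 : ℤ)⟧) (m : ℤ) :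
    X.X m ⟶ Y.X (m + -1) := f.f m

theorem ιTensor_tensorShiftLeft {X Y : CochainComplex (ModuleCat.{u} R) ℤ} (f : X ⟶ X⟦(-1 : ℤ)⟧)
    (i j m : ℤ) (h : i + j = m) :
    ιTensor X Y i j m h ≫ unshift (tensorShiftLeft f Y) m =
      (unshift f i ⊗ₘ 𝟙 (Y.X j)) ≫
        ιTensor X Y (i + -1) j (m + -1) (by omega) := by
  have e := CochainComplex.ι_mapBifunctorShift₁Iso_hom_f X Y (curriedTensor (ModuleCat.{u} R)) (-1)
    i j m h (i + -1) (m + -1) rfl rfl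
  simp only [CochainComplex.shiftFunctorObjXIso, HomologicalComplex.XIsoOfEq_rfl, Iso.refl_hom,
    Iso.refl_inv] at e
  have w : ιTensor X Y i j m h ≫ (f ▷ Y).f m = (f.f i ⊗ₘ 𝟙 (Y.X j)) ≫ ιTensor _ Y i j m h := by
    rw [← tensorHom_id, ιTensor_map, HomologicalComplex.id_f]
  refine (Category.assoc _ _ _).symm.trans ((congrArg (· ≫ HomologicalComplex.Hom.f _ m) w).trans
    ((Category.assoc _ _ _).trans ?_))
  refine congrArg (_ ≫ ·) (e.trans ?_)
  refine (congrArg (· ≫ _) ?_).trans ((Category.id_comp _).trans (Category.comp_id _))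
  exact id_whiskerRight _ _

/-- The Koszul sign comes from the isomorphism X ⊗ Y[-1] ≅ (X ⊗ Y)[-1], which on the summand of
bidegree (i, j) carries the sign (-1) ^ (i · (-1)). -/
theorem ιTensor_tensorShiftRight {X Y : CochainComplex (ModuleCat.{u} R) ℤ} (g : Y ⟶ Y⟦(-1 : ℤ)⟧)
    (i j m : ℤ) (h : i + j = m) :
    ιTensor X Y i j m h ≫ unshift (tensorShiftRight X g) m =
      i.negOnePow • ((𝟙 (X.X i) ⊗ₘ unshift g j) ≫
        ιTensor X Y i (j + -1) (m + -1) (by omega)) := by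
  have e := CochainComplex.ι_mapBifunctorShift₂Iso_hom_f X Y (curriedTensor (ModuleCat.{u} R)) (-1)
    i j m h (j + -1) (m + -1) rfl rfl
  simp only [CochainComplex.shiftFunctorObjXIso, HomologicalComplex.XIsoOfEq_rfl, Iso.refl_hom,
    Iso.refl_inv, mul_neg_one, Int.negOnePow_neg] at e
  have w : ιTensor X Y i j m h ≫ (X ◁ g).f m = (𝟙 (X.X i) ⊗ₘ g.f j) ≫ ιTensor X _ i j m h := by
    rw [← id_tensorHom, ιTensor_map, HomologicalComplex.id_f]
  refine (Category.assoc _ _ _).symm.trans ((congrArg (· ≫ HomologicalComplex.Hom.f _ m) w).trans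
    ((Category.assoc _ _ _).trans ?_))
  refine (congrArg (_ ≫ ·) (e.trans (congrArg (i.negOnePow • ·) ?_))).trans
    (Linear.comp_units_smul _ _ _)
  refine (congrArg (· ≫ _) ?_).trans ((Category.id_comp _).trans (Category.comp_id _))
  exact whiskerLeft_id _ _

namespace SimplicialTotal

variable {K L : HomologicalComplex₂ (ModuleCat.{u} R) (ComplexShape.down ℕ) (ComplexShape.up ℤ)}

theorem ι_shiftMap (β : ∀ p, K.X p ⟶ K.X (p + 1)) (h0 : β 0 ≫ K.d 1 0 = 0)
    (hs : ∀ p, β (p + 1) ≫ K.d (p + 2) (p + 1) = -(K.d (p + 1) p ≫ β p)) (p : ℕ) (a m : ℤ)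
    (h : a - p = m) :
    ι K p a m h ≫ unshift (shiftMap K β h0 hs) m =
      (β p).f a ≫ ι K (p + 1) a (m + -1) (by push_cast; omega) :=
  ι_raise K β m (m + -1) (by ring) p a h

/-- No sign appears, since neither the internal degree of the first factor nor the simplicial degree
of the second one changes. -/
theorem columns_tensorShiftLeft (β : ∀ p, K.X p ⟶ K.X (p + 1)) (h0 : β 0 ≫ K.d 1 0 = 0)
    (hs : ∀ p, β (p + 1) ≫ K.d (p + 2) (p + 1) = -(K.d (p + 1) p ≫ β p)) (p q : ℕ) (c m : ℤ)
    (h : c - p - q = m) :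
    columns K L p q c m h ≫ unshift (tensorShiftLeft (shiftMap K β h0 hs) _) m =
      (β p ▷ L.X q).f c ≫ columns K L (p + 1) q c (m + -1) (by push_cast; omega) := by
  refine tensor_hom_ext _ _ fun a b hab => ?_
  rw [← Category.assoc, ι_columns K L p q c m h a b hab _ _ rfl rfl, Linear.units_smul_comp,
    Category.assoc, ιTensor_tensorShiftLeft, ← Category.assoc (_ ⊗ₘ _), MonoidalCategory.tensorHom_comp_tensorHom,
    ι_shiftMap, Category.comp_id, ← Category.assoc (ιTensor _ _ _ _ _ _), ← tensorHom_id,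
    ιTensor_map, Category.assoc,
    ι_columns K L (p + 1) q c _ (by push_cast; omega) a b hab (a - p + -1) (b - q)
      (by push_cast; ring) rfl,
    Linear.comp_units_smul, ← Category.assoc (_ ⊗ₘ _), MonoidalCategory.tensorHom_comp_tensorHom,
    HomologicalComplex.id_f, Category.id_comp]

/-- The Koszul sign (-1) ^ (a - p) and the change from a q to a (q + 1) in the sign of `columns`
combine to (-1) ^ p, the sign in `totalConnes`. -/
theorem columns_tensorShiftRight (β : ∀ p, L.X p ⟶ L.X (p + 1)) (h0 : β 0 ≫ L.d 1 0 = 0)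
    (hs : ∀ p, β (p + 1) ≫ L.d (p + 2) (p + 1) = -(L.d (p + 1) p ≫ β p)) (p q : ℕ) (c m : ℤ)
    (h : c - p - q = m) :
    columns K L p q c m h ≫ unshift (tensorShiftRight _ (shiftMap L β h0 hs)) m =
      (p : ℤ).negOnePow •
        ((K.X p ◁ β q).f c ≫ columns K L p (q + 1) c (m + -1) (by push_cast; omega)) := by
  refine tensor_hom_ext _ _ fun a b hab => ?_
  rw [← Category.assoc, ι_columns K L p q c m h a b hab _ _ rfl rfl, Linear.units_smul_comp,
    Category.assoc, ιTensor_tensorShiftRight, Linear.comp_units_smul, ← Category.assoc (_ ⊗ₘ _),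
    MonoidalCategory.tensorHom_comp_tensorHom, ι_shiftMap, Category.comp_id, Linear.comp_units_smul,
    ← Category.assoc (ιTensor _ _ _ _ _ _), ← id_tensorHom, ιTensor_map, Category.assoc,
    ι_columns K L p (q + 1) c _ (by push_cast; omega) a b hab (a - p) (b - q + -1)
      rfl (by push_cast; ring),
    Linear.comp_units_smul, ← Category.assoc (_ ⊗ₘ _), MonoidalCategory.tensorHom_comp_tensorHom,
    HomologicalComplex.id_f, Category.id_comp, smul_smul, smul_smul, ← Int.negOnePow_add,
    ← Int.negOnePow_add]
  congr 1
  rw [Int.negOnePow_eq_iff]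
  exact ⟨-p, by push_cast; ring⟩

end SimplicialTotal

end

namespace CyclicComplex

open Paracyclic FormalSums CategoryTheory.Prod

variable {R : Type u} [CommRing R] (E E' : CyclicComplex R)

/-- The realisation of a row of a matrix. -/
theorem realize_raise₁_succ {X : FormalSums (Paracyclic × Paracyclic)} (v : ∀ p q, X ⟶ bi p q)
    (p q : ℕ) : (realize E E').map (raise₁ v (p + 1) q) =
      (realize E E').map (v p q) ≫ (CyclicObject.connesB E p ▷ E'.obj ⟨q⟩) := by
  rw [raise₁, Functor.map_comp, realize_connes₁]
  rfl

theorem realize_raise₂_succ {X : FormalSums (Paracyclic × Paracyclic)} (v : ∀ p q, X ⟶ bi p q)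
    (p q : ℕ) : (realize E E').map (raise₂ v p (q + 1)) =
      (realize E E').map (v p q) ≫ (E.obj ⟨p⟩ ◁ CyclicObject.connesB E' q) := by
  cases p <;> rw [raise₂, Functor.map_comp, realize_connes₂] <;> rfl

end CyclicComplex

/-! ### Sums of components over bidegrees -/

namespace SimplicialTotal

variable {R : Type u} [CommRing R]
  {K L : HomologicalComplex₂ (ModuleCat.{u} R) (ComplexShape.down ℕ) (ComplexShape.up ℤ)}
  {Y : CochainComplex (ModuleCat.{u} R) ℤ}

/-- The component of bidegree `x` of the map which is induced by the family `v`. -/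
noncomputable def place (v : ∀ p q, Y ⟶ K.X p ⊗ L.X q) (c m : ℤ) (x : ℕ × ℕ) :
    Y.X c ⟶ (K.total (ComplexShape.up ℤ) ⊗ L.total (ComplexShape.up ℤ)).X m :=
  if h : c - x.1 - x.2 = m then (v x.1 x.2).f c ≫ columns K L x.1 x.2 c m h else 0

theorem place_of (v : ∀ p q, Y ⟶ K.X p ⊗ L.X q) (c m : ℤ) (p q : ℕ) (h : c - p - q = m) :
    place v c m (p, q) = (v p q).f c ≫ columns K L p q c m h := dif_pos h

theorem place_eq_zero (v : ∀ p q, Y ⟶ K.X p ⊗ L.X q) (c m : ℤ) (p q : ℕ) (h : v p q = 0) :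
    place v c m (p, q) = 0 := by
  by_cases h' : c - p - q = m
  · rw [place_of _ _ _ _ _ h', h, HomologicalComplex.zero_f, Limits.zero_comp]
  · exact dif_neg h'

section

variable {X X' : ℕ → CochainComplex (ModuleCat.{u} R) ℤ} (β : ∀ p, X p ⟶ X (p + 1))
  (γ : ∀ p, X' p ⟶ X' (p + 1))

/-- Applies `β` to the first factor. -/
noncomputable def raiseLeft (v : ∀ p q, Y ⟶ X p ⊗ X' q) : ∀ p q, Y ⟶ X p ⊗ X' q
  | 0, _ => 0
  | p + 1, q => v p q ≫ (β p ▷ X' q)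

/-- Applies `γ` to the second factor. -/
noncomputable def raiseRight (v : ∀ p q, Y ⟶ X p ⊗ X' q) : ∀ p q, Y ⟶ X p ⊗ X' q
  | _, 0 => 0
  | p, q + 1 => v p q ≫ (X p ◁ γ q)

theorem raiseRight_succ (v : ∀ p q, Y ⟶ X p ⊗ X' q) (p q : ℕ) :
    raiseRight γ v p (q + 1) = v p q ≫ (X p ◁ γ q) := by
  cases p <;> rfl

theorem raiseRight_zero (v : ∀ p q, Y ⟶ X p ⊗ X' q) (p : ℕ) : raiseRight γ v p 0 = 0 := by
  cases p <;> rfl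

end

variable (β : ∀ p, K.X p ⟶ K.X (p + 1)) (γ : ∀ p, L.X p ⟶ L.X (p + 1))

theorem sum_place_tensorShiftLeft (h0 : β 0 ≫ K.d 1 0 = 0)
    (hs : ∀ p, β (p + 1) ≫ K.d (p + 2) (p + 1) = -(K.d (p + 1) p ≫ β p))
    (v : ∀ p q, Y ⟶ K.X p ⊗ L.X q) (n : ℕ) (c m : ℤ) (h : c - n = m) :
    (∑ x ∈ Finset.HasAntidiagonal.antidiagonal n, place v c m x) ≫
        unshift (tensorShiftLeft (shiftMap K β h0 hs) _) m =
      ∑ x ∈ Finset.HasAntidiagonal.antidiagonal (n + 1), place (raiseLeft β v) c (m + -1) x := by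
  rw [Finset.Nat.sum_antidiagonal_succ, place_eq_zero _ _ _ _ _ (by rw [raiseLeft]), zero_add,
    Preadditive.sum_comp]
  refine Finset.sum_congr rfl fun x hx => ?_
  obtain ⟨p, q⟩ := x
  have hx' : p + q = n := Finset.HasAntidiagonal.mem_antidiagonal.1 hx
  rw [place_of _ _ _ p q (by omega), place_of _ _ _ (p + 1) q (by push_cast; omega), Category.assoc,
    columns_tensorShiftLeft, raiseLeft, HomologicalComplex.comp_f, Category.assoc]

theorem sum_place_tensorShiftRight (h0 : γ 0 ≫ L.d 1 0 = 0)
    (hs : ∀ p, γ (p + 1) ≫ L.d (p + 2) (p + 1) = -(L.d (p + 1) p ≫ γ p))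
    (v : ∀ p q, Y ⟶ K.X p ⊗ L.X q) (n : ℕ) (c m : ℤ) (h : c - n = m) :
    (∑ x ∈ Finset.HasAntidiagonal.antidiagonal n, place v c m x) ≫
        unshift (tensorShiftRight _ (shiftMap L γ h0 hs)) m =
      ∑ x ∈ Finset.HasAntidiagonal.antidiagonal (n + 1),
        place (fun p q => (-1 : ℤ) ^ p • raiseRight γ v p q) c (m + -1) x := by
  rw [Finset.Nat.sum_antidiagonal_succ',
    place_eq_zero _ _ _ _ _ (by rw [raiseRight_zero, smul_zero]), zero_add, Preadditive.sum_comp]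
  refine Finset.sum_congr rfl fun x hx => ?_
  obtain ⟨p, q⟩ := x
  have hx' : p + q = n := Finset.HasAntidiagonal.mem_antidiagonal.1 hx
  have hp : ((p : ℤ).negOnePow : ℤ) = (-1) ^ p := ParacyclicObject.coe_negOnePow_natCast p
  rw [place_of _ _ _ p q (by omega), place_of _ _ _ p (q + 1) (by push_cast; omega), Category.assoc,
    columns_tensorShiftRight, raiseRight_succ, HomologicalComplex.zsmul_f_apply,
    HomologicalComplex.comp_f, Linear.comp_units_smul, Units.smul_def, hp, Preadditive.zsmul_comp,
    Category.assoc]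

variable {M : HomologicalComplex₂ (ModuleCat.{u} R) (ComplexShape.down ℕ) (ComplexShape.up ℤ)}

theorem comp_ι_sumComponents (φ : ∀ p q n : ℕ, p + q = n → (M.X n ⟶ K.X p ⊗ L.X q)) (n : ℕ)
    (c m : ℤ) (h : c - n = m) (u : Y ⟶ M.X n) (v : ∀ p q, Y ⟶ K.X p ⊗ L.X q)
    (hv : ∀ p q (h : p + q = n), u ≫ φ p q n h = v p q) :
    u.f c ≫ ι M n c m h ≫ sumComponents φ m =
      ∑ x ∈ Finset.HasAntidiagonal.antidiagonal n, place v c m x := by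
  rw [ι_sumComponents, Preadditive.comp_sum]
  refine Finset.sum_congr rfl fun x hx => ?_
  obtain ⟨p, q⟩ := x
  have hx' : p + q = n := Finset.HasAntidiagonal.mem_antidiagonal.1 hx
  rw [component_of _ _ _ _ _ _ _ hx', place_of _ _ _ _ _ (by omega), ← hv p q hx',
    HomologicalComplex.comp_f, Category.assoc]

theorem sum_place_sub_add (v v₁ v₂ v₃ : ∀ p q, Y ⟶ K.X p ⊗ L.X q)
    (hv : ∀ p q, v p q = v₁ p q - (v₂ p q + v₃ p q)) (c m : ℤ) (s : Finset (ℕ × ℕ)) :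
    ∑ x ∈ s, place v c m x = ∑ x ∈ s, place v₁ c m x -
      (∑ x ∈ s, place v₂ c m x + ∑ x ∈ s, place v₃ c m x) := by
  rw [← Finset.sum_add_distrib, ← Finset.sum_sub_distrib]
  refine Finset.sum_congr rfl fun x _ => ?_
  by_cases h : c - x.1 - x.2 = m
  · rw [place_of _ _ _ _ _ h, place_of _ _ _ _ _ h, place_of _ _ _ _ _ h, place_of _ _ _ _ _ h, hv]
    simp only [HomologicalComplex.sub_f_apply, HomologicalComplex.add_f_apply,
      Preadditive.sub_comp, Preadditive.add_comp]
  · rw [place, place, place, place, dif_neg h, dif_neg h, dif_neg h, dif_neg h]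
    simp

end SimplicialTotal

/-! ### The Connes–Tsygan differentials and the Alexander–Whitney map -/

namespace CyclicComplex

open Paracyclic FormalSums CategoryTheory.Prod SimplicialTotal

variable {R : Type u} [CommRing R] (E E' : CyclicComplex R)

/-- The components of the Alexander–Whitney map of the models, extended by zero. -/
noncomputable def awRow (n p q : ℕ) : bi n n ⟶ bi p q :=
  if h : p + q = n then Paracyclic.frontBack p q n h else 0

/-- The components of the Alexander–Whitney map, extended by zero. -/
noncomputable def frontBackRow (n p q : ℕ) : (E ⊗ E').obj ⟨n⟩ ⟶ E.obj ⟨p⟩ ⊗ E'.obj ⟨q⟩ :=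
  if h : p + q = n then frontBack E E' p q n h else 0

theorem frontBackRow_of (n p q : ℕ) (h : p + q = n) :
    frontBackRow E E' n p q = frontBack E E' p q n h := dif_pos h

theorem realize_awRow (n p q : ℕ) :
    (realize E E').map (awRow n p q) = (frontBackRow E E' n p q :) := by
  by_cases h : p + q = n
  · rw [awRow, dif_pos h, frontBackRow, dif_pos h, realize_frontBack]
  · rw [awRow, dif_neg h, frontBackRow, dif_neg h]
    exact (realize E E').map_zero _ _

/-- The difference of the two composites of the Alexander–Whitney map and the Connes operators. -/
noncomputable def connesDiffMap (n : ℕ) :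
    (hochschildBicomplex.obj (E ⊗ E')).X n ⟶ (totalBicomplex E E').X (n + 1) :=
  diagUnit E E' n ≫ (realizeMat E E').map (Paracyclic.connesDiff n)

theorem realize_raise₁_awRow (n p q : ℕ) :
    (realize E E').map (raise₁ (awRow n) p q) =
      (raiseLeft (X := fun p => E.obj ⟨p⟩) (X' := fun q => E'.obj ⟨q⟩)
        (fun p => CyclicObject.connesB E p) (frontBackRow E E' n) p q :) := by
  cases p with
  | zero => exact (realize E E').map_zero _ _
  | succ p =>
    rw [realize_raise₁_succ, realize_awRow]
    rfl

theorem realize_raise₂_awRow (n p q : ℕ) :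
    (realize E E').map (raise₂ (awRow n) p q) =
      (raiseRight (X := fun p => E.obj ⟨p⟩) (X' := fun q => E'.obj ⟨q⟩)
        (fun p => CyclicObject.connesB E' p) (frontBackRow E E' n) p q :) := by
  cases q with
  | zero =>
    rw [raiseRight_zero]
    cases p <;> exact (realize E E').map_zero _ _
  | succ q =>
    rw [raiseRight_succ, realize_raise₂_succ, realize_awRow]
    rfl

theorem connesDiff_apply (n p q : ℕ) (h : p + q = n + 1) :
    Paracyclic.connesDiff n PUnit.unit (idx p q h) = diagConnes n ≫ awRow (n + 1) p q -
        (raise₁ (awRow n) p q + (-1 : ℤ) ^ p • raise₂ (awRow n) p q) := by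
  have e : awRow (n + 1) p q = awMap (n + 1) PUnit.unit (idx p q h) := dif_pos h
  rw [e]
  exact congrArg₂ (· - ·) (embedding_comp_apply (diagConnes n) (awMap (n + 1)) PUnit.unit _)
    (comp_totalConnes (awMap n) PUnit.unit p q h)

theorem connesDiffMap_bidegreeπ (n p q : ℕ) (h : p + q = n + 1) :
    connesDiffMap E E' n ≫ bidegreeπ E E' p q (n + 1) h =
      (CyclicObject.connesB (E ⊗ E') n ≫ frontBackRow E E' (n + 1) p q -
        (raiseLeft (X := fun p => E.obj ⟨p⟩) (X' := fun q => E'.obj ⟨q⟩)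
          (fun p => CyclicObject.connesB E p) (frontBackRow E E' n) p q +
          (-1 : ℤ) ^ p • raiseRight (X := fun p => E.obj ⟨p⟩) (X' := fun q => E'.obj ⟨q⟩)
            (fun p => CyclicObject.connesB E' p) (frontBackRow E E' n) p q) :) := by
  refine (diagUnit_entry E E' n (Paracyclic.connesDiff n) (idx p q h)).trans ?_
  refine (congrArg (realize E E').map (connesDiff_apply n p q h)).trans ?_
  have e : (realize E E').map (diagConnes n ≫ awRow (n + 1) p q -
      (raise₁ (awRow n) p q + (-1 : ℤ) ^ p • raise₂ (awRow n) p q)) =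
      (CyclicObject.connesB (E ⊗ E') n ≫ frontBackRow E E' (n + 1) p q -
        (raiseLeft (X := fun p => E.obj ⟨p⟩) (X' := fun q => E'.obj ⟨q⟩)
          (fun p => CyclicObject.connesB E p) (frontBackRow E E' n) p q +
          (-1 : ℤ) ^ p • raiseRight (X := fun p => E.obj ⟨p⟩) (X' := fun q => E'.obj ⟨q⟩)
            (fun p => CyclicObject.connesB E' p) (frontBackRow E E' n) p q) :) := by
    rw [Functor.map_sub, Functor.map_comp, Functor.map_add, Functor.map_zsmul,
      realize_raise₁_awRow, realize_raise₂_awRow, realize_awRow, realize_diagConnes]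
    rfl
  exact e

theorem ι_alexanderWhitney (n : ℕ) (c m : ℤ) (h : c - n = m) :
    ι (hochschildBicomplex.obj (E ⊗ E')) n c m h ≫ (alexanderWhitney E E').f m =
      ∑ x ∈ Finset.HasAntidiagonal.antidiagonal n,
        place (K := hochschildBicomplex.obj E) (L := hochschildBicomplex.obj E')
          (frontBackRow E E' n) c m x := by
  refine Eq.trans ?_ (comp_ι_sumComponents (M := hochschildBicomplex.obj (E ⊗ E'))
    (K := hochschildBicomplex.obj E) (L := hochschildBicomplex.obj E')
    (fun p q n h => frontBack E E' p q n h) n c m h (𝟙 _) (frontBackRow E E' n)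
    fun p q h => (Category.id_comp _).trans (frontBackRow_of E E' n p q h).symm)
  exact (Category.id_comp _).symm

theorem connesB_hochschildBicomplex_d_zero :
    (CyclicObject.connesB E 0 ≫ (hochschildBicomplex.obj E).d 1 0 :) = 0 := by
  rw [hochschildBicomplex_d]
  exact CyclicObject.connesB_b_zero E

theorem connesB_hochschildBicomplex_d (p : ℕ) :
    (CyclicObject.connesB E (p + 1) ≫ (hochschildBicomplex.obj E).d (p + 2) (p + 1) :) =
      -((hochschildBicomplex.obj E).d (p + 1) p ≫ CyclicObject.connesB E p) := by
  rw [hochschildBicomplex_d, hochschildBicomplex_d]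
  exact CyclicObject.connesB_b E p

theorem ι_connesTsygan (n : ℕ) (c m : ℤ) (h : c - n = m) :
    ι (hochschildBicomplex.obj E) n c m h ≫ unshift (connesTsygan.app E) m =
      (CyclicObject.connesB E n).f c ≫
        ι (hochschildBicomplex.obj E) (n + 1) c (m + -1) (by push_cast; omega) :=
  ι_shiftMap (K := hochschildBicomplex.obj E) (fun p => CyclicObject.connesB E p)
    (connesB_hochschildBicomplex_d_zero E) (connesB_hochschildBicomplex_d E) n c m h

theorem ι_connesTsygan_alexanderWhitney (n : ℕ) (c m : ℤ) (h : c - n = m) :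
    ι (hochschildBicomplex.obj (E ⊗ E')) n c m h ≫ unshift (connesTsygan.app (E ⊗ E')) m ≫
        (alexanderWhitney E E').f (m + -1) =
      ∑ x ∈ Finset.HasAntidiagonal.antidiagonal (n + 1),
        place (K := hochschildBicomplex.obj E) (L := hochschildBicomplex.obj E')
          (fun p q => CyclicObject.connesB (E ⊗ E') n ≫ frontBackRow E E' (n + 1) p q)
            c (m + -1) x := by
  refine (Category.assoc _ _ _).symm.trans ((congrArg (· ≫ HomologicalComplex.Hom.f _ (m + -1))
    (ι_connesTsygan (E ⊗ E') n c m h)).trans ((Category.assoc _ _ _).trans ?_))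
  exact comp_ι_sumComponents (M := hochschildBicomplex.obj (E ⊗ E'))
    (K := hochschildBicomplex.obj E) (L := hochschildBicomplex.obj E')
    (fun p q n h => frontBack E E' p q n h) (n + 1) c (m + -1) (by push_cast; omega)
    (CyclicObject.connesB (E ⊗ E') n) _
    fun p q h => congrArg (_ ≫ ·) (frontBackRow_of E E' (n + 1) p q h).symm

/-- The bridge between the models and the statement. The realised difference is compared in each
bidegree with the operators defined through shifts of complexes; all signs have been absorbed in the
lemmas on `columns`. -/
theorem raiseBy_connesDiffMap (m : ℤ) :
    raiseBy 1 (fun p => Nat.cast_succ p) (connesDiffMap E E') m (m + -1) (by ring) ≫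
        sumComponents (bidegreeπ E E') (m + -1) =
      unshift (connesTsygan.app (E ⊗ E')) m ≫ (alexanderWhitney E E').f (m + -1) -
        (alexanderWhitney E E').f m ≫
          (unshift (tensorShiftLeft (connesTsygan.app E) (CH.obj E')) m +
            unshift (tensorShiftRight (CH.obj E) (connesTsygan.app E')) m) := by
  refine hom_ext fun n c h => ?_
  have e := comp_ι_sumComponents (bidegreeπ E E') (n + 1) c (m + -1) (by push_cast; omega)
    (connesDiffMap E E' n) _ (connesDiffMap_bidegreeπ E E' n)
  refine ((Category.assoc _ _ _).symm.trans ((congrArg (· ≫ _)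
    (ι_raiseBy 1 (fun p => Nat.cast_succ p) (connesDiffMap E E') m (m + -1) (by ring) n c h)).trans
      (Category.assoc _ _ _))).trans ?_
  refine (e.trans (sum_place_sub_add _ _ _ _ (fun _ _ => rfl) _ _ _)).trans ?_
  refine Eq.trans ?_ (Preadditive.comp_sub _ _ _).symm
  refine congrArg₂ (· - ·) (ι_connesTsygan_alexanderWhitney E E' n c m h).symm ?_
  refine Eq.trans ?_ (Category.assoc _ _ _)
  refine Eq.trans ?_ (congrArg (· ≫ _) (ι_alexanderWhitney E E' n c m h).symm)
  refine Eq.trans ?_ (Preadditive.comp_add _ _ _ _ _ _).symm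
  exact congrArg₂ (· + ·)
    (sum_place_tensorShiftLeft (K := hochschildBicomplex.obj E) (L := hochschildBicomplex.obj E')
      (fun p => CyclicObject.connesB E p) (connesB_hochschildBicomplex_d_zero E)
      (connesB_hochschildBicomplex_d E) (frontBackRow E E' n) n c m h).symm
    (sum_place_tensorShiftRight (K := hochschildBicomplex.obj E) (L := hochschildBicomplex.obj E')
      (fun p => CyclicObject.connesB E' p) (connesB_hochschildBicomplex_d_zero E')
      (connesB_hochschildBicomplex_d E') (frontBackRow E E' n) n c m h).symm

end CyclicComplex

/-- A homotopy between maps to a shifted complex, from its components of degree `-2`. -/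
noncomputable def homotopyToShift {R : Type u} [CommRing R]
    {X Y : CochainComplex (ModuleCat.{u} R) ℤ} (f g : X ⟶ Y⟦(-1 : ℤ)⟧)
    (S : ∀ i j : ℤ, j + 2 = i → (X.X i ⟶ Y.X j))
    (h : ∀ m, unshift f m = X.d m (m + 1) ≫ S (m + 1) (m + -1) (by ring) +
      S m (m - 1 + -1) (by ring) ≫ (-Y.d (m - 1 + -1) (m + -1)) + unshift g m) :
    Homotopy f g :=
  homotopyOfComponents f g (fun i j hij => S i (j + -1) (by omega)) fun m => by
    have e : (Y⟦(-1 : ℤ)⟧).d (m - 1) m = -Y.d (m - 1 + -1) (m + -1) := by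
      rw [CochainComplex.shiftFunctor_obj_d', Int.negOnePow_neg, Int.negOnePow_one, Units.neg_smul,
        one_smul]
    rw [e]
    exact h m

namespace CyclicComplex

open Paracyclic FormalSums CategoryTheory.Prod SimplicialTotal

variable {R : Type u} [CommRing R] (E E' : CyclicComplex R)

/-- The homotopy of the models, realised. -/
theorem exists_connesDiffMap_homotopy :
    ∃ s : ∀ n, (hochschildBicomplex.obj (E ⊗ E')).X n ⟶ (totalBicomplex E E').X (n + 2),
      s 0 ≫ (totalBicomplex E E').d 2 1 = connesDiffMap E E' 0 ∧
      ∀ n, s (n + 1) ≫ (totalBicomplex E E').d (n + 3) (n + 2) -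
        (hochschildBicomplex.obj (E ⊗ E')).d (n + 1) n ≫ s n = connesDiffMap E E' (n + 1) := by
  obtain ⟨s, h0, h⟩ := exists_connes_homotopy
  refine ⟨fun n => diagUnit E E' n ≫ (realizeMat E E').map (s n), ?_, fun n => ?_⟩
  · refine (Category.assoc _ _ _).trans (congrArg (_ ≫ ·) ?_)
    exact ((realizeMat E E').map_comp _ _).symm.trans (congrArg _ h0)
  · have e : (realizeMat E E').map (s (n + 1)) ≫ (realizeMat E E').map (totalComplex.d (n + 3) (n + 2)) -
        (realizeMat E E').map (diagComplex.d (n + 1) n) ≫ (realizeMat E E').map (s n) =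
          (realizeMat E E').map (connesDiff (n + 1)) := by
      rw [← Functor.map_comp, ← Functor.map_comp, ← Functor.map_sub, h n]
      rfl
    refine Eq.trans ?_ (congrArg (diagUnit E E' (n + 1) ≫ ·) e)
    refine Eq.trans ?_ (Preadditive.comp_sub _ _ _).symm
    refine congrArg₂ (· - ·) (Category.assoc _ _ _) ?_
    refine (Category.assoc _ _ _).symm.trans (Eq.trans ?_ (Category.assoc _ _ _))
    exact congrArg (· ≫ _) (diagUnit_comm E E' n).symm

/-- The bookkeeping of signs, separated from the complexes. The differential of the shifted target
is minus that of the target, hence the homotopy is minus the transported one. -/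
theorem homotopy_aux {C : Type*} [Category* C] [Preadditive C] {X X' A A' B B' : C}
    (d : X ⟶ X') (u' : X' ⟶ A') (σ' : A' ⟶ B') (u : X ⟶ A) (dA : A ⟶ A') (σ : A ⟶ B) (dB : B ⟶ B')
    (hσ : σ ≫ dB = dA ≫ σ') (v : X ⟶ A') (hv : u ≫ dA - d ≫ u' = v)
    (w₁ w₂ : X ⟶ B') (hw : v ≫ σ' = w₁ - w₂) :
    w₁ = d ≫ (-(u' ≫ σ')) + (-(u ≫ σ)) ≫ (-dB) + w₂ := by
  rw [← sub_eq_iff_eq_add, ← hw, ← hv]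
  simp only [Preadditive.sub_comp, Preadditive.comp_neg, Preadditive.neg_comp, Category.assoc, hσ]
  abel

/-- The Alexander–Whitney map commutes with the Connes–Tsygan differentials up to homotopy. -/
theorem exists_connesTsygan_homotopy :
    Nonempty (Homotopy
      (connesTsygan.app (E ⊗ E') ≫ (alexanderWhitney E E')⟦(-1 : ℤ)⟧')
      (alexanderWhitney E E' ≫ (tensorShiftLeft (connesTsygan.app E) (CH.obj E') +
        tensorShiftRight (CH.obj E) (connesTsygan.app E')))) := by
  obtain ⟨s, h0, h⟩ := exists_connesDiffMap_homotopy E E'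
  refine ⟨homotopyToShift _ _ (fun i j hij =>
    -(raiseBy 2 (fun p => Nat.cast_add p 2) s i j hij ≫ sumComponents (bidegreeπ E E') j))
      fun m => ?_⟩
  have e := raiseBy_two_d s (connesDiffMap E E') h0 h m (m + 1) (m - 1 + -1) (m + -1) rfl (by ring)
    (by ring)
  have e' := sumComponents_d (bidegreeπ E E') (total_d_bidegreeπ E E') (m - 1 + -1) (m + -1)
    (by ring)
  have e'' := homotopy_aux _ _ _ _ _ _ _ e' _ e _ _ (raiseBy_connesDiffMap E E' m)
  have w1 : unshift (connesTsygan.app (E ⊗ E') ≫ (alexanderWhitney E E')⟦(-1 : ℤ)⟧') m =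
    unshift (connesTsygan.app (E ⊗ E')) m ≫ (alexanderWhitney E E').f (m + -1) := rfl
  have w2 : unshift (alexanderWhitney E E' ≫ (tensorShiftLeft (connesTsygan.app E) (CH.obj E') +
      tensorShiftRight (CH.obj E) (connesTsygan.app E'))) m = (alexanderWhitney E E').f m ≫
          (unshift (tensorShiftLeft (connesTsygan.app E) (CH.obj E')) m +
            unshift (tensorShiftRight (CH.obj E) (connesTsygan.app E')) m) := rfl
  rw [w1, w2]
  exact e''

end CyclicComplex

/-! ### Quasi-isomorphisms between total complexes -/

section

variable {R : Type u} [CommRing R]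

/-- The mapping cone of `f` is acyclic. -/
def ConeExact {X Y : CochainComplex (ModuleCat.{u} R) ℤ} (f : X ⟶ Y) : Prop :=
  ∀ ⦃h i j k : ℤ⦄, h + 1 = i → i + 1 = j → j + 1 = k → ∀ (x : X.X j) (y : Y.X i),
    X.d j k x = 0 → f.f j x = Y.d i j y →
      ∃ (x' : X.X i) (y' : Y.X h), X.d i j x' = x ∧ f.f i x' = y + Y.d h i y'

/-- Preimages under `h` chosen element by element need not depend linearly on `a`; they do after an
epimorphism onto `A`. This leads from elements to the criteria for homology maps up to refinements.
-/
theorem exists_refinement {A B C : ModuleCat.{u} R} (g : A ⟶ C) (h : B ⟶ C)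
    (H : ∀ a, ∃ b, h b = g a) :
    ∃ (A' : ModuleCat.{u} R) (π : A' ⟶ A) (_ : Epi π) (b : A' ⟶ B), π ≫ g = b ≫ h := by
  have : Epi (ModuleCat.ofHom h.hom.rangeRestrict) :=
    (ModuleCat.epi_iff_surjective _).2 h.hom.surjective_rangeRestrict
  obtain ⟨A', π, hπ, b, hb⟩ := surjective_up_to_refinements_of_epi
    (ModuleCat.ofHom h.hom.rangeRestrict) (ModuleCat.ofHom (g.hom.codRestrict _ H))
  refine ⟨A', π, hπ, b, ?_⟩
  ext a
  exact congrArg Subtype.val (ConcreteCategory.congr_hom hb a)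

/-- The way back to elements: an element is a map from `R`, and an epimorphism onto `R` takes the
value 1. -/
theorem exists_of_refinement {B C : ModuleCat.{u} R} {h : B ⟶ C} {c : C}
    {A' : ModuleCat.{u} R} {π : A' ⟶ ModuleCat.of R R} (hπ : Epi π) {b : A' ⟶ B}
    (e : π ≫ ModuleCat.ofHom (LinearMap.toSpanSingleton R C c) = b ≫ h) :
    ∃ a, π a = (1 : R) ∧ h (b a) = c := by
  obtain ⟨a, ha⟩ := (ModuleCat.epi_iff_surjective _).1 hπ (1 : R)
  refine ⟨a, ha, (ConcreteCategory.congr_hom e a).symm.trans ?_⟩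
  simp [ha]

variable {X Y : CochainComplex (ModuleCat.{u} R) ℤ} (f : X ⟶ Y)

/-- The condition contains both halves: its first conclusion gives injectivity on homology, and the
case x = 0 gives surjectivity. -/
theorem ConeExact.quasiIso {f : X ⟶ Y} (hf : ConeExact f) : QuasiIso f := by
  refine ⟨fun j => (quasiIsoAt_iff_isIso_homologyMap f j).2 ?_⟩
  have h1 : Mono (HomologicalComplex.homologyMap f j) := by
    refine (HomologicalComplex.mono_homologyMap_iff_up_to_refinements f (j - 1) j (j + 1)
      (by simp) (by simp)).2 fun A x hx y hy => exists_refinement _ _ fun a => ?_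
    obtain ⟨x', _, h, _⟩ := hf (show j - 1 - 1 + 1 = j - 1 by ring) (show j - 1 + 1 = j by ring) rfl
      (x a) (y a) (ConcreteCategory.congr_hom hx a) (ConcreteCategory.congr_hom hy a)
    exact ⟨x', h⟩
  have h2 : Epi (HomologicalComplex.homologyMap f j) := by
    refine (HomologicalComplex.epi_homologyMap_iff_up_to_refinements f (j - 1) j (j + 1)
      (by simp) (by simp)).2 fun A y hy => ?_
    obtain ⟨A', π, hπ, b, hb⟩ := exists_refinement y (B := ModuleCat.of R
      (LinearMap.ker (X.d j (j + 1)).hom × Y.X (j - 1)))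
      (ModuleCat.ofHom (((f.f j).hom ∘ₗ Submodule.subtype _).coprod (Y.d (j - 1) j).hom)) fun a => by
        obtain ⟨x', y', h, h'⟩ := hf (show j - 1 + 1 = j by ring) rfl (show j + 1 + 1 = j + 2 by ring)
          0 (y a) (map_zero _) ((map_zero _).trans (ConcreteCategory.congr_hom hy a).symm)
        refine ⟨(⟨x', h⟩, -y'), ?_⟩
        change f.f j x' + Y.d (j - 1) j (-y') = y a
        rw [h', map_neg, add_neg_cancel_right]
    refine ⟨A', π, hπ, b ≫ ModuleCat.ofHom (Submodule.subtype _ ∘ₗ LinearMap.fst R _ _), ?_,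
      b ≫ ModuleCat.ofHom (LinearMap.snd R _ _), ?_⟩
    · ext a
      exact (b a).1.2
    · rw [hb]
      rfl
  exact isIso_of_mono_of_epi _

/-- By injectivity x is the boundary of some x₀. Then y - f x₀ is a cycle, and by surjectivity it is
homologous to f z for a cycle z. The solution is x₀ + z. -/
theorem coneExact_of_quasiIso [QuasiIso f] : ConeExact f := by
  intro h i j k hi hj hk x y hx hy
  have h1 : Mono (HomologicalComplex.homologyMap f j) := inferInstance
  have h2 : Epi (HomologicalComplex.homologyMap f i) := inferInstance
  rw [HomologicalComplex.mono_homologyMap_iff_up_to_refinements f i j k (by simp; omega)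
    (by simp; omega)] at h1
  rw [HomologicalComplex.epi_homologyMap_iff_up_to_refinements f h i j (by simp; omega)
    (by simp; omega)] at h2
  obtain ⟨A, π, hπ, x₁, e⟩ := h1 (ModuleCat.ofHom (LinearMap.toSpanSingleton R _ x))
    (by ext; simpa using hx) (ModuleCat.ofHom (LinearMap.toSpanSingleton R _ y))
    (by ext; simpa using hy)
  obtain ⟨a, ha, e⟩ := exists_of_refinement hπ e
  set x₀ := x₁ a
  obtain ⟨A, π, hπ, z, hz, w, e'⟩ := h2 (ModuleCat.ofHom (LinearMap.toSpanSingleton R _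
    (y - f.f i x₀))) (by
      ext
      have e' : (Y.d i j).hom (f.f i x₀) = f.f j (X.d i j x₀) :=
        ConcreteCategory.congr_hom (f.comm i j) x₀
      simp [← hy, ← e, e'])
  obtain ⟨a, ha⟩ := (ModuleCat.epi_iff_surjective _).1 hπ (1 : R)
  have e'' := ConcreteCategory.congr_hom e' a
  have hz' := ConcreteCategory.congr_hom hz a
  simp [ha] at e'' hz'
  refine ⟨x₀ + z a, -w a, ?_, ?_⟩
  · rw [map_add, e, hz', add_zero]
  · rw [map_add, map_neg, ← sub_eq_add_neg, eq_sub_iff_add_eq, add_assoc, ← e'']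
    abel

end

/-! ### The filtration of a total complex by the simplicial degree -/

section

variable {R : Type u} [CommRing R]

namespace SimplicialTotal

variable {K L : HomologicalComplex₂ (ModuleCat.{u} R) (ComplexShape.down ℕ) (ComplexShape.up ℤ)}

theorem map_zsmul_unit {A B : ModuleCat.{u} R} (f : A ⟶ B) (ε : ℤˣ) (x : A) :
    f (ε • x) = ε • f x := map_zsmul f.hom (ε : ℤ) x

variable (K) in
/-- The projection of the total complex to a summand. -/
noncomputable def proj (p : ℕ) (a m : ℤ) (h : a - p = m) :
    (K.total (ComplexShape.up ℤ)).X m ⟶ (K.X p).X a :=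
  K.totalDesc fun q b hb =>
    if hq : q = p then eqToHom (by
      change b - (q : ℤ) = m at hb
      rw [hq, show b = a by omega]) else 0

theorem ι_proj (p : ℕ) (a m : ℤ) (h : a - p = m) : ι K p a m h ≫ proj K p a m h = 𝟙 _ :=
  (HomologicalComplex₂.ι_totalDesc _ _ _ _ _).trans (dif_pos rfl)

theorem ι_proj_ne (p q : ℕ) (a b m : ℤ) (h : a - p = m) (h' : b - q = m) (hpq : p ≠ q) :
    ι K p a m h ≫ proj K q b m h' = 0 :=
  (HomologicalComplex₂.ι_totalDesc _ _ _ _ _).trans (dif_neg hpq)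

theorem faceι_proj_ne (p q : ℕ) (a b m : ℤ) (h : a - p + 1 = m) (h' : b - q = m) (hpq : p ≠ q + 1) :
    faceι K p a m h ≫ proj K q b m h' = 0 := by
  cases p with
  | zero => rw [faceι, Limits.zero_comp]
  | succ p => rw [faceι, Category.assoc, ι_proj_ne _ _ _ _ _ _ _ (by omega), Limits.comp_zero]

theorem d_proj (p : ℕ) (a a' m m' : ℤ) (h : a - p = m) (ha : a + 1 = a') (hm : m + 1 = m') :
    (K.total (ComplexShape.up ℤ)).d m m' ≫ proj K p a' m' (by omega) =
      (p : ℤ).negOnePow • (proj K p a m h ≫ (K.X p).d a a') +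
        proj K (p + 1) a' m (by push_cast; omega) ≫ (K.d (p + 1) p).f a' := by
  subst ha
  refine hom_ext fun q b hb => ?_
  rw [← Category.assoc, ι_d K q b m m' hb hm, Preadditive.add_comp, Linear.units_smul_comp,
    Category.assoc, Preadditive.comp_add, Linear.comp_units_smul, ← Category.assoc (ι K q b m hb),
    ← Category.assoc (ι K q b m hb)]
  by_cases hq : q = p
  · subst hq
    obtain rfl : b = a := by omega
    rw [faceι_proj_ne _ _ _ _ _ _ _ (by omega), ι_proj, ι_proj, ι_proj_ne _ _ _ _ _ _ _ (by omega)]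
    simp
  · rw [ι_proj_ne q p (b + 1) (a + 1) m' _ _ hq, ι_proj_ne q p b a m _ _ hq, Limits.comp_zero,
      Limits.zero_comp, smul_zero, smul_zero, add_zero, zero_add]
    by_cases hq' : q = p + 1
    · subst hq'
      obtain rfl : b = a + 1 := by push_cast at hb; omega
      rw [ι_proj, faceι, Category.assoc, ι_proj, Category.comp_id, Category.id_comp]
    · rw [faceι_proj_ne _ _ _ _ _ _ _ hq', ι_proj_ne _ _ _ _ _ _ _ hq', Limits.zero_comp]

theorem proj_map (φ : K ⟶ L) (p : ℕ) (a m : ℤ) (h : a - p = m) :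
    (HomologicalComplex₂.total.map φ (ComplexShape.up ℤ)).f m ≫ proj L p a m h =
      proj K p a m h ≫ (φ.f p).f a := by
  refine hom_ext fun q b hb => ?_
  rw [← Category.assoc, ι_map, ← Category.assoc, Category.assoc]
  by_cases hq : q = p
  · subst hq
    obtain rfl : b = a := by omega
    rw [ι_proj, ι_proj, Category.comp_id, Category.id_comp]
  · rw [ι_proj_ne _ _ _ _ _ _ _ hq, ι_proj_ne _ _ _ _ _ _ _ hq, Limits.comp_zero, Limits.zero_comp]

/-- Elements of the total complex of simplicial degree less than `N`. -/
def Below (N : ℕ) {m : ℤ} (x : (K.total (ComplexShape.up ℤ)).X m) : Prop :=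
  ∀ (p : ℕ) (a : ℤ) (h : a - p = m), N ≤ p → proj K p a m h x = 0

theorem proj_ι_apply (p : ℕ) (a m : ℤ) (h : a - p = m) (z : (K.X p).X a) :
    proj K p a m h (ι K p a m h z) = z := ConcreteCategory.congr_hom (ι_proj p a m h) z

theorem proj_ι_apply_ne (p q : ℕ) (a b m : ℤ) (h : a - p = m) (h' : b - q = m) (hpq : p ≠ q)
    (z : (K.X p).X a) : proj K q b m h' (ι K p a m h z) = 0 :=
  ConcreteCategory.congr_hom (ι_proj_ne p q a b m h h' hpq) z

/-- The total complex is accessible through its universal property only. The elements with a finite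
expansion form a submodule containing all summands, so the projection to the quotient vanishes. -/
theorem exists_sum_eq {m : ℤ} (x : (K.total (ComplexShape.up ℤ)).X m) :
    ∃ N, ∀ M ≥ N, x = ∑ p ∈ Finset.range M,
      ι K p (m + p) m (by ring) (proj K p (m + p) m (by ring) x) := by
  let S : Submodule R ((K.total (ComplexShape.up ℤ)).X m) :=
    { carrier := {x | ∃ N, ∀ M ≥ N, x = ∑ p ∈ Finset.range M,
        ι K p (m + p) m (by ring) (proj K p (m + p) m (by ring) x)}
      zero_mem' := ⟨0, fun M _ => by simp⟩
      add_mem' := by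
        rintro x y ⟨N, hN⟩ ⟨N', hN'⟩
        refine ⟨max N N', fun M hM => ?_⟩
        simp only [map_add, Finset.sum_add_distrib]
        rw [← hN M (le_trans (le_max_left _ _) hM), ← hN' M (le_trans (le_max_right _ _) hM)]
      smul_mem' := by
        rintro r x ⟨N, hN⟩
        refine ⟨N, fun M hM => ?_⟩
        simp only [map_smul]
        rw [← Finset.smul_sum, ← hN M hM] }
  have hS : ModuleCat.ofHom S.mkQ = 0 := by
    refine hom_ext fun p a h => ?_
    ext z
    refine (Submodule.Quotient.mk_eq_zero S).2 ⟨p + 1, fun M hM => ?_⟩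
    obtain rfl : a = m + p := by omega
    refine Eq.symm ((Finset.sum_eq_single p (fun q _ hq => ?_) fun hp => ?_).trans ?_)
    · exact (congrArg (ι K q (m + q) m _) (proj_ι_apply_ne _ _ _ _ _ _ _ hq.symm z)).trans
        (map_zero _)
    · exact absurd (Finset.mem_range.2 (by omega)) hp
    · exact congrArg (ι K p (m + p) m _) (proj_ι_apply _ _ _ _ z)
  exact (Submodule.Quotient.mk_eq_zero S).1 (ConcreteCategory.congr_hom hS x)

theorem exists_below {m : ℤ} (x : (K.total (ComplexShape.up ℤ)).X m) : ∃ N, Below N x := by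
  obtain ⟨N, hN⟩ := exists_sum_eq x
  refine ⟨N, fun p a h hp => ?_⟩
  obtain rfl : a = m + p := by omega
  -- Comparing the expansions with p and with p + 1 terms isolates the component of simplicial
  -- degree p.
  have e := hN (p + 1) (by omega)
  rw [Finset.sum_range_succ, ← hN p hp, left_eq_add] at e
  rw [← proj_ι_apply p (m + p) m h (proj K p (m + p) m h x), e, map_zero]

theorem eq_zero_of_below_zero {m : ℤ} {x : (K.total (ComplexShape.up ℤ)).X m} (hx : Below 0 x) :
    x = 0 := by
  obtain ⟨N, hN⟩ := exists_sum_eq x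
  rw [hN N le_rfl]
  exact Finset.sum_eq_zero fun p _ => by rw [hx p _ _ (Nat.zero_le _), map_zero]

theorem d_proj_apply (p : ℕ) (a a' m m' : ℤ) (h : a - p = m) (ha : a + 1 = a') (hm : m + 1 = m')
    (x : (K.total (ComplexShape.up ℤ)).X m) :
    proj K p a' m' (by omega) ((K.total (ComplexShape.up ℤ)).d m m' x) =
      (p : ℤ).negOnePow • (K.X p).d a a' (proj K p a m h x) +
        (K.d (p + 1) p).f a' (proj K (p + 1) a' m (by push_cast; omega) x) :=
  ConcreteCategory.congr_hom (d_proj p a a' m m' h ha hm) x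

theorem proj_map_apply (φ : K ⟶ L) (p : ℕ) (a m : ℤ) (h : a - p = m)
    (x : (K.total (ComplexShape.up ℤ)).X m) :
    proj L p a m h ((HomologicalComplex₂.total.map φ (ComplexShape.up ℤ)).f m x) =
      (φ.f p).f a (proj K p a m h x) :=
  ConcreteCategory.congr_hom (proj_map φ p a m h) x

theorem below_ι (N : ℕ) (a m : ℤ) (h : a - N = m) (z : (K.X N).X a) : Below (N + 1) (ι K N a m h z) :=
  fun p b hb hp => proj_ι_apply_ne N p a b m h hb (by omega) z

theorem Below.d {N : ℕ} {m : ℤ} {x : (K.total (ComplexShape.up ℤ)).X m} (hx : Below N x) (m' : ℤ)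
    (hm : m + 1 = m') : Below N ((K.total (ComplexShape.up ℤ)).d m m' x) := fun p a h hp => by
  rw [d_proj_apply p (a - 1) a m m' (by omega) (by ring) hm, hx p _ _ hp, hx (p + 1) _ _ (by omega),
    map_zero, map_zero, smul_zero, add_zero]

theorem Below.map {N : ℕ} {m : ℤ} {x : (K.total (ComplexShape.up ℤ)).X m} (hx : Below N x)
    (φ : K ⟶ L) : Below N ((HomologicalComplex₂.total.map φ (ComplexShape.up ℤ)).f m x) :=
  fun p a h hp => by rw [proj_map_apply, hx p _ _ hp, map_zero]

theorem Below.add {N : ℕ} {m : ℤ} {x y : (K.total (ComplexShape.up ℤ)).X m} (hx : Below N x)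
    (hy : Below N y) : Below N (x + y) :=
  fun p a h hp => by rw [map_add, hx p _ _ hp, hy p _ _ hp, add_zero]

theorem Below.sub {N : ℕ} {m : ℤ} {x y : (K.total (ComplexShape.up ℤ)).X m} (hx : Below N x)
    (hy : Below N y) : Below N (x - y) :=
  fun p a h hp => by rw [map_sub, hx p _ _ hp, hy p _ _ hp, sub_zero]

theorem Below.mono {N N' : ℕ} {m : ℤ} {x : (K.total (ComplexShape.up ℤ)).X m} (hx : Below N x)
    (hN : N ≤ N') : Below N' x :=
  fun p a h hp => hx p a h (hN.trans hp)

theorem Below.of_succ {N : ℕ} {a m : ℤ} {h : a - N = m} {x : (K.total (ComplexShape.up ℤ)).X m}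
    (hx : Below (N + 1) x) (h0 : proj K N a m h x = 0) : Below N x := fun p b hb hp => by
  rcases hp.eq_or_lt with rfl | hp
  · obtain rfl : b = a := by omega
    exact h0
  · exact hx p b hb hp

/-- Induction on the bound for the simplicial degree. The simplicial differential lowers that
degree, so the top components satisfy the hypotheses in their own column. A solution there is
subtracted, and the bound drops by one. -/
theorem exists_of_below (φ : K ⟶ L) (hφ : ∀ p, ConeExact (φ.f p)) (N : ℕ) {h i j k : ℤ}
    (hi : h + 1 = i) (hj : i + 1 = j) (hk : j + 1 = k) (x : (K.total (ComplexShape.up ℤ)).X j)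
    (y : (L.total (ComplexShape.up ℤ)).X i) (hx : Below N x) (hy : Below N y)
    (hdx : (K.total (ComplexShape.up ℤ)).d j k x = 0)
    (hxy : (HomologicalComplex₂.total.map φ (ComplexShape.up ℤ)).f j x =
      (L.total (ComplexShape.up ℤ)).d i j y) :
    ∃ (x' : (K.total (ComplexShape.up ℤ)).X i) (y' : (L.total (ComplexShape.up ℤ)).X h),
      (K.total (ComplexShape.up ℤ)).d i j x' = x ∧
        (HomologicalComplex₂.total.map φ (ComplexShape.up ℤ)).f i x' =
          y + (L.total (ComplexShape.up ℤ)).d h i y' := by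
  induction N generalizing x y with
  | zero =>
    refine ⟨0, 0, ?_, ?_⟩
    · rw [eq_zero_of_below_zero hx, map_zero]
    · rw [eq_zero_of_below_zero hy, map_zero, map_zero, add_zero]
  | succ N ih =>
    have e1 := d_proj_apply N (j + N) (k + N) j k (add_sub_cancel_right _ _) (by omega) hk x
    rw [hdx, map_zero, hx (N + 1) _ _ le_rfl, map_zero, add_zero, eq_comm,
      smul_eq_zero_iff_eq] at e1
    have e2 := congrArg (proj L N (j + N) j (add_sub_cancel_right _ _)) hxy
    rw [proj_map_apply, d_proj_apply N (i + N) (j + N) i j (add_sub_cancel_right _ _) (by omega) hj,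
      hy (N + 1) _ _ le_rfl, map_zero, add_zero, ← map_zsmul_unit] at e2
    obtain ⟨x', y', h1, h2⟩ := hφ N (show h + N + 1 = i + N by omega) (by omega) (by omega) _ _ e1 e2
    let D := (K.total (ComplexShape.up ℤ)).d i j
    let D' := (L.total (ComplexShape.up ℤ)).d h i
    let f := (HomologicalComplex₂.total.map φ (ComplexShape.up ℤ)).f
    have dd : ∀ z, (K.total (ComplexShape.up ℤ)).d j k (D z) = 0 := fun z =>
      ConcreteCategory.congr_hom ((K.total (ComplexShape.up ℤ)).d_comp_d i j k) z
    have dd' : ∀ z, (L.total (ComplexShape.up ℤ)).d i j (D' z) = 0 := fun z =>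
      ConcreteCategory.congr_hom ((L.total (ComplexShape.up ℤ)).d_comp_d h i j) z
    have fd : ∀ z, (L.total (ComplexShape.up ℤ)).d i j (f i z) = f j (D z) := fun z =>
      ConcreteCategory.congr_hom
        ((HomologicalComplex₂.total.map φ (ComplexShape.up ℤ)).comm i j) z
    -- The sign compensates that of the internal differential in column `N` of the total complex.
    let X := ι K N (i + N) i (add_sub_cancel_right _ _) ((N : ℤ).negOnePow • x')
    let Y := ι L N (h + N) h (add_sub_cancel_right _ _) y'
    have hX : Below (N + 1) X := below_ι N _ _ _ _
    have hY : Below (N + 1) Y := below_ι N _ _ _ _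
    have bx : Below N (x - D X) := by
      refine (hx.sub (hX.d j hj)).of_succ (a := j + N) (h := add_sub_cancel_right _ _) ?_
      rw [map_sub, d_proj_apply N (i + N) (j + N) i j (add_sub_cancel_right _ _) (by omega) hj,
        hX (N + 1) _ _ le_rfl, proj_ι_apply, map_zero, add_zero, map_zsmul_unit, h1, smul_smul,
        Int.units_mul_self, one_smul, sub_self]
    have bz : Below N (y - f i X + D' Y) := by
      refine ((hy.sub (hX.map φ)).add (hY.d i hi)).of_succ (a := i + N) (h := add_sub_cancel_right _ _) ?_
      rw [map_add, map_sub, d_proj_apply N (h + N) (i + N) h i (add_sub_cancel_right _ _) (by omega) hi,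
        hY (N + 1) _ _ le_rfl, proj_ι_apply, proj_map_apply, proj_ι_apply, map_zero, add_zero,
        map_zsmul_unit, h2, smul_add, smul_smul, Int.units_mul_self, one_smul]
      abel
    obtain ⟨x'', y'', h3, h4⟩ := ih (x - D X) (y - f i X + D' Y) bx bz
      (by rw [map_sub, hdx, dd, sub_zero])
      (by
        rw [map_add, map_sub, dd', map_sub, add_zero, fd, hxy])
    refine ⟨x'' + X, y'' + Y, ?_, ?_⟩
    · rw [map_add, h3]
      exact sub_add_cancel _ _
    · rw [map_add, h4, map_add]
      change y - f i X + D' Y + D' y'' + f i X = y + (D' y'' + D' Y)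
      abel

/-- A map of bicomplexes which is a quasi-isomorphism on the columns is a quasi-isomorphism on total
complexes. -/
theorem quasiIso_total_map (φ : K ⟶ L) [∀ p, QuasiIso (φ.f p)] :
    QuasiIso (HomologicalComplex₂.total.map φ (ComplexShape.up ℤ)) := by
  refine ConeExact.quasiIso fun h i j k hi hj hk x y hx hxy => ?_
  obtain ⟨N, hN⟩ := exists_below x
  obtain ⟨N', hN'⟩ := exists_below y
  exact exists_of_below φ (fun p => coneExact_of_quasiIso (φ.f p)) (max N N') hi hj hk x y
    (hN.mono (le_max_left _ _)) (hN'.mono (le_max_right _ _)) hx hxy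

end SimplicialTotal

end

/-! ### Acyclicity and homotopically flat replacements -/

section

variable {R : Type u} [CommRing R]

/-- Reduces the acyclicity of total complexes to the statement on quasi-isomorphisms. -/
theorem HomologicalComplex.acyclic_iff_quasiIso_zero (X : CochainComplex (ModuleCat.{u} R) ℤ) :
    X.Acyclic ↔ QuasiIso (0 : X ⟶ X) := by
  constructor
  · intro h
    refine ⟨fun i => (quasiIsoAt_iff_exactAt _ _ (h i)).2 (h i)⟩
  · intro h i
    rw [exactAt_iff_isZero_homology, Limits.IsZero.iff_id_eq_zero]
    have e : homologyMap (0 : X ⟶ X) i = 0 := homologyMap_zero _ _ i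
    exact (IsIso.hom_inv_id (homologyMap (0 : X ⟶ X) i)).symm.trans
      ((congrArg (· ≫ _) e).trans Limits.zero_comp)

theorem HomologicalComplex.Acyclic.of_retract {X Z : CochainComplex (ModuleCat.{u} R) ℤ}
    (hZ : Z.Acyclic) (i : X ⟶ Z) (r : Z ⟶ X) (h : i ≫ r = 𝟙 X) : X.Acyclic := by
  intro n
  have e : homologyMap i n = 0 := (hZ n).isZero_homology.eq_zero_of_tgt _
  rw [exactAt_iff_isZero_homology, Limits.IsZero.iff_id_eq_zero, ← homologyMap_id, ← h,
    homologyMap_comp, e, Limits.zero_comp]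

theorem HomologicalComplex.Acyclic.of_quasiIso {X Y : CochainComplex (ModuleCat.{u} R) ℤ}
    (hX : X.Acyclic) (f : X ⟶ Y) [QuasiIso f] : Y.Acyclic := fun n =>
  (quasiIsoAt_iff_exactAt f n (hX n)).1 inferInstance

namespace SimplicialTotal

variable {K : HomologicalComplex₂ (ModuleCat.{u} R) (ComplexShape.down ℕ) (ComplexShape.up ℤ)}

theorem total_acyclic (hK : ∀ p, (K.X p).Acyclic) : (K.total (ComplexShape.up ℤ)).Acyclic := by
  rw [HomologicalComplex.acyclic_iff_quasiIso_zero]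
  have : ∀ p, QuasiIso ((0 : K ⟶ K).f p) := fun p =>
    (HomologicalComplex.acyclic_iff_quasiIso_zero _).1 (hK p)
  have h := quasiIso_total_map (0 : K ⟶ K)
  have e : HomologicalComplex₂.total.map (0 : K ⟶ K) (ComplexShape.up ℤ) = 0 := by
    refine HomologicalComplex.hom_ext _ _ fun m => hom_ext fun p a h => ?_
    rw [ι_map]
    refine Eq.trans ?_ Limits.comp_zero.symm
    exact Limits.zero_comp
  rwa [e] at h

/-- In general the projection to simplicial degree zero misses the contribution of simplicial degree
one. For a constant functor this contribution is the difference of two equal faces. -/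
theorem d_proj_zero (hK : K.d 1 0 = 0) (m m' : ℤ) (hm : m + 1 = m') :
    (K.total (ComplexShape.up ℤ)).d m m' ≫ proj K 0 m' m' (by simp) =
      proj K 0 m m (by simp) ≫ (K.X 0).d m m' := by
  have h : ((0 : ℕ) : ℤ).negOnePow = 1 := Int.negOnePow_zero
  rw [d_proj 0 m m' m m' (by simp) hm hm, hK, HomologicalComplex.zero_f, Limits.comp_zero, add_zero,
    h, one_smul]

end SimplicialTotal

open SimplicialTotal

namespace CyclicComplex

theorem quasiIso_CH_map {E F : CyclicComplex R} (φ : E ⟶ F) (h : ∀ n, QuasiIso (φ.app n)) :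
    QuasiIso (CH.map φ) := by
  have : ∀ p, QuasiIso ((hochschildBicomplex.map φ).f p) := fun p => h ⟨p⟩
  exact quasiIso_total_map (hochschildBicomplex.map φ)

theorem CH_acyclic {E : CyclicComplex R} (h : E.Acyclic) : (CH.obj E).Acyclic :=
  total_acyclic (K := hochschildBicomplex.obj E) fun p => h ⟨p⟩

variable (Y : CochainComplex (ModuleCat.{u} R) ℤ)

theorem b_const_zero : CyclicObject.b ((Functor.const CyclicCat).obj Y) 0 = 0 := by
  simp [CyclicObject.b]

/-- The inclusion of `Y` in the Hochschild complex of the constant functor. -/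
noncomputable def constInclusion : Y ⟶ CH.obj ((Functor.const CyclicCat).obj Y) where
  f m := ι (hochschildBicomplex.obj ((Functor.const CyclicCat).obj Y)) 0 m m (by simp)
  comm' m m' hm := by
    obtain rfl : m + 1 = m' := hm
    exact ι_d_zero (hochschildBicomplex.obj ((Functor.const CyclicCat).obj Y)) m m (m + 1) (by simp) rfl

/-- The projection of the Hochschild complex of the constant functor to its part of simplicial
degree zero. -/
noncomputable def constProjection : CH.obj ((Functor.const CyclicCat).obj Y) ⟶ Y where
  f m := proj (hochschildBicomplex.obj ((Functor.const CyclicCat).obj Y)) 0 m m (by simp)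
  comm' m m' hm := (d_proj_zero (K := hochschildBicomplex.obj ((Functor.const CyclicCat).obj Y))
    ((hochschildBicomplex_d _ 0).trans (b_const_zero Y)) m m' hm).symm

theorem constInclusion_constProjection : constInclusion Y ≫ constProjection Y = 𝟙 Y :=
  HomologicalComplex.hom_ext _ _ fun m =>
    ι_proj (K := hochschildBicomplex.obj ((Functor.const CyclicCat).obj Y)) 0 m m _

/-- Flatness of `P` only concerns tensor products with functors. A complex Y is made into a constant
functor, and is recovered as a retract of its Hochschild complex, so the acyclicity of CH(P ⊗ Y)
passes to CH(P) ⊗ CH(Y) and then to CH(P) ⊗ Y. -/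
theorem HomotopicallyFlat.CH_obj {P : CyclicComplex R} (hP : P.HomotopicallyFlat) :
    _root_.HomotopicallyFlat (CH.obj P) := fun Y hY => by
  have h := (CH_acyclic (hP ((Functor.const CyclicCat).obj Y) fun _ => hY)).of_quasiIso
    (alexanderWhitney P ((Functor.const CyclicCat).obj Y))
  refine h.of_retract (CH.obj P ◁ constInclusion Y) (CH.obj P ◁ constProjection Y) ?_
  rw [← MonoidalCategory.whiskerLeft_comp, constInclusion_constProjection, whiskerLeft_id]

variable [HasDerivedCategory.{w} (ModuleCat.{u} R)] (E E' : CyclicComplex R)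

/-- Homotopic maps become equal in the derived category, and the compatibility of the localisation
with shifts is natural. -/
theorem toDerived_connesTsygan_alexanderWhitney :
    toDerived (connesTsygan.app (E ⊗ E')) ≫
        (DerivedCategory.Q.map (alexanderWhitney E E'))⟦(-1 : ℤ)⟧' =
      DerivedCategory.Q.map (alexanderWhitney E E') ≫
        (toDerived (tensorShiftLeft (connesTsygan.app E) (CH.obj E')) +
          toDerived (tensorShiftRight (CH.obj E) (connesTsygan.app E'))) := by
  obtain ⟨H⟩ := exists_connesTsygan_homotopy E E'
  have e := DerivedCategory.Q_map_eq_of_homotopy _ H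
  rw [Functor.map_comp, Functor.map_comp, Functor.map_add] at e
  have hc := (DerivedCategory.Q.commShiftIso (-1 : ℤ)).hom.naturality (alexanderWhitney E E')
  rw [toDerived, toDerived, toDerived, ← Preadditive.add_comp, Category.assoc]
  refine (congrArg (_ ≫ ·) hc.symm).trans ?_
  refine (Category.assoc _ _ _).symm.trans (Eq.trans ?_ (Category.assoc _ _ _))
  exact congrArg (· ≫ _) e

end CyclicComplex

theorem comp_eq_of_isIso {C : Type*} [Category* C] {A B A' B' : C} (a : A ≅ B) (a' : A' ≅ B')
    {f : B ⟶ B'} {g : A ⟶ A'} (h : f ≫ a'.inv = a.inv ≫ g) : a.hom ≫ f = g ≫ a'.hom := by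
  rw [← Iso.eq_inv_comp, ← Category.assoc, ← h, Category.assoc, a'.inv_hom_id, Category.comp_id]

end

theorem lemmaB (R : Type u) [CommRing R] [HasDerivedCategory.{w} (ModuleCat.{u} R)]
    (E E' : CyclicComplex R) (ρ : E.FlatResolution) (ρ' : E'.FlatResolution) :
    (QuasiIso (CH.map ρ.hom) ∧ HomotopicallyFlat (CH.obj ρ.obj)) ∧
    (QuasiIso (CH.map ρ'.hom) ∧ HomotopicallyFlat (CH.obj ρ'.obj)) ∧
    ∃ κ : DerivedCategory.Q.obj (CH.obj ρ.obj ⊗ CH.obj ρ'.obj) ≅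
        DerivedCategory.Q.obj (CH.obj (ρ.obj ⊗ ρ'.obj)),
      κ.inv = DerivedCategory.Q.map (alexanderWhitney ρ.obj ρ'.obj) ∧
      κ.hom ≫ toDerived (connesTsygan.app (ρ.obj ⊗ ρ'.obj)) =
        (toDerived (tensorShiftLeft (connesTsygan.app ρ.obj) (CH.obj ρ'.obj)) +
          toDerived (tensorShiftRight (CH.obj ρ.obj) (connesTsygan.app ρ'.obj))) ≫
          κ.hom⟦(-1 : ℤ)⟧' := by
  refine ⟨⟨CyclicComplex.quasiIso_CH_map ρ.hom ρ.quasiIso, CyclicComplex.HomotopicallyFlat.CH_obj ρ.flat⟩,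
    ⟨CyclicComplex.quasiIso_CH_map ρ'.hom ρ'.quasiIso, CyclicComplex.HomotopicallyFlat.CH_obj ρ'.flat⟩,
    -- The isomorphism is taken to be the inverse of the localised Alexander–Whitney map, so the
    -- remaining identity is the one for that map, read backwards.
    (asIso (DerivedCategory.Q.map (alexanderWhitney ρ.obj ρ'.obj))).symm, rfl, ?_⟩
  exact comp_eq_of_isIso _ ((shiftFunctor _ (-1 : ℤ)).mapIso
    (asIso (DerivedCategory.Q.map (alexanderWhitney ρ.obj ρ'.obj))).symm)
    (CyclicComplex.toDerived_connesTsygan_alexanderWhitney ρ.obj ρ'.obj)
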